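/- A set $S$ of vertices of a finite simple graph $G$ is a CVD set if every connected component of $G-S$ is a clique. Cluster Vertex Deletion (CVD) asks, for a graph $G$ and an integer $k\ge 0$, whether $G$ has a CVD set of size at most $k$; its optimization version asks for a CVD set of minimum size. A partition tree of $G$ is a tree $\mathcal T$ whose vertices (the bags) are the parts of a partition of $V(G)$ such that (a) each bag is a clique of $G$; (b) for each edge $XY$ of $\mathcal T$ there are $X'\subseteq X$ and $Y'\subseteq Y$ such that the edges of $G$ between $X$ and $Y$ are exactly the pairs in $X'\times Y'$; (c) there is no edge of $G$ between distinct bags that are not adjacent in $\mathcal T$. A well-partitioned chordal graph is a connected graph that has a partition tree. **Theorem.** There is an algorithm that, given a well-partitioned chordal graph $G$ with $n$ vertices and $m$ edges, a partition tree of $G$, and an integer $k\ge 0$, computes a minimum CVD set of $G$ and decides whether $G$ has a CVD set of size at most $k$, in $O(m^2n)$ time. Precisely, there are a program for the random access machine with words of $O(\log n)$ bits (longer only if needed to hold $k$), the graph and the tree being given by lists of their edges and the partition by the bag of each vertex, and a constant $C$ such that the program halts on every such input after at most $C\,(m^2n+1)$ steps with the correct output. (The summand $1$ matters only for $n=1$,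 $m=0$.) -/

import Mathlib

/-! ### Graphs -/

namespace WPC

/-- `T` is a partition tree of `G`. The parts of the partition of the vertex set are indexed by the
vertices of `T`; the part (bag) with index `X` is the nonempty set `{v | bag v = X}`. -/
structure IsPartitionTree {V P : Type*} (G : SimpleGraph V) (bag : V → P) (T : SimpleGraph P) :
    Prop where
  /-- Parts of a partition are nonempty. -/
  surjective : Function.Surjective bag
  /-- `T` is a tree. -/
  isTree : T.IsTree
  /-- Every bag is a clique. -/
  isClique : ∀ X : P, G.IsClique {v | bag v = X}
  /-- The edges of `G` between adjacent bags `X`, `Y` form a product `X' × Y'`. -/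
  product_of_adj : ∀ X Y : P, T.Adj X Y → ∃ X' Y' : Set V,
    X' ⊆ {v | bag v = X} ∧ Y' ⊆ {v | bag v = Y} ∧
      ∀ x y : V, bag x = X → bag y = Y → (G.Adj x y ↔ x ∈ X' ∧ y ∈ Y')
  /-- There is no edge of `G` between distinct bags that are not adjacent in `T`. -/
  no_edge_of_not_adj : ∀ X Y : P, X ≠ Y → ¬ T.Adj X Y →
    ∀ x y : V, bag x = X → bag y = Y → ¬ G.Adj x y

/-- `G` is a well-partitioned chordal graph: it is connected, and for some partition of its vertex
set (the classes of an equivalence relation) there is a partition tree on the set of classes. -/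
def IsWellPartitionedChordal {V : Type*} (G : SimpleGraph V) : Prop :=
  G.Connected ∧ ∃ (r : Setoid V) (T : SimpleGraph (Quotient r)),
    IsPartitionTree G (fun v => Quotient.mk r v) T

/-- `S` is a CVD set of `G`: every connected component of `G - S` is a clique. -/
def IsCVDSet {V : Type*} (G : SimpleGraph V) (S : Finset V) : Prop :=
  ∀ K : (G.induce {v | v ∉ S}).ConnectedComponent, (G.induce {v | v ∉ S}).IsClique K.supp

/-- `S` is a CVD set of `G` of minimum cardinality. -/
def IsMinimumCVDSet {V : Type*} (G : SimpleGraph V) (S : Finset V) : Prop :=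
  IsCVDSet G S ∧ ∀ S' : Finset V, IsCVDSet G S' → S.card ≤ S'.card

/-- The list `es` contains every edge of `G` exactly once, in some order and with some order of its
two ends, and nothing else. -/
def IsEdgeList {V : Type*} (G : SimpleGraph V) (es : List (V × V)) : Prop :=
  (es.map fun e => s(e.1, e.2)).Nodup ∧
    ∀ e : Sym2 V, e ∈ es.map (fun e => s(e.1, e.2)) ↔ e ∈ G.edgeSet

end WPC

/-! ### Random access machines

A word RAM with structured programs. The machine has registers and arrays (a fixed program mentions
only finitely many of each), holding natural numbers. Arrays are accessed by computed indices.
Every arithmetic operation, comparison, array access, assignment and test costs one step or more.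
The machine has a word capacity `W`: an operation whose result exceeds `W` has no legal execution,
so a program that ever overflows does not have a run. -/

namespace RAM

/-- The binary operations of the machine. -/
inductive Op where
  | add
  | sub
  | mul
  | lt
  | eq

/-- Subtraction is truncated at `0`; comparisons return `1` for true and `0` for false. -/
def Op.eval : Op → ℕ → ℕ → ℕ
  | .add, a, b => a + b
  | .sub, a, b => a - b
  | .mul, a, b => a * b
  | .lt, a, b => if a < b then 1 else 0
  | .eq, a, b => if a = b then 1 else 0

/-- Expressions: constants, registers, array reads, and binary operations. -/
inductive Expr where
  | lit (a : ℕ)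
  | reg (i : ℕ)
  | load (A : ℕ) (index : Expr)
  | op (o : Op) (e f : Expr)

/-- The contents of the registers and of the arrays. -/
structure State where
  reg : ℕ → ℕ
  arr : ℕ → ℕ → ℕ

/-- The value of an expression. -/
def Expr.eval (σ : State) : Expr → ℕ
  | .lit a => a
  | .reg i => σ.reg i
  | .load A e => σ.arr A (e.eval σ)
  | .op o e f => o.eval (e.eval σ) (f.eval σ)

/-- The evaluation of the expression causes no overflow: all constants and all results of
operations are at most `W`. -/
def Expr.Fits (W : ℕ) (σ : State) : Expr → Prop
  | .lit a => a ≤ W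
  | .reg _ => True
  | .load _ e => e.Fits W σ
  | .op o e f => e.Fits W σ ∧ f.Fits W σ ∧ o.eval (e.eval σ) (f.eval σ) ≤ W

/-- The number of steps for the evaluation of an expression: one for each constant, register,
array read and operation in it. -/
def Expr.cost : Expr → ℕ
  | .lit _ => 1
  | .reg _ => 1
  | .load _ e => e.cost + 1
  | .op _ e f => e.cost + f.cost + 1

/-- Programs. -/
inductive Prog where
  | skip
  | assign (i : ℕ) (e : Expr)
  | store (A : ℕ) (index value : Expr)
  | seq (p q : Prog)
  | ite (e : Expr) (p q : Prog)
  | while (e : Expr) (p : Prog)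

/-- `Runs W p σ t τ`: on a machine with word capacity `W`, the program `p` started in state `σ`
halts after exactly `t` steps in state `τ`, without overflow. A test succeeds if its value is not
`0`. -/
inductive Runs (W : ℕ) : Prog → State → ℕ → State → Prop where
  | skip (σ : State) : Runs W .skip σ 1 σ
  | assign (i : ℕ) (e : Expr) (σ : State) (he : e.Fits W σ) :
      Runs W (.assign i e) σ (e.cost + 1) { σ with reg := Function.update σ.reg i (e.eval σ) }
  | store (A : ℕ) (e f : Expr) (σ : State) (he : e.Fits W σ) (hf : f.Fits W σ) :
      Runs W (.store A e f) σ (e.cost + f.cost + 1)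
        { σ with arr := Function.update σ.arr A
                    (Function.update (σ.arr A) (e.eval σ) (f.eval σ)) }
  | seq {p q : Prog} {ρ σ τ : State} {s t : ℕ} (hp : Runs W p ρ s σ) (hq : Runs W q σ t τ) :
      Runs W (.seq p q) ρ (s + t) τ
  | ite_true {e : Expr} {p q : Prog} {σ τ : State} {t : ℕ} (he : e.Fits W σ) (h : e.eval σ ≠ 0)
      (hp : Runs W p σ t τ) : Runs W (.ite e p q) σ (e.cost + 1 + t) τ
  | ite_false {e : Expr} {p q : Prog} {σ τ : State} {t : ℕ} (he : e.Fits W σ) (h : e.eval σ = 0)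
      (hq : Runs W q σ t τ) : Runs W (.ite e p q) σ (e.cost + 1 + t) τ
  | while_true {e : Expr} {p : Prog} {ρ σ τ : State} {s t : ℕ} (he : e.Fits W ρ)
      (h : e.eval ρ ≠ 0) (hp : Runs W p ρ s σ) (hw : Runs W (.while e p) σ t τ) :
      Runs W (.while e p) ρ (e.cost + 1 + s + t) τ
  | while_false {e : Expr} {p : Prog} {σ : State} (he : e.Fits W σ) (h : e.eval σ = 0) :
      Runs W (.while e p) σ (e.cost + 1) σ

end RAM

namespace WPC

/-- The initial state for the instance that consists of a graph on `{0, …, n - 1}` with the list of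
edges `es`, the map `bag` that assigns to each vertex (the index of) its bag, the list `ts` of the
edges of a tree on the set `{0, …, p - 1}` of bags, and a number `k`. All other cells are `0`. -/
def inputState {n p : ℕ} (es : List (Fin n × Fin n)) (bag : Fin n → Fin p)
    (ts : List (Fin p × Fin p)) (k : ℕ) : RAM.State where
  reg := fun i => match i with
    | 0 => n
    | 1 => es.length
    | 2 => p
    | 3 => ts.length
    | 4 => k
    | _ => 0
  arr := fun A j => match A with
    | 0 => (es.map fun e => (e.1 : ℕ)).getD j 0
    | 1 => (es.map fun e => (e.2 : ℕ)).getD j 0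
    | 2 => if h : j < n then (bag ⟨j, h⟩ : ℕ) else 0
    | 3 => (ts.map fun e => (e.1 : ℕ)).getD j 0
    | 4 => (ts.map fun e => (e.2 : ℕ)).getD j 0
    | _ => 0

/-- The state `τ` holds a solution of Cluster Vertex Deletion on `G`: the first `n` cells of array
`0` are the indicator vector of a minimum CVD set of `G`, and register `0` holds `1` or `0` (Yes or
No) according to whether `G` has a CVD set of size at most `k`. -/
def IsSolution {n : ℕ} (G : SimpleGraph (Fin n)) (k : ℕ) (τ : RAM.State) : Prop :=
  (∃ S : Finset (Fin n), IsMinimumCVDSet G S ∧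
    ∀ v : Fin n, (v ∈ S → τ.arr 0 v = 1) ∧ (v ∉ S → τ.arr 0 v = 0)) ∧
  ((∃ S : Finset (Fin n), IsCVDSet G S ∧ S.card ≤ k) → τ.reg 0 = 1) ∧
  ((¬ ∃ S : Finset (Fin n), IsCVDSet G S ∧ S.card ≤ k) → τ.reg 0 = 0)

end WPC

/-!
A set of vertices is a CVD set if and only if its complement `K` induces a *cluster graph*, that
is, contains no induced path on three vertices. Root the partition tree. In a cluster graph `K`,
the kept parts of two adjacent bags either have no edge between them or form one clique; in the
latter case the bags are called merged. A bag is merged with at most one other bag, so that the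
merged pairs form a matching of the tree. The relation of a bag to its parent is described by
three *modes*: in mode `0` only vertices without neighbours in the parent may be kept, in mode `1`
the bag is merged with its parent and only vertices with such neighbours may be kept, in mode `2`
every vertex may be kept, since no neighbour in the parent is. Let `val M X` be the optimum for
the subtree of `X` in mode `M`, up to a constant that depends on `X` only. Keeping a set `L` in
bag `X` costs `val 2 Y - val 0 Y` for each child `Y` in which `L` has neighbours, and `val 2 Z -
val 1 Z` for the merged child `Z`; these losses telescope over the tree, so that the maximum size
of a cluster graph is the sum of the `val 2 X` (`RootedBags.card_le_sum_val`,
`RootedBags.isCluster_and_card`).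

It remains to maximize `|L|` minus the loss of `L`, for a bag, a mode and a choice of `Z`. By the
product structure of the edges between bags, `L` hits either all attached vertices of `Y` or none.
There are at least `val 2 Y - val 0 Y` of them, and if exactly that many are declared active, then
the loss of `L` becomes the number of active neighbours of `L` (`RootedBags.card_active_eq_loss`).
So the maximum is the deficiency of a bipartite graph, namely the number of vertices left
unmatched by a maximum matching of the bag to the active vertices. Such a matching is found by an
auction (`Auction`): unmatched vertices take over a cheapest neighbour and raise its price by one,
as long as there is a price at most the number `N - 1` of bidders. There are at most `N - 1`
vertices of positive price, hence fewer than `N²` bids, and some positive `t ≤ N` is not a price;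
the bidders all of whose neighbours cost more than `t` form an optimal set `L` (`Auction.card_le`,
`Auction.card_eq`). A bag is a clique, so that the number of bids is `O(m)`, and each of them
takes `O(m)` steps. There are at most two jobs (a bag with a choice of `Z`) per bag, one as `X`
without `Z` and one as the child `Z`, which gives `O(m² n)` in total.

The machine does not need the edges of the tree: a breadth-first search along the edges of `G`
that lead to new bags yields a connected spanning subgraph of the tree, which is the tree
(`SearchInv.adj`). Programs are written with bounded loops only (`Cmd`). They have a static time
bound. Apart from the computation of the loop limits, additions only add `1`, so that a cell never
exceeds its initial bound by more than the number of steps. Hence the time bound excludes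
overflow, too (`Cmd.runs`).
-/

/-! ### Bounded-loop programs and their execution -/

namespace RAM

/-- The state `σ` with the content of register `i` replaced by `a`. -/
def State.setReg (σ : State) (i a : ℕ) : State :=
  { σ with reg := Function.update σ.reg i a }

/-- The state `σ` with the content of cell `j` of array `A` replaced by `a`. -/
def State.setArr (σ : State) (A j a : ℕ) : State :=
  { σ with arr := Function.update σ.arr A (Function.update (σ.arr A) j a) }

@[simp] lemma State.setReg_reg (σ : State) (i a r : ℕ) :
    (σ.setReg i a).reg r = if r = i then a else σ.reg r := by
  simp [State.setReg, Function.update_apply]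

@[simp] lemma State.setReg_arr (σ : State) (i a : ℕ) : (σ.setReg i a).arr = σ.arr := rfl

@[simp] lemma State.setArr_reg (σ : State) (A j a : ℕ) : (σ.setArr A j a).reg = σ.reg := rfl

@[simp] lemma State.setArr_arr (σ : State) (A j a B x : ℕ) :
    (σ.setArr A j a).arr B x = if B = A then (if x = j then a else σ.arr B x) else σ.arr B x := by
  by_cases h : B = A
  · subst h
    simp [State.setArr, Function.update_apply]
  · simp [State.setArr, h]

lemma State.setArr_arr_ne (σ : State) {A B : ℕ} (j a : ℕ) (h : B ≠ A) :
    (σ.setArr A j a).arr B = σ.arr B := by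
  simp [State.setArr, h]

/-- All cells other than register `4` contain at most `M`. Register `4` holds the parameter `k` of
the instance, which is not bounded in terms of the graph. -/
def State.BoundedBy (σ : State) (M : ℕ) : Prop :=
  (∀ i, i ≠ 4 → σ.reg i ≤ M) ∧ ∀ A j, σ.arr A j ≤ M

lemma State.BoundedBy.mono {σ : State} {M M' : ℕ} (h : σ.BoundedBy M) (hM : M ≤ M') :
    σ.BoundedBy M' :=
  ⟨fun i hi => (h.1 i hi).trans hM, fun A j => (h.2 A j).trans hM⟩

lemma State.BoundedBy.setReg {σ : State} {M a : ℕ} (h : σ.BoundedBy M) (i : ℕ) (ha : a ≤ M) :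
    (σ.setReg i a).BoundedBy M := by
  refine ⟨fun r hr => ?_, h.2⟩
  rw [State.setReg_reg]
  split_ifs
  · exact ha
  · exact h.1 r hr

lemma State.BoundedBy.setArr {σ : State} {M a : ℕ} (h : σ.BoundedBy M) (A j : ℕ) (ha : a ≤ M) :
    (σ.setArr A j a).BoundedBy M := by
  refine ⟨h.1, fun B x => ?_⟩
  rw [State.setArr_arr]
  split_ifs
  · exact ha
  · exact h.2 B x
  · exact h.2 B x

lemma Op.eval_lt_le_one (a b : ℕ) : Op.lt.eval a b ≤ 1 := by
  simp only [Op.eval]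
  split_ifs <;> simp

namespace Expr

/-- The operation at the root of the expression produces a truth value. -/
def isBool : Expr → Bool
  | op .lt _ _ => true
  | op .eq _ _ => true
  | op .mul e f => e.isBool && f.isBool
  | _ => false

/-- The expression is the constant `1`. -/
def isOne : Expr → Bool
  | lit a => a == 1
  | _ => false

/-- The expression is register `4`. -/
def isParam : Expr → Bool
  | reg i => i == 4
  | _ => false

/-- Expressions whose value exceeds the contents of the cells by at most their cost: only `1` may
be added, only truth values may be multiplied, and register `4` may only be compared. -/
def ok : Expr → Bool
  | lit a => decide (a ≤ 3)
  | reg i => i != 4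
  | load _ e => e.ok
  | op .add e f => e.ok && f.isOne
  | op .sub e f => e.ok && f.ok
  | op .mul e f => e.ok && f.ok && e.isBool && f.isBool
  | op .lt e f => (e.ok || e.isParam) && f.ok
  | op .eq e f => e.ok && f.ok

/-- The expression reads register `r`. -/
def readsReg (r : ℕ) : Expr → Bool
  | lit _ => false
  | reg i => i == r
  | load _ e => e.readsReg r
  | op _ e f => e.readsReg r || f.readsReg r

/-- The expression reads array `A`. -/
def readsArr (A : ℕ) : Expr → Bool
  | lit _ => false
  | reg _ => false
  | load B e => B == A || e.readsArr A
  | op _ e f => e.readsArr A || f.readsArr A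

lemma eval_le_one_of_isBool (σ : State) : ∀ e : Expr, e.isBool = true → e.eval σ ≤ 1
  | lit _, h => by simp [isBool] at h
  | reg _, h => by simp [isBool] at h
  | load _ _, h => by simp [isBool] at h
  | op .add _ _, h => by simp [isBool] at h
  | op .sub _ _, h => by simp [isBool] at h
  | op .lt _ _, _ => by simp only [eval, Op.eval]; split_ifs <;> simp
  | op .eq _ _, _ => by simp only [eval, Op.eval]; split_ifs <;> simp
  | op .mul e f, h => by
      simp only [isBool, Bool.and_eq_true] at h
      simpa [eval, Op.eval] using
        Nat.mul_le_mul (eval_le_one_of_isBool σ e h.1) (eval_le_one_of_isBool σ f h.2)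

/-- The value of an admissible expression exceeds the contents of the cells by at most its cost, and
so do all intermediate results. This is what makes overflow a matter of running time. -/
lemma eval_le_and_fits {σ : State} {M W : ℕ} (hσ : σ.BoundedBy M) (hM : 3 ≤ M) :
    ∀ e : Expr, e.ok = true → M + e.cost ≤ W → e.eval σ ≤ M + e.cost ∧ e.Fits W σ
  | lit a, h, hW => by
      simp only [ok, decide_eq_true_eq] at h
      simp only [eval, Fits, cost] at *
      omega
  | reg i, h, hW => by
      simp only [ok, bne_iff_ne, ne_eq] at h
      have := hσ.1 i h
      simp only [eval, Fits, cost, and_true]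
      omega
  | load A e, h, hW => by
      simp only [ok] at h
      simp only [cost] at hW
      have := hσ.2 A (e.eval σ)
      refine ⟨by simp only [eval, cost]; omega, ?_⟩
      exact (eval_le_and_fits (W := W) hσ hM e h (by omega)).2
  | op .add e f, h, hW => by
      simp only [ok, Bool.and_eq_true] at h
      simp only [cost] at hW
      have he := eval_le_and_fits (W := W) hσ hM e h.1 (by omega)
      cases f with
      | lit a =>
        have ha : a = 1 := by simpa [isOne] using h.2
        subst ha
        simp only [cost] at hW
        simp only [eval, Op.eval, cost, Fits]
        refine ⟨by omega, he.2, by omega, by omega⟩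
      | _ => simp [isOne] at h
  | op .sub e f, h, hW => by
      simp only [ok, Bool.and_eq_true] at h
      simp only [cost] at hW
      have he := eval_le_and_fits (W := W) hσ hM e h.1 (by omega)
      have hf := eval_le_and_fits (W := W) hσ hM f h.2 (by omega)
      simp only [eval, Op.eval, cost, Fits]
      exact ⟨by omega, he.2, hf.2, by omega⟩
  | op .mul e f, h, hW => by
      simp only [ok, Bool.and_eq_true] at h
      simp only [cost] at hW
      have he := eval_le_and_fits (W := W) hσ hM e h.1.1.1 (by omega)
      have hf := eval_le_and_fits (W := W) hσ hM f h.1.1.2 (by omega)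
      have h1 : (op .mul e f).eval σ ≤ 1 :=
        eval_le_one_of_isBool σ _ (by simp [isBool, h.1.2, h.2])
      refine ⟨by omega, he.2, hf.2, ?_⟩
      simp only [eval] at h1
      omega
  | op .lt e f, h, hW => by
      simp only [ok, Bool.and_eq_true, Bool.or_eq_true] at h
      simp only [cost] at hW
      have hf := eval_le_and_fits (W := W) hσ hM f h.2 (by omega)
      have h1 : (op .lt e f).eval σ ≤ 1 := eval_le_one_of_isBool σ _ rfl
      have he : e.Fits W σ := by
        rcases h.1 with he | he
        · exact (eval_le_and_fits (W := W) hσ hM e he (by omega)).2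
        · cases e with
          | reg i => simp [Fits]
          | _ => simp [isParam] at he
      refine ⟨by omega, he, hf.2, ?_⟩
      simp only [eval] at h1
      omega
  | op .eq e f, h, hW => by
      simp only [ok, Bool.and_eq_true] at h
      simp only [cost] at hW
      have he := eval_le_and_fits (W := W) hσ hM e h.1 (by omega)
      have hf := eval_le_and_fits (W := W) hσ hM f h.2 (by omega)
      have h1 : (op .eq e f).eval σ ≤ 1 := eval_le_one_of_isBool σ _ rfl
      refine ⟨by omega, he.2, hf.2, ?_⟩
      simp only [eval] at h1
      omega

/-- The value of an expression depends only on the cells that it reads. -/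
lemma eval_congr {σ τ : State} : ∀ e : Expr, (∀ r, e.readsReg r = true → σ.reg r = τ.reg r) →
    (∀ A, e.readsArr A = true → σ.arr A = τ.arr A) → e.eval σ = e.eval τ
  | lit _, _, _ => rfl
  | reg i, h, _ => h i (by simp [readsReg])
  | load A e, h, h' => by
      have he := eval_congr e (fun r hr => h r (by simpa [readsReg] using hr))
        (fun B hB => h' B (by simp [readsArr, hB]))
      simp only [eval, he, h' A (by simp [readsArr])]
  | op o e f, h, h' => by
      have he := eval_congr e (fun r hr => h r (by simp [readsReg, hr]))
        (fun B hB => h' B (by simp [readsArr, hB]))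
      have hf := eval_congr f (fun r hr => h r (by simp [readsReg, hr]))
        (fun B hB => h' B (by simp [readsArr, hB]))
      simp only [eval, he, hf]

/-- The truth of an expression used as a test. -/
def Holds (e : Expr) (σ : State) : Prop := e.eval σ ≠ 0

instance (e : Expr) (σ : State) : Decidable (e.Holds σ) :=
  inferInstanceAs (Decidable (e.eval σ ≠ 0))

/-- Conjunction of tests. -/
def and (e f : Expr) : Expr := op .mul e f

/-- Negation of a test. -/
def not (e : Expr) : Expr := op .eq e (lit 0)

/-- Disjunction of tests. -/
def or (e f : Expr) : Expr := not (and (not e) (not f))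

@[simp] lemma holds_and (e f : Expr) (σ : State) : (and e f).Holds σ ↔ e.Holds σ ∧ f.Holds σ := by
  simp [Holds, and, eval, Op.eval]

@[simp] lemma holds_not (e : Expr) (σ : State) : (not e).Holds σ ↔ ¬ e.Holds σ := by
  simp only [Holds, not, eval, Op.eval]
  split_ifs with h <;> simp [h]

@[simp] lemma holds_or (e f : Expr) (σ : State) : (or e f).Holds σ ↔ e.Holds σ ∨ f.Holds σ := by
  simp only [or, holds_not, holds_and]
  tauto

@[simp] lemma holds_lt (e f : Expr) (σ : State) :
    (op .lt e f).Holds σ ↔ e.eval σ < f.eval σ := by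
  simp [Holds, eval, Op.eval]

@[simp] lemma holds_eq (e f : Expr) (σ : State) :
    (op .eq e f).Holds σ ↔ e.eval σ = f.eval σ := by
  simp [Holds, eval, Op.eval]

@[simp] lemma eval_lit (σ : State) (a : ℕ) : (lit a).eval σ = a := rfl
@[simp] lemma eval_reg (σ : State) (i : ℕ) : (reg i).eval σ = σ.reg i := rfl
@[simp] lemma eval_load (σ : State) (A : ℕ) (e : Expr) :
    (load A e).eval σ = σ.arr A (e.eval σ) := rfl
@[simp] lemma eval_add (σ : State) (e f : Expr) :
    (op .add e f).eval σ = e.eval σ + f.eval σ := rfl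
@[simp] lemma eval_sub (σ : State) (e f : Expr) :
    (op .sub e f).eval σ = e.eval σ - f.eval σ := rfl
lemma eval_eq (σ : State) (e f : Expr) :
    (op .eq e f).eval σ = if e.eval σ = f.eval σ then 1 else 0 := rfl
lemma eval_lt (σ : State) (e f : Expr) :
    (op .lt e f).eval σ = if e.eval σ < f.eval σ then 1 else 0 := rfl

end Expr

/-- Programs whose only loops are counting loops: `loop i N c` executes `c` for the values
`0, 1, …, N - 1` of register `i`, where `N` stands for the content of register `N`. -/
inductive Cmd where
  | skip
  | assign (i : ℕ) (e : Expr)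
  | store (A : ℕ) (index value : Expr)
  | seq (c d : Cmd)
  | ite (e : Expr) (c d : Cmd)
  | loop (i N : ℕ) (c : Cmd)

namespace Cmd

/-- Sequential composition. -/
infixr:60 " ;; " => Cmd.seq

/-- The translation to programs of the machine. -/
def toProg : Cmd → Prog
  | skip => .skip
  | assign i e => .assign i e
  | store A e f => .store A e f
  | seq c d => .seq c.toProg d.toProg
  | ite e c d => .ite e c.toProg d.toProg
  | loop i N c => .seq (.assign i (.lit 0)) (.while (.op .lt (.reg i) (.reg N))
      (.seq c.toProg (.assign i (.op .add (.reg i) (.lit 1)))))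

/-- The state after execution. -/
def run : Cmd → State → State
  | skip, σ => σ
  | assign i e, σ => σ.setReg i (e.eval σ)
  | store A e f, σ => σ.setArr A (e.eval σ) (f.eval σ)
  | seq c d, σ => d.run (c.run σ)
  | ite e c d, σ => if e.Holds σ then c.run σ else d.run σ
  | loop i N c, σ =>
      Nat.rec (σ.setReg i 0) (fun t τ => (c.run τ).setReg i (t + 1)) (σ.reg N)

/-- An upper bound for the number of steps, if `ρ N` bounds the content of every register `N` that
serves as the limit of a loop. -/
def time (ρ : ℕ → ℕ) : Cmd → ℕ
  | skip => 1
  | assign _ e => e.cost + 1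
  | store _ e f => e.cost + f.cost + 1
  | seq c d => c.time ρ + d.time ρ
  | ite e c d => e.cost + 1 + (c.time ρ + d.time ρ)
  | loop _ N c => 6 + ρ N * (c.time ρ + 8)

/-- The command may write register `r`. -/
def writesReg (r : ℕ) : Cmd → Bool
  | skip => false
  | assign i _ => i == r
  | store _ _ _ => false
  | seq c d => c.writesReg r || d.writesReg r
  | ite _ c d => c.writesReg r || d.writesReg r
  | loop i _ c => i == r || c.writesReg r

/-- The command may write array `A`. -/
def writesArr (A : ℕ) : Cmd → Bool
  | skip => false
  | assign _ _ => false
  | store B _ _ => B == A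
  | seq c d => c.writesArr A || d.writesArr A
  | ite _ c d => c.writesArr A || d.writesArr A
  | loop _ _ c => c.writesArr A

/-- The registers that serve as limits of loops. -/
def limits : Cmd → List ℕ
  | skip => []
  | assign _ _ => []
  | store _ _ _ => []
  | seq c d => c.limits ++ d.limits
  | ite _ c d => c.limits ++ d.limits
  | loop _ N c => N :: c.limits

/-- Syntactic conditions under which a command runs in time `time` without overflow: expressions
grow slowly, counters and limits of loops are not written in the body, and no limit is changed
before its loop is executed. -/
def good : Cmd → Bool
  | skip => true
  | assign i e => i != 4 && e.ok
  | store _ e f => e.ok && f.ok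
  | seq c d => c.good && d.good && d.limits.all fun N => !c.writesReg N
  | ite e c d => e.ok && c.good && d.good
  | loop i N c => i != 4 && N != 4 && i != N && c.good && !c.writesReg i && !c.writesReg N &&
      c.limits.all fun L => !c.writesReg L && L != i

lemma run_loop_eq (i N : ℕ) (c : Cmd) (σ : State) :
    (loop i N c).run σ =
      Nat.rec (σ.setReg i 0) (fun t τ => (c.run τ).setReg i (t + 1)) (σ.reg N) := rfl

@[simp] lemma run_skip (σ : State) : skip.run σ = σ := rfl
@[simp] lemma run_assign (i : ℕ) (e : Expr) (σ : State) :
    (assign i e).run σ = σ.setReg i (e.eval σ) := rfl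
@[simp] lemma run_store (A : ℕ) (e f : Expr) (σ : State) :
    (store A e f).run σ = σ.setArr A (e.eval σ) (f.eval σ) := rfl
@[simp] lemma run_seq (c d : Cmd) (σ : State) : (c ;; d).run σ = d.run (c.run σ) := rfl
@[simp] lemma run_ite (e : Expr) (c d : Cmd) (σ : State) :
    (ite e c d).run σ = if e.Holds σ then c.run σ else d.run σ := rfl

lemma run_reg : ∀ (c : Cmd) (σ : State) {r : ℕ}, c.writesReg r = false →
    (c.run σ).reg r = σ.reg r
  | skip, _, _, _ => rfl
  | assign i e, σ, r, h => by
      simp only [writesReg, beq_eq_false_iff_ne, ne_eq] at h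
      simp [Ne.symm h]
  | store _ _ _, _, _, _ => rfl
  | seq c d, σ, r, h => by
      simp only [writesReg, Bool.or_eq_false_iff] at h
      rw [run_seq, run_reg d _ h.2, run_reg c _ h.1]
  | ite e c d, σ, r, h => by
      simp only [writesReg, Bool.or_eq_false_iff] at h
      rw [run_ite]
      split_ifs
      · exact run_reg c _ h.1
      · exact run_reg d _ h.2
  | loop i N c, σ, r, h => by
      simp only [writesReg, Bool.or_eq_false_iff, beq_eq_false_iff_ne, ne_eq] at h
      rw [run_loop_eq]
      induction σ.reg N with
      | zero => simp [Ne.symm h.1]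
      | succ t ih =>
        simp only [State.setReg_reg, Ne.symm h.1, if_false]
        rw [run_reg c _ h.2, ih]

lemma run_arr : ∀ (c : Cmd) (σ : State) {A : ℕ}, c.writesArr A = false →
    (c.run σ).arr A = σ.arr A
  | skip, _, _, _ => rfl
  | assign _ _, _, _, _ => rfl
  | store B e f, σ, A, h => by
      simp only [writesArr, beq_eq_false_iff_ne, ne_eq] at h
      exact State.setArr_arr_ne _ _ _ (Ne.symm h)
  | seq c d, σ, r, h => by
      simp only [writesArr, Bool.or_eq_false_iff] at h
      rw [run_seq, run_arr d _ h.2, run_arr c _ h.1]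
  | ite e c d, σ, r, h => by
      simp only [writesArr, Bool.or_eq_false_iff] at h
      rw [run_ite]
      split_ifs
      · exact run_arr c _ h.1
      · exact run_arr d _ h.2
  | loop i N c, σ, r, h => by
      simp only [writesArr] at h
      rw [run_loop_eq]
      induction σ.reg N with
      | zero => simp
      | succ t ih =>
        simp only [State.setReg_arr]
        rw [run_arr c _ h, ih]

/-- The states `σ` and `τ` agree on all cells that `c` does not write. -/
def Frame (c : Cmd) (σ τ : State) : Prop :=
  (∀ r, c.writesReg r = false → τ.reg r = σ.reg r) ∧
    ∀ A, c.writesArr A = false → τ.arr A = σ.arr A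

lemma frame_run (c : Cmd) (σ : State) : c.Frame σ (c.run σ) :=
  ⟨fun _ h => c.run_reg σ h, fun _ h => c.run_arr σ h⟩

/-- Induction over the iterations of a loop. Each iteration starts in a state that agrees with the
initial state outside of the cells that the loop writes. -/
lemma run_loop_induction {i N : ℕ} {c : Cmd} {σ : State} (P : ℕ → State → Prop)
    (h0 : P 0 (σ.setReg i 0))
    (hs : ∀ t τ, t < σ.reg N → τ.reg i = t → (loop i N c).Frame σ τ → P t τ →
      P (t + 1) ((c.run τ).setReg i (t + 1))) :
    P (σ.reg N) ((loop i N c).run σ) := by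
  rw [run_loop_eq]
  have key : ∀ T, T ≤ σ.reg N → P T (Nat.rec (motive := fun _ => State) (σ.setReg i 0)
        (fun t τ => (c.run τ).setReg i (t + 1)) T) ∧
      (Nat.rec (motive := fun _ => State) (σ.setReg i 0)
        (fun t τ => (c.run τ).setReg i (t + 1)) T).reg i = T ∧
      (loop i N c).Frame σ (Nat.rec (motive := fun _ => State) (σ.setReg i 0)
        (fun t τ => (c.run τ).setReg i (t + 1)) T) := by
    intro T
    induction T with
    | zero =>
      intro _
      refine ⟨h0, by simp, fun r hr => ?_, fun A _ => rfl⟩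
      simp only [writesReg, Bool.or_eq_false_iff, beq_eq_false_iff_ne, ne_eq] at hr
      simp [Ne.symm hr.1]
    | succ T ih =>
      intro hT
      obtain ⟨h1, h2, h3⟩ := ih (by omega)
      refine ⟨hs T _ (by omega) h2 h3 h1, by simp, fun r hr => ?_, fun A hA => ?_⟩
      · have hr' := hr
        simp only [writesReg, Bool.or_eq_false_iff, beq_eq_false_iff_ne, ne_eq] at hr
        simp only [State.setReg_reg, Ne.symm hr.1, if_false]
        rw [run_reg c _ hr.2, h3.1 r hr']
      · have hA' := hA
        simp only [writesArr] at hA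
        simp only [State.setReg_arr]
        rw [run_arr c _ hA, h3.2 A hA']
  exact (key _ le_rfl).1

/-- A good command runs within its time bound, and without overflow if the words are large compared
to the initial contents of the cells and the time bound. -/
theorem runs (ρ : ℕ → ℕ) {W : ℕ} : ∀ (c : Cmd) (σ : State) (M : ℕ), c.good = true →
    σ.BoundedBy M → 3 ≤ M → (∀ N ∈ c.limits, σ.reg N ≤ ρ N) → M + c.time ρ ≤ W →
    (∃ t ≤ c.time ρ, Runs W c.toProg σ t (c.run σ)) ∧ (c.run σ).BoundedBy (M + c.time ρ)
  | skip, σ, M, _, hσ, _, _, _ => ⟨⟨1, le_rfl, .skip σ⟩, hσ.mono (by omega)⟩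
  | assign i e, σ, M, hc, hσ, hM, _, hW => by
      simp only [good, Bool.and_eq_true] at hc
      simp only [time] at hW ⊢
      have he := Expr.eval_le_and_fits (W := W) hσ hM e hc.2 (by omega)
      exact ⟨⟨_, le_rfl, .assign i e σ he.2⟩, (hσ.mono (by omega)).setReg i (by omega)⟩
  | store A e f, σ, M, hc, hσ, hM, _, hW => by
      simp only [good, Bool.and_eq_true] at hc
      simp only [time] at hW ⊢
      have he := Expr.eval_le_and_fits (W := W) hσ hM e hc.1 (by omega)
      have hf := Expr.eval_le_and_fits (W := W) hσ hM f hc.2 (by omega)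
      exact ⟨⟨_, le_rfl, .store A e f σ he.2 hf.2⟩, (hσ.mono (by omega)).setArr A _ (by omega)⟩
  | seq c d, σ, M, hc, hσ, hM, hρ, hW => by
      simp only [good, Bool.and_eq_true, List.all_eq_true, Bool.not_eq_true'] at hc
      simp only [limits, List.mem_append] at hρ
      simp only [time] at hW ⊢
      obtain ⟨⟨s, hs, hc1⟩, hb⟩ := runs (W := W) ρ c σ M hc.1.1 hσ hM (fun N hN => hρ N (.inl hN)) (by omega)
      obtain ⟨⟨t, ht, hd1⟩, hb'⟩ := runs (W := W) ρ d (c.run σ) _ hc.1.2 hb (by omega)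
        (fun N hN => by rw [run_reg c _ (hc.2 N hN)]; exact hρ N (.inr hN)) (by omega)
      exact ⟨⟨s + t, by omega, .seq hc1 hd1⟩, hb'.mono (by omega)⟩
  | ite e c d, σ, M, hc, hσ, hM, hρ, hW => by
      simp only [good, Bool.and_eq_true] at hc
      simp only [limits, List.mem_append] at hρ
      simp only [time] at hW ⊢
      have he := Expr.eval_le_and_fits (W := W) hσ hM e hc.1.1 (by omega)
      rw [run_ite]
      split_ifs with h
      · obtain ⟨⟨s, hs, hr⟩, hb⟩ := runs (W := W) ρ c σ M hc.1.2 hσ hM (fun N hN => hρ N (.inl hN)) (by omega)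
        exact ⟨⟨_, by omega, .ite_true he.2 h hr⟩, hb.mono (by omega)⟩
      · obtain ⟨⟨s, hs, hr⟩, hb⟩ := runs (W := W) ρ d σ M hc.2 hσ hM (fun N hN => hρ N (.inr hN)) (by omega)
        exact ⟨⟨_, by omega, .ite_false he.2 (by simpa [Expr.Holds] using h) hr⟩,
          hb.mono (by omega)⟩
  | loop i N c, σ, M, hc, hσ, hM, hρ, hW => by
      simp only [good, Bool.and_eq_true, Bool.not_eq_true', List.all_eq_true, bne_iff_ne,
        ne_eq] at hc
      obtain ⟨⟨⟨⟨⟨⟨hi4, hN4⟩, hiN⟩, hc⟩, hci⟩, hcN⟩, hcL⟩ := hc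
      simp only [limits, List.mem_cons] at hρ
      simp only [time] at hW ⊢
      set B := c.time ρ with hB
      have hlim : ∀ L ∈ N :: c.limits, c.writesReg L = false ∧ L ≠ i := by
        intro L hL
        rcases List.mem_cons.1 hL with rfl | hL
        · exact ⟨hcN, Ne.symm hiN⟩
        · exact hcL L hL
      have hmain : ∀ s T (τ : State) (M' : ℕ), T + s = σ.reg N → τ.reg i = T →
          (∀ L ∈ N :: c.limits, τ.reg L = σ.reg L) → τ.BoundedBy M' → 3 ≤ M' →
          M' + (s * (B + 8) + 4) ≤ W →
          (∃ t ≤ s * (B + 8) + 4, Runs W (.while (.op .lt (.reg i) (.reg N))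
            (.seq c.toProg (.assign i (.op .add (.reg i) (.lit 1))))) τ t
            (Nat.rec (motive := fun _ => ℕ → State → State) (fun _ τ => τ)
              (fun _ f T τ => f (T + 1) ((c.run τ).setReg i (T + 1))) s T τ)) ∧
          (Nat.rec (motive := fun _ => ℕ → State → State) (fun _ τ => τ)
              (fun _ f T τ => f (T + 1) ((c.run τ).setReg i (T + 1))) s T τ : State).BoundedBy
            (M' + (s * (B + 8) + 4)) := by
        intro s
        induction s with
        | zero =>
          intro T τ M' hTs hT hL hb h3 hW'
          refine ⟨⟨4, by omega, ?_⟩, hb.mono (by omega)⟩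
          refine .while_false ⟨trivial, trivial, ?_⟩ ?_
          · exact (Op.eval_lt_le_one _ _).trans (by omega)
          · have := hL N (by simp)
            have h : ¬ τ.reg i < τ.reg N := by omega
            simp [Expr.eval, Op.eval, h]
        | succ s ih =>
          intro T τ M' hTs hT hL hb h3 hW'
          have e1 : (s + 1) * (B + 8) = s * (B + 8) + (B + 8) := by ring
          rw [e1] at hW' ⊢
          obtain ⟨⟨t1, ht1, hr1⟩, hb1⟩ := runs (W := W) ρ c τ M' hc hb h3
            (fun L hL' => by rw [hL L (by simp [hL'])]; exact hρ L (.inr hL')) (by omega)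
          have hci' : (c.run τ).reg i = T := by rw [run_reg c _ hci, hT]
          have hb2 : ((c.run τ).setReg i (T + 1)).BoundedBy (M' + B + 1) := by
            refine (hb1.mono (by omega)).setReg i ?_
            have := hb.1 i hi4
            omega
          obtain ⟨⟨t2, ht2, hr2⟩, hb3⟩ := ih (T + 1) ((c.run τ).setReg i (T + 1)) (M' + B + 1)
            (by omega) (by simp) (fun L hL' => by
              simp only [State.setReg_reg, (hlim L hL').2, if_false]
              rw [run_reg c _ (hlim L hL').1, hL L hL']) hb2 (by omega) (by omega)
          have hinc : Runs W (.assign i (.op .add (.reg i) (.lit 1))) (c.run τ) 4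
              ((c.run τ).setReg i (T + 1)) := by
            have := Runs.assign (W := W) i (.op .add (.reg i) (.lit 1)) (c.run τ)
              ⟨trivial, by simp only [Expr.Fits]; omega, by
                simp only [Op.eval, Expr.eval, hci']
                have := hb.1 i hi4
                omega⟩
            simpa [Expr.eval, Op.eval, hci', State.setReg, Expr.cost] using this
          refine ⟨⟨3 + 1 + (t1 + 4) + t2, by omega, ?_⟩, hb3.mono (by omega)⟩
          refine .while_true ⟨trivial, trivial, ?_⟩ ?_ (.seq hr1 hinc) hr2
          · exact (Op.eval_lt_le_one _ _).trans (by omega)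
          · have := hL N (by simp)
            have h : τ.reg i < τ.reg N := by omega
            simp [Expr.eval, Op.eval, h]
      have hNρ : σ.reg N ≤ ρ N := hρ N (.inl rfl)
      have hmul : σ.reg N * (B + 8) ≤ ρ N * (B + 8) := Nat.mul_le_mul_right _ hNρ
      obtain ⟨⟨t, ht, hr⟩, hb⟩ := hmain (σ.reg N) 0 (σ.setReg i 0) M (by omega) (by simp)
        (fun L hL => by simp [(hlim L hL).2]) (hσ.setReg i (by omega)) hM (by omega)
      have hrec : ∀ s T (τ : State), (Nat.rec (motive := fun _ => ℕ → State → State) (fun _ τ => τ)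
              (fun _ f T τ => f (T + 1) ((c.run τ).setReg i (T + 1))) s T τ : State) =
            Nat.rec (motive := fun _ => State) τ
              (fun t τ => (c.run τ).setReg i (T + t + 1)) s := by
        intro s
        induction s with
        | zero => intros; rfl
        | succ s ih =>
          intro T τ
          refine (ih (T + 1) _).trans ?_
          clear ih
          induction s with
          | zero => rfl
          | succ s ih =>
            refine Eq.trans (congrArg (fun τ => (c.run τ).setReg i (T + 1 + s + 1)) ih) ?_
            rw [show T + 1 + s + 1 = T + (s + 1) + 1 by omega]
      rw [hrec] at hr hb
      simp only [zero_add] at hr hb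
      refine ⟨⟨2 + t, by omega, ?_⟩, hb.mono (by omega)⟩
      have h0 := Runs.assign (W := W) i (.lit 0) σ (by simp [Expr.Fits])
      exact .seq h0 hr

/-! ### Loops of special forms -/

/-- A loop that stores in cell `j` of array `A` the value of `e`, for all `j` that satisfy the
test `q`. -/
lemma run_loop_map {i N A : ℕ} {q e : Expr} (σ : State) (hq : q.readsArr A = false)
    (he : e.readsArr A = false) :
    ((loop i N (ite q (store A (.reg i) e) skip)).run σ).arr A =
      fun v => if v < σ.reg N ∧ q.Holds (σ.setReg i v) then e.eval (σ.setReg i v)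
        else σ.arr A v := by
  refine run_loop_induction (P := fun t τ => τ.arr A =
      fun v => if v < t ∧ q.Holds (σ.setReg i v) then e.eval (σ.setReg i v) else σ.arr A v)
    (by simp) ?_
  intro t τ ht hi hF hP
  have hcongr : ∀ f : Expr, f.readsArr A = false → f.eval τ = f.eval (σ.setReg i t) := by
    intro f hf
    refine Expr.eval_congr f (fun r _ => ?_) (fun B hB => ?_)
    · rw [State.setReg_reg]
      split_ifs with h
      · rw [h, hi]
      · exact hF.1 r (by simp [writesReg, Ne.symm h])
    · rw [State.setReg_arr]
      refine hF.2 B ?_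
      have : A ≠ B := by
        rintro rfl
        simp [hf] at hB
      simp [writesArr, this]
  have hq' : q.Holds τ ↔ q.Holds (σ.setReg i t) := by simp only [Expr.Holds, hcongr q hq]
  funext v
  simp only [run_ite, State.setReg_arr, hq']
  by_cases h : q.Holds (σ.setReg i t)
  · simp only [h, if_true, run_store, State.setArr_arr, Expr.eval_reg, hi, hcongr e he, hP]
    rcases lt_trichotomy v t with hv | rfl | hv
    · simp [hv.ne, hv, Nat.lt_succ_of_lt hv]
    · simp [h]
    · simp [hv.ne', not_lt.2 hv.le, show ¬ v < t + 1 by omega]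
  · simp only [h, if_false, run_skip, hP]
    rcases lt_trichotomy v t with hv | rfl | hv
    · simp [hv, Nat.lt_succ_of_lt hv]
    · simp [h]
    · simp [not_lt.2 hv.le, show ¬ v < t + 1 by omega]

/-- A loop that stores the constant `a` in the cells of array `A` whose index is the value of `x`
for some value of the counter that satisfies the test `q`. -/
lemma run_loop_mark {i N A a : ℕ} {q x : Expr} (σ : State) (hq : q.readsArr A = false)
    (hx : x.readsArr A = false) (v : ℕ) :
    ((loop i N (ite q (store A x (.lit a)) skip)).run σ).arr A v =
      if ∃ j < σ.reg N, q.Holds (σ.setReg i j) ∧ x.eval (σ.setReg i j) = v then a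
        else σ.arr A v := by
  refine run_loop_induction (P := fun t τ => τ.arr A v =
      if ∃ j < t, q.Holds (σ.setReg i j) ∧ x.eval (σ.setReg i j) = v then a else σ.arr A v)
    (by simp) ?_
  intro t τ ht hi hF hP
  have hcongr : ∀ f : Expr, f.readsArr A = false → f.eval τ = f.eval (σ.setReg i t) := by
    intro f hf
    refine Expr.eval_congr f (fun r _ => ?_) (fun B hB => ?_)
    · rw [State.setReg_reg]
      split_ifs with h
      · rw [h, hi]
      · exact hF.1 r (by simp [writesReg, Ne.symm h])
    · rw [State.setReg_arr]
      refine hF.2 B ?_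
      have : A ≠ B := by
        rintro rfl
        simp [hf] at hB
      simp [writesArr, this]
  have hq' : q.Holds τ ↔ q.Holds (σ.setReg i t) := by simp only [Expr.Holds, hcongr q hq]
  have hex : (∃ j < t + 1, q.Holds (σ.setReg i j) ∧ x.eval (σ.setReg i j) = v) ↔
      (q.Holds (σ.setReg i t) ∧ x.eval (σ.setReg i t) = v) ∨
        ∃ j < t, q.Holds (σ.setReg i j) ∧ x.eval (σ.setReg i j) = v := by
    constructor
    · rintro ⟨j, hj, h⟩
      rcases Nat.lt_succ_iff_lt_or_eq.1 hj with hj | rfl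
      · exact .inr ⟨j, hj, h⟩
      · exact .inl h
    · rintro (h | ⟨j, hj, h⟩)
      · exact ⟨t, by omega, h⟩
      · exact ⟨j, by omega, h⟩
  simp only [run_ite, State.setReg_arr, hq', hex]
  by_cases h : q.Holds (σ.setReg i t)
  · simp only [h, if_true, run_store, State.setArr_arr, hcongr x hx, hP, true_and,
      Expr.eval_lit]
    by_cases hv : x.eval (σ.setReg i t) = v
    · simp [hv]
    · simp [hv, Ne.symm hv]
  · simp only [h, if_false, run_skip, hP, false_and, false_or]

/-- A loop that sets register `r` to the constant `a` if the test `q` holds for some value of the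
counter. -/
lemma run_loop_any {i N r a : ℕ} {q : Expr} (σ : State) (hr : i ≠ r)
    (hq : q.readsReg r = false) :
    ((loop i N (ite q (assign r (.lit a)) skip)).run σ).reg r =
      if ∃ j < σ.reg N, q.Holds (σ.setReg i j) then a else σ.reg r := by
  refine run_loop_induction (P := fun t τ => τ.reg r =
      if ∃ j < t, q.Holds (σ.setReg i j) then a else σ.reg r)
    (by simp [Ne.symm hr]) ?_
  intro t τ ht hi hF hP
  have hq' : q.Holds τ ↔ q.Holds (σ.setReg i t) := by
    have : q.eval τ = q.eval (σ.setReg i t) := by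
      refine Expr.eval_congr q (fun s hs => ?_) (fun B _ => ?_)
      · rw [State.setReg_reg]
        split_ifs with h
        · rw [h, hi]
        · refine hF.1 s ?_
          have : r ≠ s := by
            rintro rfl
            simp [hq] at hs
          simp [writesReg, Ne.symm h, this]
      · rw [State.setReg_arr]
        exact hF.2 B (by simp [writesArr])
    simp only [Expr.Holds, this]
  have hex : (∃ j < t + 1, q.Holds (σ.setReg i j)) ↔
      q.Holds (σ.setReg i t) ∨ ∃ j < t, q.Holds (σ.setReg i j) := by
    constructor
    · rintro ⟨j, hj, h⟩
      rcases Nat.lt_succ_iff_lt_or_eq.1 hj with hj | rfl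
      · exact .inr ⟨j, hj, h⟩
      · exact .inl h
    · rintro (h | ⟨j, hj, h⟩)
      · exact ⟨t, by omega, h⟩
      · exact ⟨j, by omega, h⟩
  simp only [run_ite, hq', hex, State.setReg_reg, Ne.symm hr, if_false]
  by_cases h : q.Holds (σ.setReg i t)
  · simp [h]
  · simp only [h, if_false, run_skip, hP, false_or]

/-- A loop that adds to register `r` the number of values of the counter for which the test `q`
holds. -/
lemma run_loop_count {i N r : ℕ} {q : Expr} (σ : State) (hr : i ≠ r)
    (hq : q.readsReg r = false) :
    ((loop i N (ite q (assign r (.op .add (.reg r) (.lit 1))) skip)).run σ).reg r =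
      σ.reg r + ((Finset.range (σ.reg N)).filter fun j => q.Holds (σ.setReg i j)).card := by
  refine run_loop_induction (P := fun t τ => τ.reg r =
      σ.reg r + ((Finset.range t).filter fun j => q.Holds (σ.setReg i j)).card)
    (by simp [Ne.symm hr]) ?_
  intro t τ ht hi hF hP
  have hq' : q.Holds τ ↔ q.Holds (σ.setReg i t) := by
    have : q.eval τ = q.eval (σ.setReg i t) := by
      refine Expr.eval_congr q (fun s hs => ?_) (fun B _ => ?_)
      · rw [State.setReg_reg]
        split_ifs with h
        · rw [h, hi]
        · refine hF.1 s ?_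
          have : r ≠ s := by
            rintro rfl
            simp [hq] at hs
          simp [writesReg, Ne.symm h, this]
      · rw [State.setReg_arr]
        exact hF.2 B (by simp [writesArr])
    simp only [Expr.Holds, this]
  simp only [run_ite, hq', State.setReg_reg, Ne.symm hr, if_false, Finset.range_add_one,
    Finset.filter_insert]
  by_cases h : q.Holds (σ.setReg i t)
  · simp [h, hP, add_assoc]
  · simp [h, hP]

end Cmd

end RAM

/-! ### Local optimality on a rooted tree of bags -/

namespace WPC

/-- A graph on `{0, …, n - 1}` with adjacency relation `E`, partitioned into the bags
`0, …, p - 1` by the map `b`, and a partition tree rooted at bag `0`. The parent of a bag `Y` is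
encoded by `pa Y = X + 1`, and `pa 0 = p + 1` encodes that the root has no parent. -/
structure RootedBags (n p : ℕ) (E : ℕ → ℕ → Prop) (b pa : ℕ → ℕ) : Prop where
  lt : ∀ {u v}, E u v → u < n
  symm : ∀ {u v}, E u v → E v u
  bag_lt : ∀ {v}, v < n → b v < p
  clique : ∀ {u v}, u < n → v < n → u ≠ v → b u = b v → E u v
  tree_edge : ∀ {u v}, E u v → b u = b v ∨ pa (b v) = b u + 1 ∨ pa (b u) = b v + 1
  product : ∀ {u v u' v'}, pa (b v) = b u + 1 → E u v' → E u' v → b v' = b v → b u' = b u → E u v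
  rank : ∃ rk : ℕ → ℕ, ∀ X Y, Y < p → pa Y = X + 1 → rk X < rk Y
  root : pa 0 = p + 1
  parent : ∀ {Y}, Y < p → Y ≠ 0 → ∃ X < p, pa Y = X + 1

/-- The vertices in `K` induce a cluster graph, that is, there is no induced path on three
vertices. -/
def IsCluster (E : ℕ → ℕ → Prop) (K : Finset ℕ) : Prop :=
  ∀ u ∈ K, ∀ v ∈ K, ∀ w ∈ K, E u v → E v w → u ≠ w → E u w

/-- The vertex `v` has a neighbour in the parent of its bag. -/
def Att (E : ℕ → ℕ → Prop) (b pa : ℕ → ℕ) (v : ℕ) : Prop :=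
  ∃ u, E u v ∧ pa (b v) = b u + 1

/-- Some vertex in `L` has a neighbour in bag `Y`. -/
def Hits (E : ℕ → ℕ → Prop) (b : ℕ → ℕ) (L : Finset ℕ) (Y : ℕ) : Prop :=
  ∃ u ∈ L, ∃ v, E u v ∧ b v = Y

/-- The vertices that may be kept in a bag in the three modes. Mode `0`: there are no edges to
the parent bag, and only unattached vertices are kept. Mode `1`: the kept vertices form a clique
with those of the parent bag, and only attached vertices are kept. Mode `2`: any vertices may be
kept, the parent bag keeps no neighbours of this bag. -/
def Admissible (E : ℕ → ℕ → Prop) (b pa : ℕ → ℕ) (M v : ℕ) : Prop :=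
  M = 2 ∨ M = 0 ∧ ¬ Att E b pa v ∨ M = 1 ∧ Att E b pa v

/-- In mode `M`, the set `L` may be kept in bag `X`, where `z = Z + 1` means that the vertices kept
in `X` form one clique with those of the child `Z`, and `z = 0` that there is no such child. -/
def Feasible (n p : ℕ) (E : ℕ → ℕ → Prop) (b pa : ℕ → ℕ) (M X z : ℕ) (L : Finset ℕ) : Prop :=
  (∀ u ∈ L, u < n ∧ b u = X ∧ Admissible E b pa M u) ∧
    (z = 0 ∨ M ≠ 1 ∧ ∃ Z < p, z = Z + 1 ∧ pa Z = X + 1 ∧ ∀ u ∈ L, ∃ v, E u v ∧ b v = Z)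

open scoped Classical in
/-- The loss that keeping `L` in `X` causes in the children of `X`, if `val M Y` is the optimum for
`Y` in mode `M` up to a constant that depends on `Y` only: a child `Y` that `L` hits is in mode `0`
and not `2`, the child `Z` with `Z + 1 = z` is in mode `1`. -/
noncomputable def loss (p : ℕ) (E : ℕ → ℕ → Prop) (b pa : ℕ → ℕ) (val : ℕ → ℕ → ℕ) (z X : ℕ)
    (L : Finset ℕ) : ℕ :=
  ∑ Y ∈ (Finset.range p).filter (fun Y => pa Y = X + 1),
    if Y + 1 = z then val 2 Y - val 1 Y else if Hits E b L Y then val 2 Y - val 0 Y else 0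

/-- The value `val M X` is at least the gain minus the loss of every feasible set. -/
def IsUpper (n p : ℕ) (E : ℕ → ℕ → Prop) (b pa : ℕ → ℕ) (val : ℕ → ℕ → ℕ) (M X z : ℕ) : Prop :=
  ∀ L, Feasible n p E b pa M X z L → L.card ≤ val M X + loss p E b pa val z X L

/-- The value `val M X` is attained by the set `L`. -/
def IsAttained (n p : ℕ) (E : ℕ → ℕ → Prop) (b pa : ℕ → ℕ) (val : ℕ → ℕ → ℕ) (M X z : ℕ)
    (L : Finset ℕ) : Prop :=
  Feasible n p E b pa M X z L ∧ L.card = val M X + loss p E b pa val z X L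

variable {n p : ℕ} {E : ℕ → ℕ → Prop} {b pa : ℕ → ℕ}

lemma loss_mono (val : ℕ → ℕ → ℕ) (z X : ℕ) {L L' : Finset ℕ} (h : L ⊆ L') :
    loss p E b pa val z X L ≤ loss p E b pa val z X L' := by
  classical
  refine Finset.sum_le_sum fun Y _ => ?_
  by_cases h1 : Y + 1 = z
  · simp [h1]
  by_cases h2 : Hits E b L Y
  · have h3 : Hits E b L' Y := by
      obtain ⟨u, hu, hv⟩ := h2
      exact ⟨u, h hu, hv⟩
    simp [h1, h2, h3]
  · simp [h1, h2]

lemma val_zero_le_two {val : ℕ → ℕ → ℕ} {X z : ℕ} {L : Finset ℕ}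
    (ha : IsAttained n p E b pa val 0 X z L) (hu : IsUpper n p E b pa val 2 X z) :
    val 0 X ≤ val 2 X := by
  have h := hu L ⟨fun u h => ⟨(ha.1.1 u h).1, (ha.1.1 u h).2.1, .inl rfl⟩, by
    rcases ha.1.2 with h | ⟨_, h⟩
    · exact .inl h
    · exact .inr ⟨by decide, h⟩⟩
  have := ha.2
  omega

lemma val_one_le_two {val : ℕ → ℕ → ℕ} {X z : ℕ} {L : Finset ℕ}
    (ha : IsAttained n p E b pa val 1 X z L) (hu : IsUpper n p E b pa val 2 X z) :
    val 1 X ≤ val 2 X := by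
  have h := hu L ⟨fun u h => ⟨(ha.1.1 u h).1, (ha.1.1 u h).2.1, .inl rfl⟩, by
    rcases ha.1.2 with h | ⟨h, _⟩
    · exact .inl h
    · exact absurd rfl h⟩
  have := ha.2
  omega

open scoped Classical in
/-- Removing the attached vertices turns a solution for mode `2` into one for mode `0`. -/
lemma val_two_sub_zero_le {val : ℕ → ℕ → ℕ} {X z : ℕ} {L : Finset ℕ}
    (ha : IsAttained n p E b pa val 2 X z L) (hu : IsUpper n p E b pa val 0 X z) :
    val 2 X - val 0 X ≤ ((Finset.range n).filter fun v => b v = X ∧ Att E b pa v).card := by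
  have h := hu (L.filter fun v => ¬ Att E b pa v) ⟨fun u h => by
      obtain ⟨h1, h2⟩ := Finset.mem_filter.1 h
      exact ⟨(ha.1.1 u h1).1, (ha.1.1 u h1).2.1, .inr (.inl ⟨rfl, h2⟩)⟩, by
    rcases ha.1.2 with h | ⟨_, Z, hZ, h1, h2, h3⟩
    · exact .inl h
    · exact .inr ⟨by decide, Z, hZ, h1, h2, fun u hu => h3 u (Finset.mem_filter.1 hu).1⟩⟩
  have h1 := loss_mono (p := p) (E := E) (b := b) (pa := pa) val z X
    (Finset.filter_subset (fun v => ¬ Att E b pa v) L)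
  have h2 : (L.filter fun v => Att E b pa v).card ≤
      ((Finset.range n).filter fun v => b v = X ∧ Att E b pa v).card := by
    refine Finset.card_le_card fun v hv => ?_
    obtain ⟨h1, h2⟩ := Finset.mem_filter.1 hv
    have := ha.1.1 v h1
    simp [this.1, this.2.1, h2]
  have h3 := Finset.card_filter_add_card_filter_not (s := L) (fun v => Att E b pa v)
  have := ha.2
  omega

/-- Every bag but the root is a child of exactly one bag. -/
lemma RootedBags.sum_children (hT : RootedBags n p E b pa) (f : ℕ → ℕ) (h0 : f 0 = 0) :
    ∑ X ∈ Finset.range p, ∑ Y ∈ (Finset.range p).filter (fun Y => pa Y = X + 1), f Y =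
      ∑ Y ∈ Finset.range p, f Y := by
  simp only [Finset.sum_filter]
  rw [Finset.sum_comm]
  refine Finset.sum_congr rfl fun Y hY => ?_
  by_cases h : Y = 0
  · subst h
    simp [h0]
  · obtain ⟨X, hX, hXY⟩ := hT.parent (Finset.mem_range.1 hY) h
    rw [Finset.sum_eq_single X]
    · simp [hXY]
    · intro X' _ hX'
      rw [if_neg]
      omega
    · intro hX'
      exact absurd (Finset.mem_range.2 hX) hX'

lemma RootedBags.pa_ne_self (hT : RootedBags n p E b pa) {X : ℕ} (hX : X < p) : pa X ≠ X + 1 := by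
  obtain ⟨rk, h⟩ := hT.rank
  intro h1
  exact lt_irrefl _ (h X X hX h1)

/-- The total size of the sets kept in the bags, if every bag attains (or stays below) its value in
its mode: the losses in the bags telescope. -/
lemma RootedBags.sum_val (hT : RootedBags n p E b pa) {val : ℕ → ℕ → ℕ} (md : ℕ → ℕ)
    (h0 : md 0 = 2) (hle : ∀ X < p, val (md X) X ≤ val 2 X) :
    ∑ X ∈ Finset.range p, (val (md X) X + ∑ Y ∈ (Finset.range p).filter (fun Y => pa Y = X + 1),
      (val 2 Y - val (md Y) Y)) = ∑ X ∈ Finset.range p, val 2 X := by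
  rw [Finset.sum_add_distrib, hT.sum_children (fun Y => val 2 Y - val (md Y) Y) (by simp [h0]),
    ← Finset.sum_add_distrib]
  refine Finset.sum_congr rfl fun X hX => ?_
  have := hle X (Finset.mem_range.1 hX)
  omega

lemma RootedBags.card_eq_sum (hT : RootedBags n p E b pa) {K : Finset ℕ} (hK : ∀ v ∈ K, v < n) :
    K.card = ∑ X ∈ Finset.range p, (K.filter fun v => b v = X).card :=
  Finset.card_eq_sum_card_fiberwise fun v hv => by
    simpa using hT.bag_lt (hK v hv)

/-- Two distinct children of one bag are not adjacent. -/
lemma RootedBags.bag_eq_of_siblings (hT : RootedBags n p E b pa) {u v X : ℕ} (h : E u v)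
    (hu : pa (b u) = X + 1) (hv : pa (b v) = X + 1) : b u = b v := by
  have hun := hT.bag_lt (hT.lt h)
  have hvn := hT.bag_lt (hT.lt (hT.symm h))
  rcases hT.tree_edge h with h1 | h1 | h1
  · exact h1
  · have : b u = X := by omega
    exact absurd (by rw [hu, this]) (hT.pa_ne_self hun)
  · have : b v = X := by omega
    exact absurd (by rw [hv, this]) (hT.pa_ne_self hvn)

/-- A bag is not adjacent to its grandparent. -/
lemma RootedBags.not_adj_grandparent (hT : RootedBags n p E b pa) {u w Y : ℕ} (h : E u w)
    (hY : Y < p) (hu : pa Y = b u + 1) (hw : pa (b w) = Y + 1) : False := by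
  have hun := hT.bag_lt (hT.lt h)
  have hwn := hT.bag_lt (hT.lt (hT.symm h))
  obtain ⟨rk, hrk⟩ := hT.rank
  have h1 := hrk _ _ hY hu
  have h2 := hrk _ _ hwn hw
  rcases hT.tree_edge h with h3 | h3 | h3
  · rw [h3] at h1
    omega
  · have : b u = Y := by omega
    rw [this] at h1
    omega
  · have := hrk _ _ hun h3
    omega

section UpperBound

variable {K : Finset ℕ}

open scoped Classical in
/-- The mode of the bag `Y` in the cluster graph on the kept vertices `K`. -/
noncomputable def clusterMode (E : ℕ → ℕ → Prop) (b pa : ℕ → ℕ) (K : Finset ℕ) (Y : ℕ) : ℕ :=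
  if ∃ X, pa Y = X + 1 ∧ Hits E b (K.filter fun v => b v = X) Y then
    if ∃ y ∈ K, b y = Y ∧ Att E b pa y then 1 else 0
  else 2

lemma clusterMode_eq_one {Y : ℕ} (h : clusterMode E b pa K Y = 1) :
    (∃ X, pa Y = X + 1 ∧ Hits E b (K.filter fun v => b v = X) Y) ∧
      ∃ y ∈ K, b y = Y ∧ Att E b pa y := by
  classical
  unfold clusterMode at h
  split_ifs at h with h1 h2
  · exact ⟨h1, h2⟩
  · simp at h

/-- If the bag `Y` is in mode `1`, then its kept vertices and those of its parent are joined by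
an edge, and all of them have neighbours in the other bag. -/
lemma RootedBags.clusterMode_one (hT : RootedBags n p E b pa) (hKn : ∀ v ∈ K, v < n)
    (hK : IsCluster E K) {X Y : ℕ} (hY : Y < p) (hXY : pa Y = X + 1)
    (h : clusterMode E b pa K Y = 1) :
    (∃ x ∈ K, ∃ y ∈ K, b x = X ∧ b y = Y ∧ E x y) ∧
      (∀ x ∈ K, b x = X → ∃ v, E x v ∧ b v = Y) ∧ ∀ y ∈ K, b y = Y → Att E b pa y := by
  obtain ⟨⟨X', hX', x, hx, v', hxv, hv'⟩, y, hyK, hyY, u', huy, hu'⟩ := clusterMode_eq_one h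
  obtain rfl : X' = X := by omega
  obtain ⟨hxK, hxX⟩ := Finset.mem_filter.1 hx
  have hne : X' ≠ Y := by
    rintro rfl
    exact hT.pa_ne_self hY hXY
  have hxy : E x y := by
    refine hT.product (u' := u') (v' := v') ?_ hxv huy ?_ ?_
    · rw [hyY, hxX, hXY]
    · rw [hv', hyY]
    · rw [hyY] at hu'
      omega
  refine ⟨⟨x, hxK, y, hyK, hxX, hyY, hxy⟩, fun x' hx' hxX' => ?_, fun y' hy' hyY' => ?_⟩
  · by_cases hxx : x' = x
    · exact ⟨y, hxx ▸ hxy, hyY⟩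
    · have h1 := hT.clique (hKn x' hx') (hKn x hxK) hxx (by rw [hxX, hxX'])
      refine ⟨y, hK x' hx' x hxK y hyK h1 hxy ?_, hyY⟩
      rintro rfl
      omega
  · by_cases hyy : y' = y
    · exact ⟨x, hyy ▸ hxy, by rw [hyY', hxX, hXY]⟩
    · have h1 := hT.clique (hKn y hyK) (hKn y' hy') (Ne.symm hyy) (by rw [hyY, hyY'])
      refine ⟨x, hK x hxK y hyK y' hy' hxy h1 ?_, by rw [hyY', hxX, hXY]⟩
      rintro rfl
      omega

/-- At most one child of a bag is in mode `1`. -/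
lemma RootedBags.clusterMode_one_unique (hT : RootedBags n p E b pa) (hKn : ∀ v ∈ K, v < n)
    (hK : IsCluster E K) {X Y Z : ℕ} (hY : Y < p) (hZ : Z < p) (hXY : pa Y = X + 1)
    (hXZ : pa Z = X + 1) (h : clusterMode E b pa K Y = 1) (h' : clusterMode E b pa K Z = 1) :
    Y = Z := by
  obtain ⟨x, hx, y, hy, hxX, hyY, hxy⟩ := (hT.clusterMode_one hKn hK hY hXY h).1
  obtain ⟨x', hx', z, hz, hxX', hzZ, hxz⟩ := (hT.clusterMode_one hKn hK hZ hXZ h').1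
  by_contra hne
  have hyz : y ≠ z := by
    rintro rfl
    omega
  have hXne : X ≠ Y := by
    rintro rfl
    exact hT.pa_ne_self hY hXY
  have h1 : E y x' := by
    by_cases hxx : x = x'
    · exact hxx ▸ hT.symm hxy
    · refine hK y hy x hx x' hx' (hT.symm hxy)
        (hT.clique (hKn x hx) (hKn x' hx') hxx (by rw [hxX, hxX'])) ?_
      rintro rfl
      omega
  have h2 := hT.bag_eq_of_siblings (hK y hy x' hx' z hz h1 hxz hyz) (X := X) (by rw [hyY, hXY])
    (by rw [hzZ, hXZ])
  omega

/-- A bag in mode `1` has no child in mode `1`. -/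
lemma RootedBags.clusterMode_one_child (hT : RootedBags n p E b pa) (hKn : ∀ v ∈ K, v < n)
    (hK : IsCluster E K) {Y Z : ℕ} (hY : Y < p) (hZ : Z < p) (hYZ : pa Z = Y + 1)
    (h : clusterMode E b pa K Y = 1) : clusterMode E b pa K Z ≠ 1 := by
  intro h'
  obtain ⟨⟨X, hXY, -⟩, -⟩ := clusterMode_eq_one h
  obtain ⟨x, hx, y, hy, hxX, hyY, hxy⟩ := (hT.clusterMode_one hKn hK hY hXY h).1
  obtain ⟨y', hy', z, hz, hyY', hzZ, hyz⟩ := (hT.clusterMode_one hKn hK hZ hYZ h').1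
  obtain ⟨rk, hrk⟩ := hT.rank
  have hr1 := hrk _ _ hY hXY
  have hr2 := hrk _ _ hZ hYZ
  have h1 : E x y' := by
    by_cases hyy : y = y'
    · exact hyy ▸ hxy
    · refine hK x hx y hy y' hy' hxy
        (hT.clique (hKn y hy) (hKn y' hy') hyy (by rw [hyY, hyY'])) ?_
      rintro rfl
      have : X = Y := by omega
      subst this
      omega
  have h2 : E x z := by
    refine hK x hx y' hy' z hz h1 hyz ?_
    rintro rfl
    have : X = Z := by omega
    subst this
    omega
  exact hT.not_adj_grandparent h2 hY (by rw [hXY, hxX]) (by rw [hzZ, hYZ])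

/-- A cluster graph has at most as many vertices as the sum of the values of mode `2`. -/
theorem RootedBags.card_le_sum_val (hT : RootedBags n p E b pa) {val : ℕ → ℕ → ℕ}
    (hup : ∀ M < 3, ∀ X < p, ∀ z, IsUpper n p E b pa val M X z)
    (hle : ∀ M < 3, ∀ X < p, val M X ≤ val 2 X) (hKn : ∀ v ∈ K, v < n) (hK : IsCluster E K) :
    K.card ≤ ∑ X ∈ Finset.range p, val 2 X := by
  classical
  have hlt : ∀ X, clusterMode E b pa K X < 3 := by
    intro X
    unfold clusterMode
    split_ifs <;> simp
  have h0 : clusterMode E b pa K 0 = 2 := by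
    unfold clusterMode
    rw [if_neg]
    rintro ⟨X, hX, u, hu, -⟩
    obtain ⟨huK, hub⟩ := Finset.mem_filter.1 hu
    have := hT.bag_lt (hKn u huK)
    have := hT.root
    omega
  rw [hT.card_eq_sum hKn, ← hT.sum_val (clusterMode E b pa K) h0 (fun X hX => hle _ (hlt X) X hX)]
  refine Finset.sum_le_sum fun X hX => ?_
  have hX := Finset.mem_range.1 hX
  -- The child that forms a clique with `X`, if there is one.
  let z := if h : ∃ Z < p, pa Z = X + 1 ∧ clusterMode E b pa K Z = 1 then h.choose + 1 else 0
  have hz : ∀ Y < p, pa Y = X + 1 → (Y + 1 = z ↔ clusterMode E b pa K Y = 1) := by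
    intro Y hY hXY
    by_cases h : ∃ Z < p, pa Z = X + 1 ∧ clusterMode E b pa K Z = 1
    · have hz : z = h.choose + 1 := dif_pos h
      have hs := h.choose_spec
      rw [hz]
      constructor
      · intro h1
        have : Y = h.choose := by omega
        rw [this]
        exact hs.2.2
      · intro h1
        rw [hT.clusterMode_one_unique hKn hK hY hs.1 hXY hs.2.1 h1 hs.2.2]
    · have hz : z = 0 := dif_neg h
      rw [hz]
      refine ⟨fun h => by omega, fun h1 => absurd ⟨Y, hY, hXY, h1⟩ h⟩
  have hfeas : Feasible n p E b pa (clusterMode E b pa K X) X z (K.filter fun v => b v = X) := by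
    constructor
    · intro u hu
      obtain ⟨huK, hub⟩ := Finset.mem_filter.1 hu
      refine ⟨hKn u huK, hub, ?_⟩
      by_cases h1 : ∃ W, pa X = W + 1 ∧ Hits E b (K.filter fun v => b v = W) X
      · by_cases h2 : ∃ y ∈ K, b y = X ∧ Att E b pa y
        · have h3 : clusterMode E b pa K X = 1 := by simp only [clusterMode, h1, h2, if_true]
          obtain ⟨W, hW, -⟩ := h1
          exact .inr (.inr ⟨h3, (hT.clusterMode_one hKn hK hX hW h3).2.2 u huK hub⟩)
        · have h3 : clusterMode E b pa K X = 0 := by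
            simp only [clusterMode, h1, h2, if_true, if_false]
          exact .inr (.inl ⟨h3, fun h => h2 ⟨u, huK, hub, h⟩⟩)
      · exact .inl (by simp only [clusterMode, h1, if_false])
    · by_cases h : ∃ Z < p, pa Z = X + 1 ∧ clusterMode E b pa K Z = 1
      · have hz : z = h.choose + 1 := dif_pos h
        have hs := h.choose_spec
        refine .inr ⟨fun h1 => hT.clusterMode_one_child hKn hK hX hs.1 hs.2.1 h1 hs.2.2,
          h.choose, hs.1, hz, hs.2.1, fun u hu => ?_⟩
        obtain ⟨huK, hub⟩ := Finset.mem_filter.1 hu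
        exact (hT.clusterMode_one hKn hK hs.1 hs.2.1 hs.2.2).2.1 u huK hub
      · exact .inl (dif_neg h)
  refine (hup _ (hlt X) X hX z _ hfeas).trans (Nat.add_le_add_left (Finset.sum_le_sum ?_) _)
  intro Y hY
  obtain ⟨hY, hXY⟩ := Finset.mem_filter.1 hY
  have hzY := hz Y (Finset.mem_range.1 hY) hXY
  split_ifs with h1 h2
  · rw [hzY.1 h1]
  · have h3 : clusterMode E b pa K Y = 0 := by
      have h4 : clusterMode E b pa K Y ≠ 1 := fun h => h1 (hzY.2 h)
      have h5 : ∃ W, pa Y = W + 1 ∧ Hits E b (K.filter fun v => b v = W) Y := ⟨X, hXY, h2⟩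
      unfold clusterMode at h4 ⊢
      rw [if_pos h5] at h4 ⊢
      split_ifs at h4 ⊢
      · simp at h4
      · rfl
    rw [h3]
  · exact Nat.zero_le _

end UpperBound

open scoped Classical in
/-- The kept sets that attain the values in the modes that are forced from the root downwards
form a maximum cluster graph. -/
theorem RootedBags.isCluster_and_card (hT : RootedBags n p E b pa) {val mg : ℕ → ℕ → ℕ}
    {loc : ℕ → ℕ → Finset ℕ}
    (hup : ∀ M < 3, ∀ X < p, ∀ z, IsUpper n p E b pa val M X z)
    (hatt : ∀ M < 3, ∀ X < p, IsAttained n p E b pa val M X (mg M X) (loc M X))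
    {md : ℕ → ℕ} (hlt : ∀ X < p, md X < 3) (h0 : md 0 = 2)
    (hmd : ∀ X < p, ∀ Y < p, pa Y = X + 1 → md Y =
      if mg (md X) X = Y + 1 then 1 else if Hits E b (loc (md X) X) Y then 0 else 2)
    {F : Finset ℕ} (hF : ∀ v, v ∈ F ↔ v < n ∧ v ∈ loc (md (b v)) (b v)) :
    IsCluster E F ∧ ∀ K : Finset ℕ, (∀ v ∈ K, v < n) → IsCluster E K → K.card ≤ F.card := by
  have hle : ∀ M < 3, ∀ X < p, val M X ≤ val 2 X := by
    intro M hM X hX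
    interval_cases M
    · exact val_zero_le_two (hatt 0 (by simp) X hX) (hup 2 (by simp) X hX _)
    · exact val_one_le_two (hatt 1 (by simp) X hX) (hup 2 (by simp) X hX _)
    · exact le_rfl
  have hFn : ∀ v ∈ F, v < n := fun v hv => ((hF v).1 hv).1
  have hFX : ∀ X < p, (F.filter fun v => b v = X) = loc (md X) X := by
    intro X hX
    ext v
    rw [Finset.mem_filter, hF]
    constructor
    · rintro ⟨⟨-, h⟩, rfl⟩
      exact h
    · intro h
      have := (hatt _ (hlt X hX) X hX).1.1 v h
      obtain ⟨h1, rfl, -⟩ := this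
      exact ⟨⟨h1, h⟩, rfl⟩
  -- Two kept vertices in a bag and its child are adjacent only if the bags are merged.
  have hmerge : ∀ x ∈ F, ∀ y ∈ F, pa (b y) = b x + 1 → E x y →
      mg (md (b x)) (b x) = b y + 1 ∧ md (b y) = 1 := by
    intro x hx y hy hxy hE
    have hX := hT.bag_lt (hFn x hx)
    have hY := hT.bag_lt (hFn y hy)
    have h1 := hmd _ hX _ hY hxy
    have h2 : Hits E b (loc (md (b x)) (b x)) (b y) := ⟨x, ((hF x).1 hx).2, y, hE, rfl⟩
    by_cases h3 : mg (md (b x)) (b x) = b y + 1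
    · rw [if_pos h3] at h1
      exact ⟨h3, h1⟩
    · rw [if_neg h3, if_pos h2] at h1
      have h4 := ((hatt _ (hlt _ hY) _ hY).1.1 y ((hF y).1 hy).2).2.2
      rw [h1] at h4
      rcases h4 with h4 | h4 | h4
      · simp at h4
      · exact absurd ⟨x, hE, hxy⟩ h4.2
      · simp at h4
  -- Merged bags form one clique, by the product structure of the edges between them.
  have hjoin : ∀ x ∈ F, ∀ y ∈ F, pa (b y) = b x + 1 → E x y → ∀ x' ∈ F, ∀ y' ∈ F, b x' = b x →
      b y' = b y → E x' y' := by
    intro x hx y hy hxy hE x' hx' y' hy' hbx hby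
    obtain ⟨h1, h2⟩ := hmerge x hx y hy hxy hE
    have hX := hT.bag_lt (hFn x hx)
    have hY := hT.bag_lt (hFn y hy)
    have hx1 := ((hF x').1 hx').2
    have hy1 := ((hF y').1 hy').2
    rw [hbx] at hx1
    rw [hby, h2] at hy1
    obtain ⟨v, hv, hvY⟩ : ∃ v, E x' v ∧ b v = b y := by
      rcases (hatt _ (hlt _ hX) _ hX).1.2 with h3 | ⟨-, Z, -, h3, -, h4⟩
      · omega
      · have : Z = b y := by omega
        subst this
        exact h4 x' hx1
    obtain ⟨u, hu, hub⟩ : Att E b pa y' := by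
      rcases ((hatt 1 (by simp) _ hY).1.1 y' hy1).2.2 with h4 | h4 | h4
      · simp at h4
      · simp at h4
      · exact h4.2
    refine hT.product ?_ hv hu ?_ ?_
    · rw [hby, hbx, hxy]
    · rw [hvY, hby]
    · rw [hby] at hub
      omega
  -- A bag that is merged with its parent is not merged with a child.
  have hmg1 : ∀ y ∈ F, md (b y) = 1 → mg (md (b y)) (b y) = 0 := by
    intro y hy h
    have hY := hT.bag_lt (hFn y hy)
    rcases (hatt _ (hlt _ hY) _ hY).1.2 with h3 | ⟨h3, -⟩
    · exact h3
    · exact absurd h h3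
  constructor
  · intro u hu v hv w hw huv hvw huw
    rcases hT.tree_edge huv with h1 | h1 | h1 <;> rcases hT.tree_edge hvw with h2 | h2 | h2
    · exact hT.clique (hFn u hu) (hFn w hw) huw (h1.trans h2)
    · exact hjoin v hv w hw h2 hvw u hu w hw h1 rfl
    · exact hT.symm (hjoin w hw v hv h2 (hT.symm hvw) w hw u hu rfl h1)
    · exact hjoin u hu v hv h1 huv u hu w hw rfl h2.symm
    · have h3 := hmerge u hu v hv h1 huv
      have h4 := hmerge v hv w hw h2 hvw
      have h5 := hmg1 v hv h3.2
      omega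
    · exact hT.clique (hFn u hu) (hFn w hw) huw (by omega)
    · exact hT.symm (hjoin v hv u hu h1 (hT.symm huv) w hw u hu h2.symm rfl)
    · have h3 := hmerge v hv u hu h1 (hT.symm huv)
      have h4 := hmerge v hv w hw h2 hvw
      exact hT.clique (hFn u hu) (hFn w hw) huw (by omega)
    · have h3 := hmerge v hv u hu h1 (hT.symm huv)
      have h4 := hmerge w hw v hv h2 (hT.symm hvw)
      have h5 := hmg1 v hv h4.2
      omega
  · intro K hKn hK
    refine (hT.card_le_sum_val hup hle hKn hK).trans (le_of_eq ?_)
    rw [hT.card_eq_sum hFn, ← hT.sum_val md h0 (fun X hX => hle _ (hlt X hX) X hX)]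
    refine Finset.sum_congr rfl fun X hX => ?_
    have hX := Finset.mem_range.1 hX
    rw [hFX X hX, (hatt _ (hlt X hX) X hX).2, loss]
    congr 1
    refine Finset.sum_congr rfl fun Y hY => ?_
    obtain ⟨hY, hXY⟩ := Finset.mem_filter.1 hY
    rw [hmd X hX Y (Finset.mem_range.1 hY) hXY]
    by_cases h1 : mg (md X) X = Y + 1
    · simp [h1]
    · by_cases h2 : Hits E b (loc (md X) X) Y
      · simp [h1, h2, Ne.symm h1]
      · simp [h1, h2, Ne.symm h1]

end WPC

/-! ### Bipartite matching by an auction -/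

namespace WPC

/-- The state of an auction in which the vertices in `U` bid for those in `R` along the relation
`E`: `pd u = 1` says that `u` is pending, `ow v = u + 1` that `u` owns `v`, `ow v = 0` that `v` is
free, and `pr v` is the price of `v`, which is at most `N`. An owner holds a vertex whose price
exceeds that of the cheapest alternative by at most one. -/
structure Auction (U R : Finset ℕ) (E : ℕ → ℕ → Prop) (N : ℕ) (pd ow pr : ℕ → ℕ) : Prop where
  owner : ∀ v ∈ R, ow v ≠ 0 → ∃ u ∈ U, ow v = u + 1 ∧ E u v ∧ pd u ≠ 1 ∧
    ∀ v' ∈ R, E u v' → pr v ≤ pr v' + 1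
  free : ∀ v ∈ R, ow v = 0 → pr v = 0
  inj : ∀ v ∈ R, ∀ v' ∈ R, ow v = ow v' → ow v ≠ 0 → v = v'
  owns : ∀ u ∈ U, pd u ≠ 1 → ∃ v ∈ R, ow v = u + 1
  price_le : ∀ v ∈ R, pr v ≤ N

variable {U R : Finset ℕ} {E : ℕ → ℕ → Prop} {N : ℕ} {pd ow pr : ℕ → ℕ}

/-- A pending vertex takes over a cheapest neighbour and raises its price. -/
lemma Auction.bid (h : Auction U R E N pd ow pr) {u v : ℕ} (huU : u ∈ U) (hu : pd u = 1)
    (hv : v ∈ R) (huv : E u v) (hN : pr v < N) (hmin : ∀ v' ∈ R, E u v' → pr v ≤ pr v')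
    {pd' ow' pr' : ℕ → ℕ}
    (hpd : ∀ x, pd' x = if x = u then 0 else if ow v ≠ 0 ∧ x = ow v - 1 then 1 else pd x)
    (how : ∀ x, ow' x = if x = v then u + 1 else ow x)
    (hpr : ∀ x, pr' x = if x = v then pr v + 1 else pr x) :
    Auction U R E N pd' ow' pr' ∧ ∑ x ∈ R, pr' x = ∑ x ∈ R, pr x + 1 := by
  have hpr_le : ∀ x, pr x ≤ pr' x := by
    intro x
    rw [hpr]
    split_ifs with h1
    · rw [h1]; omega
    · exact le_rfl
  refine ⟨⟨?_, ?_, ?_, ?_, ?_⟩, ?_⟩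
  · intro x hx hxo
    rw [how] at hxo
    by_cases hxv : x = v
    · subst hxv
      refine ⟨u, huU, by simp [how], huv, by simp [hpd], fun v' hv' hE => ?_⟩
      rw [hpr x, if_pos rfl]
      have := hmin v' hv' hE
      have := hpr_le v'
      omega
    · rw [if_neg hxv] at hxo
      obtain ⟨w, hw, hw1, hE, hwp, hle⟩ := h.owner x hx hxo
      refine ⟨w, hw, by rw [how, if_neg hxv, hw1], hE, ?_, fun v' hv' hE' => ?_⟩
      · rw [hpd]
        split_ifs with h1 h2
        · simp
        · exact absurd (h.inj x hx v hv (by omega) hxo) hxv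
        · exact hwp
      · rw [hpr x, if_neg hxv]
        have := hle v' hv' hE'
        have := hpr_le v'
        omega
  · intro x hx hxo
    rw [how] at hxo
    split_ifs at hxo with h1
    rw [hpr, if_neg h1]
    exact h.free x hx hxo
  · have key : ∀ x ∈ R, ow x ≠ u + 1 := by
      intro x hx hxo
      obtain ⟨w, -, hw1, -, hwp, -⟩ := h.owner x hx (by omega)
      have : w = u := by omega
      exact hwp (this ▸ hu)
    intro x hx y hy hxy hxo
    rw [how, how] at hxy
    rw [how] at hxo
    split_ifs at hxy hxo with h1 h2 h2
    · rw [h1, h2]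
    · exact absurd hxy.symm (key y hy)
    · exact absurd hxy (key x hx)
    · exact h.inj x hx y hy hxy hxo
  · intro w hw hwp
    rw [hpd] at hwp
    split_ifs at hwp with h1 h2
    · exact ⟨v, hv, by simp [how, h1]⟩
    · exact absurd rfl hwp
    · obtain ⟨x, hx, hxw⟩ := h.owns w hw hwp
      refine ⟨x, hx, ?_⟩
      rw [how, if_neg, hxw]
      rintro rfl
      exact h2 ⟨by omega, by omega⟩
  · intro x hx
    rw [hpr]
    split_ifs
    · omega
    · exact h.price_le x hx
  · have h1 : ∀ x ∈ R, pr' x = pr x + if x = v then 1 else 0 := by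
      intro x _
      rw [hpr]
      split_ifs with h1
      · rw [h1]
      · rfl
    rw [Finset.sum_congr rfl h1, Finset.sum_add_distrib, Finset.sum_ite_eq' R v, if_pos hv]

lemma Auction.card_pos_price (h : Auction U R E N pd ow pr) :
    (R.filter fun v => pr v ≠ 0).card ≤ U.card := by
  refine Finset.card_le_card_of_injOn (fun v => ow v - 1) ?_ ?_
  · intro v hv
    obtain ⟨hv, hp⟩ := Finset.mem_filter.1 hv
    obtain ⟨u, hu, hvu, -⟩ := h.owner v hv fun h0 => hp (h.free v hv h0)
    simpa [hvu] using hu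
  · intro v hv w hw hvw
    obtain ⟨hv, hpv⟩ := Finset.mem_filter.1 hv
    obtain ⟨hw, hpw⟩ := Finset.mem_filter.1 hw
    have h1 : ow v ≠ 0 := fun h0 => hpv (h.free v hv h0)
    have h2 : ow w ≠ 0 := fun h0 => hpw (h.free w hw h0)
    exact h.inj v hv w hw (by simp only at hvw; omega) h1

/-- The total price bounds the number of bids. -/
lemma Auction.sum_price_le (h : Auction U R E N pd ow pr) : ∑ v ∈ R, pr v ≤ U.card * N := by
  rw [← Finset.sum_filter_ne_zero]
  refine (Finset.sum_le_card_nsmul _ _ N fun v hv => ?_).trans ?_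
  · exact h.price_le v (Finset.mem_filter.1 hv).1
  · simpa using Nat.mul_le_mul_right N h.card_pos_price

/-- Some positive value up to `U.card + 1` is not a price. -/
lemma Auction.exists_gap (h : Auction U R E N pd ow pr) :
    ∃ t, 1 ≤ t ∧ t ≤ U.card + 1 ∧ ∀ v ∈ R, pr v ≠ t := by
  by_contra! hcon
  have : (Finset.Icc 1 (U.card + 1)).card ≤ (R.filter fun v => pr v ≠ 0).card := by
    refine Finset.card_le_card_of_surjOn pr fun t ht => ?_
    obtain ⟨h1, h2⟩ := Finset.mem_Icc.1 (Finset.mem_coe.1 ht)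
    obtain ⟨v, hv, hvt⟩ := hcon t h1 h2
    exact ⟨v, by simp [hv]; omega, hvt⟩
  rw [Nat.card_Icc] at this
  have := h.card_pos_price
  omega

open scoped Classical in
/-- The weak inequality of König's theorem: a set of bidders has at most as many elements as there
are pending vertices and neighbours of the set. -/
lemma Auction.card_le (h : Auction U R E N pd ow pr) {L : Finset ℕ} (hL : L ⊆ U) :
    L.card ≤ (U.filter fun u => pd u = 1).card + (R.filter fun v => ∃ u ∈ L, E u v).card := by
  rw [← Finset.card_filter_add_card_filter_not (s := L) (fun u => pd u = 1)]
  refine Nat.add_le_add (Finset.card_le_card (Finset.filter_subset_filter _ hL)) ?_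
  refine Finset.card_le_card_of_surjOn (fun v => ow v - 1) fun u hu => ?_
  obtain ⟨hu, hup⟩ := Finset.mem_filter.1 (Finset.mem_coe.1 hu)
  obtain ⟨v, hv, hvu⟩ := h.owns u (hL hu) hup
  obtain ⟨w, -, hw, hE, -⟩ := h.owner v hv (by omega)
  have : w = u := by omega
  subst this
  exact ⟨v, by simpa using ⟨hv, w, hu, hE⟩, by simp [hvu]⟩

open scoped Classical in
/-- If no pending vertex can bid any more and `t` is a gap in the prices, then the bidders all of
whose neighbours cost more than `t` attain equality in `Auction.card_le`: all these neighbours are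
owned, and their owners are such bidders, too. -/
lemma Auction.card_eq (h : Auction U R E N pd ow pr) {t : ℕ} (ht1 : 1 ≤ t) (htN : t ≤ N)
    (hgap : ∀ v ∈ R, pr v ≠ t) (hdone : ∀ u ∈ U, pd u = 1 → ∀ v ∈ R, E u v → N ≤ pr v)
    {L : Finset ℕ} (hL : ∀ u, u ∈ L ↔ u ∈ U ∧ ∀ v ∈ R, E u v → t < pr v) :
    L.card = (U.filter fun u => pd u = 1).card + (R.filter fun v => ∃ u ∈ L, E u v).card := by
  refine le_antisymm (h.card_le fun u hu => ((hL u).1 hu).1) ?_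
  rw [← Finset.card_filter_add_card_filter_not (s := L) (fun u => pd u = 1)]
  refine Nat.add_le_add (Finset.card_le_card fun u hu => ?_) ?_
  · obtain ⟨hu, hup⟩ := Finset.mem_filter.1 hu
    refine Finset.mem_filter.2 ⟨(hL u).2 ⟨hu, fun v hv hE => ?_⟩, hup⟩
    have := hdone u hu hup v hv hE
    have := hgap v hv
    omega
  · have key : ∀ v ∈ R, (∃ u ∈ L, E u v) → ow v ≠ 0 ∧ ow v - 1 ∈ L ∧ pd (ow v - 1) ≠ 1 := by
      rintro v hv ⟨u, hu, hE⟩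
      have h1 := ((hL u).1 hu).2 v hv hE
      have h2 : ow v ≠ 0 := by
        intro h0
        have := h.free v hv h0
        omega
      obtain ⟨w, hw, hvw, -, hwp, hmin⟩ := h.owner v hv h2
      have h3 : ow v - 1 = w := by omega
      rw [h3]
      refine ⟨h2, (hL w).2 ⟨hw, fun v' hv' hE' => ?_⟩, hwp⟩
      have := hmin v' hv' hE'
      have := hgap v' hv'
      omega
    refine Finset.card_le_card_of_injOn (fun v => ow v - 1) ?_ ?_
    · intro v hv
      obtain ⟨hv, hE⟩ := Finset.mem_filter.1 (Finset.mem_coe.1 hv)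
      have := key v hv hE
      simpa using this.2
    · intro v hv w hw hvw
      obtain ⟨hv, hEv⟩ := Finset.mem_filter.1 (Finset.mem_coe.1 hv)
      obtain ⟨hw, hEw⟩ := Finset.mem_filter.1 (Finset.mem_coe.1 hw)
      have h1 := (key v hv hEv).1
      have h2 := (key w hw hEw).1
      exact h.inj v hv w hw (by simp only at hvw; omega) h1

open scoped Classical in
/-- The number of active vertices adjacent to `L` is the loss of `L`, if the number of active
vertices in each child is the loss in this child when it is hit. The summand `D` is the loss in the
child that is merged with the bag `X`. -/
lemma RootedBags.card_active_eq_loss {n p : ℕ} {b pa : ℕ → ℕ} (hT : RootedBags n p E b pa)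
    {val : ℕ → ℕ → ℕ} {X z D : ℕ} {L : Finset ℕ} (hL : ∀ u ∈ L, b u = X)
    (hR : ∀ v ∈ R, v < n ∧ pa (b v) = X + 1 ∧ b v + 1 ≠ z ∧ Att E b pa v)
    (hcard : ∀ Y < p, pa Y = X + 1 → Y + 1 ≠ z →
      (R.filter fun v => b v = Y).card = val 2 Y - val 0 Y)
    (hD : z = 0 ∧ D = 0 ∨ ∃ Z < p, z = Z + 1 ∧ pa Z = X + 1 ∧ D = val 2 Z - val 1 Z) :
    (R.filter fun v => ∃ u ∈ L, E u v).card + D = loss p E b pa val z X L := by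
  have h1 : (R.filter fun v => ∃ u ∈ L, E u v).card =
      ∑ Y ∈ (Finset.range p).filter (fun Y => pa Y = X + 1),
        if Y + 1 = z then 0 else if Hits E b L Y then val 2 Y - val 0 Y else 0 := by
    rw [Finset.card_eq_sum_card_fiberwise (f := b)
      (t := (Finset.range p).filter (fun Y => pa Y = X + 1))]
    · refine Finset.sum_congr rfl fun Y hY => ?_
      obtain ⟨hYp, hXY⟩ := Finset.mem_filter.1 hY
      by_cases hYz : Y + 1 = z
      · rw [if_pos hYz, Finset.card_eq_zero, Finset.filter_eq_empty_iff]
        intro v hv hvY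
        exact (hR v (Finset.mem_filter.1 hv).1).2.2.1 (by rw [hvY, hYz])
      rw [if_neg hYz]
      by_cases hH : Hits E b L Y
      · rw [if_pos hH, ← hcard Y (Finset.mem_range.1 hYp) hXY hYz, Finset.filter_filter]
        congr 1
        refine Finset.filter_congr fun v hv => ⟨fun h => h.2, fun h => ⟨?_, h⟩⟩
        obtain ⟨u, hu, v', huv, hv'⟩ := hH
        obtain ⟨u', hu', hub⟩ := (hR v hv).2.2.2
        have hu1 := hL u hu
        refine ⟨u, hu, hT.product ?_ huv hu' (by rw [hv', h]) (by rw [h] at hub; omega)⟩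
        rw [h, hu1, hXY]
      · rw [if_neg hH, Finset.card_eq_zero, Finset.filter_eq_empty_iff]
        intro v hv hvY
        obtain ⟨u, hu, huv⟩ := (Finset.mem_filter.1 hv).2
        exact hH ⟨u, hu, v, huv, hvY⟩
    · intro v hv
      have := hR v (Finset.mem_filter.1 (Finset.mem_coe.1 hv)).1
      simpa using ⟨hT.bag_lt this.1, this.2.1⟩
  have h2 : D = ∑ Y ∈ (Finset.range p).filter (fun Y => pa Y = X + 1),
      if Y + 1 = z then val 2 Y - val 1 Y else 0 := by
    rcases hD with ⟨rfl, rfl⟩ | ⟨Z, hZ, rfl, hXZ, rfl⟩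
    · simp
    · simp [Finset.sum_ite_eq', hZ, hXZ]
  rw [h1, h2, loss, ← Finset.sum_add_distrib]
  refine Finset.sum_congr rfl fun Y _ => ?_
  by_cases h : Y + 1 = z <;> simp [h]

end WPC

/-! ### The program -/

namespace RAM

/-- Equality test. -/
infix:50 " =ᵉ " => Expr.op Op.eq
/-- Order test. -/
infix:50 " <ᵉ " => Expr.op Op.lt
/-- Sum of expressions. -/
infixl:65 " +ᵉ " => Expr.op Op.add
/-- Truncated difference of expressions. -/
infixl:65 " -ᵉ " => Expr.op Op.sub
/-- Conjunction of tests. -/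
infixr:35 " ∧ᵉ " => Expr.and
/-- Disjunction of tests. -/
infixr:30 " ∨ᵉ " => Expr.or

open RAM.Expr RAM.Cmd

/-- Arrays `5` and `6` receive the starting points and end points of the directed edges, two for
each edge of the graph. -/
def orientEdges : Cmd :=
  loop 10 5 (ite (reg 10 <ᵉ reg 1)
    (store 5 (reg 10) (load 0 (reg 10)) ;; store 6 (reg 10) (load 1 (reg 10)))
    (store 5 (reg 10) (load 1 (reg 10 -ᵉ reg 1)) ;;
      store 6 (reg 10) (load 0 (reg 10 -ᵉ reg 1))))

/-- If the current directed edge leads from bag `reg 13` to a new bag, then append the new bag to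
the queue. -/
def searchStep : Cmd :=
  ite (load 2 (load 5 (reg 11)) =ᵉ reg 13 ∧ᵉ load 9 (load 2 (load 6 (reg 11))) =ᵉ lit 0)
    (store 8 (reg 9) (load 2 (load 6 (reg 11))) ;;
      store 9 (load 2 (load 6 (reg 11))) (reg 13 +ᵉ lit 1) ;;
      assign 9 (reg 9 +ᵉ lit 1)) skip

/-- Breadth-first search on the bags from bag `0`. The queue of bags is array `8` of length
`reg 9`; array `9` receives the parents plus one, and `p + 1` for the root. -/
def search : Cmd :=
  store 9 (lit 0) (reg 2 +ᵉ lit 1) ;; assign 9 (lit 1) ;;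
  loop 10 2 (ite (reg 10 <ᵉ reg 9) (assign 13 (load 8 (reg 10)) ;; loop 11 5 searchStep) skip)

/-- Append the job `(reg 10, e)`. -/
def pushJob (e : Expr) : Cmd :=
  store 10 (reg 8) (reg 10) ;; store 11 (reg 8) e ;; assign 8 (reg 8 +ᵉ lit 1)

/-- The list of jobs in arrays `10` and `11`, of length `reg 8`. The jobs of the bags follow each
other in the order opposite to the search. The job `(i, Z)` belongs to the `i`-th bag `X` in
this order; the jobs of `X` are given by the children `Z` of `X` and by `Z = X`. -/
def listJobs : Cmd :=
  assign 8 (lit 0) ;;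
  loop 10 2 (assign 13 (load 8 (reg 2 -ᵉ lit 1 -ᵉ reg 10)) ;;
    loop 11 2 (ite (load 9 (reg 11) =ᵉ reg 13 +ᵉ lit 1) (pushJob (reg 11)) skip) ;;
    pushJob (reg 13))

/-- Array `12` marks the vertices with a neighbour in the parent bag. -/
def markAttached : Cmd :=
  loop 10 5 (ite (load 9 (load 2 (load 6 (reg 10))) =ᵉ load 2 (load 5 (reg 10)) +ᵉ lit 1)
    (store 12 (load 6 (reg 10)) (lit 1)) skip)

/-- Array `14` marks the vertices of bag `X = reg 13` that may be kept in mode `reg 15` if `X`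
is merged with the child `reg 14`, or with no child if this is `X`. -/
def markBidders : Cmd :=
  loop 11 0 (ite (lit 1) (store 13 (reg 11) (reg 13 =ᵉ reg 14)) skip) ;;
  loop 11 5 (ite (load 2 (load 6 (reg 11)) =ᵉ reg 14) (store 13 (load 5 (reg 11)) (lit 1)) skip) ;;
  loop 11 0 (ite (lit 1) (store 14 (reg 11) (load 2 (reg 11) =ᵉ reg 13 ∧ᵉ
    (reg 15 =ᵉ lit 2 ∨ᵉ load 12 (reg 11) =ᵉ reg 15) ∧ᵉ load 13 (reg 11) =ᵉ lit 1 ∧ᵉ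
    (reg 13 =ᵉ reg 14 ∨ᵉ Expr.not (reg 15 =ᵉ lit 1)))) skip)

/-- Test whether the vertex `reg 11` is attached, lies in a child of the bag `reg 13` other than
the bag `reg 14`, and fewer vertices of its bag are active than the loss if the bag is hit. -/
def activeTest : Expr :=
  load 9 (load 2 (reg 11)) =ᵉ reg 13 +ᵉ lit 1 ∧ᵉ Expr.not (load 2 (reg 11) =ᵉ reg 14) ∧ᵉ
    load 12 (reg 11) =ᵉ lit 1 ∧ᵉ load 17 (load 2 (reg 11)) <ᵉ
      load 22 (load 2 (reg 11)) -ᵉ load 20 (load 2 (reg 11))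

/-- The initial prices in array `18`: active vertices have price `0`, the others a price above
the maximum `reg 16`. Array `17` counts the active vertices in each bag. -/
def initPrices : Cmd :=
  loop 11 2 (ite (lit 1) (store 17 (reg 11) (lit 0)) skip) ;;
  loop 11 0 (ite activeTest
    (store 18 (reg 11) (lit 0) ;;
      store 17 (load 2 (reg 11)) (load 17 (load 2 (reg 11)) +ᵉ lit 1))
    (store 18 (reg 11) (reg 16 +ᵉ lit 1)))

/-- The initial state of the auction: pending bidders in array `15`, owners in array `16`, and the
maximum price in `reg 16`. -/
def initAuction : Cmd :=
  loop 11 0 (ite (lit 1) (store 15 (reg 11) (load 14 (reg 11))) skip) ;;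
  assign 16 (lit 1) ;;
  loop 11 0 (ite (load 14 (reg 11) =ᵉ lit 1) (assign 16 (reg 16 +ᵉ lit 1)) skip) ;;
  loop 11 0 (ite (lit 1) (store 16 (reg 11) (lit 0)) skip) ;;
  initPrices

/-- Find an edge from a pending bidder to a vertex of minimum price. -/
def findBid : Cmd :=
  assign 17 (reg 16) ;;
  loop 12 5 (ite (load 14 (load 5 (reg 12)) =ᵉ lit 1 ∧ᵉ load 15 (load 5 (reg 12)) =ᵉ lit 1 ∧ᵉ
      load 18 (load 6 (reg 12)) <ᵉ reg 17)
    (assign 17 (load 18 (load 6 (reg 12))) ;; assign 18 (load 5 (reg 12)) ;;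
      assign 19 (load 6 (reg 12))) skip)

/-- Execute the bid that has been found, if there is one. -/
def placeBid : Cmd :=
  ite (reg 17 <ᵉ reg 16)
    (ite (load 16 (reg 19) =ᵉ lit 0) skip (store 15 (load 16 (reg 19) -ᵉ lit 1) (lit 1)) ;;
      store 16 (reg 19) (reg 18 +ᵉ lit 1) ;; store 15 (reg 18) (lit 0) ;;
      store 18 (reg 19) (reg 17 +ᵉ lit 1)) skip

/-- All bids. -/
def auction : Cmd := loop 11 6 (findBid ;; placeBid)

/-- The least positive number that is not a price is written to `reg 20`. -/
def findGap : Cmd :=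
  assign 20 (lit 0) ;;
  loop 11 7 (assign 21 (lit 0) ;;
    loop 12 0 (ite (load 18 (reg 12) =ᵉ reg 11 +ᵉ lit 1) (assign 21 (lit 1)) skip) ;;
    ite (reg 21 =ᵉ lit 0 ∧ᵉ reg 20 =ᵉ lit 0) (assign 20 (reg 11 +ᵉ lit 1)) skip)

/-- The optimum for the current job: its value in `reg 22`, and the set in array `14`. -/
def evaluate : Cmd :=
  assign 22 (lit 0) ;;
  loop 11 0 (ite (load 14 (reg 11) =ᵉ lit 1 ∧ᵉ load 15 (reg 11) =ᵉ lit 1)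
    (assign 22 (reg 22 +ᵉ lit 1)) skip) ;;
  ite (reg 13 =ᵉ reg 14) skip
    (assign 22 (reg 22 -ᵉ (load 22 (reg 14) -ᵉ load 21 (reg 14)))) ;;
  loop 11 5 (ite (load 18 (load 6 (reg 11)) <ᵉ reg 20 +ᵉ lit 1)
    (store 14 (load 5 (reg 11)) (lit 0)) skip)

/-- Compute the optimum for bag `reg 13` in mode `reg 15`, merged with child `reg 14`. -/
def solveJob : Cmd :=
  markBidders ;; initAuction ;; auction ;; findGap ;; evaluate

/-- Record the optimum for the current job if it improves the value in mode `M`. The values are in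
array `20 + M`, the merged children (plus one) in array `23 + M`, the sets in array `26 + M`. -/
def record (M : ℕ) : Cmd :=
  ite (load (20 + M) (reg 13) <ᵉ reg 22)
    (store (20 + M) (reg 13) (reg 22) ;;
      ite (reg 13 =ᵉ reg 14) (store (23 + M) (reg 13) (lit 0))
        (store (23 + M) (reg 13) (reg 14 +ᵉ lit 1)) ;;
      loop 11 0 (ite (load 2 (reg 11) =ᵉ reg 13) (store (26 + M) (reg 11) (load 14 (reg 11))) skip))
    skip

/-- Execute the current job in mode `M`. -/
def jobInMode (M : ℕ) : Cmd := assign 15 (lit M) ;; solveJob ;; record M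

/-- Execute the job with index `reg 10`. -/
def job : Cmd :=
  assign 13 (load 8 (reg 2 -ᵉ lit 1 -ᵉ load 10 (reg 10))) ;; assign 14 (load 11 (reg 10)) ;;
  jobInMode 0 ;; jobInMode 1 ;; jobInMode 2

/-- Execute all jobs. -/
def allJobs : Cmd := loop 10 8 job

/-- Adopt for bag `reg 13` the solution in mode `M`: array `29` marks the kept vertices, array `30`
contains the merged children (plus one), shifted by one. -/
def adopt (M : ℕ) : Cmd :=
  store 30 (reg 13 +ᵉ lit 1) (load (23 + M) (reg 13)) ;;
  loop 11 0 (ite (load 2 (reg 11) =ᵉ reg 13) (store 29 (reg 11) (load (26 + M) (reg 11))) skip)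

/-- Determine the mode of the bag `reg 13` from the vertices that are kept in its parent. -/
def chooseMode : Cmd :=
  assign 14 (load 9 (reg 13)) ;; assign 15 (lit 2) ;;
  loop 11 5 (ite (load 2 (load 6 (reg 11)) =ᵉ reg 13 ∧ᵉ
      load 2 (load 5 (reg 11)) +ᵉ lit 1 =ᵉ reg 14 ∧ᵉ load 29 (load 5 (reg 11)) =ᵉ lit 1)
    (assign 15 (lit 0)) skip) ;;
  ite (load 30 (reg 14) =ᵉ reg 13 +ᵉ lit 1) (assign 15 (lit 1)) skip

/-- Determine the modes and the kept vertices of all bags, from the root downwards. -/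
def selectAll : Cmd :=
  loop 10 2 (assign 13 (load 8 (reg 10)) ;; chooseMode ;;
    ite (reg 15 =ᵉ lit 0) (adopt 0) (ite (reg 15 =ᵉ lit 1) (adopt 1) (adopt 2)))

/-- Write the output. -/
def output : Cmd :=
  loop 10 0 (ite (lit 1) (store 0 (reg 10) (lit 1 -ᵉ (load 29 (reg 10) =ᵉ lit 1))) skip) ;;
  assign 13 (lit 0) ;;
  loop 10 0 (ite (load 0 (reg 10) =ᵉ lit 1) (assign 13 (reg 13 +ᵉ lit 1)) skip) ;;
  assign 0 (lit 1 -ᵉ (reg 4 <ᵉ reg 13))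

/-- The limits of the loops: `reg 5` is the number of directed edges, `reg 6` a number of bids that
suffices for every auction, `reg 7` is `n + 1`. -/
def setLimits : Prog :=
  .seq (.assign 5 (reg 1 +ᵉ reg 1)) (.seq (.assign 6 (reg 5 +ᵉ reg 5 +ᵉ lit 3))
    (.assign 7 (reg 0 +ᵉ lit 1)))

/-- Everything that precedes the jobs. -/
def preparation : Cmd := orientEdges ;; search ;; listJobs ;; markAttached

/-- The jobs and everything that follows. -/
def solution : Cmd := allJobs ;; selectAll ;; output

/-- The program for Cluster Vertex Deletion. -/
def cvdProgram : Prog := .seq setLimits (.seq preparation.toProg solution.toProg)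

lemma preparation_good : preparation.good = true := by decide

lemma solution_good : solution.good = true := by decide

end RAM

/-! ### Correctness of a single job -/

namespace RAM

open RAM.Expr RAM.Cmd WPC

lemma Expr.eval_eq_one_iff (σ : State) {e : Expr} (he : e.isBool = true) :
    e.eval σ = 1 ↔ e.Holds σ := by
  have := Expr.eval_le_one_of_isBool σ e he
  unfold Expr.Holds
  omega

/-- The command writes none of the given registers and arrays. -/
def Cmd.keeps (c : Cmd) (rs as : List ℕ) : Bool :=
  rs.all (fun r => !c.writesReg r) && as.all fun A => !c.writesArr A

lemma Cmd.keeps_frame {c : Cmd} {rs as : List ℕ} (h : c.keeps rs as = true) {σ τ : State}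
    (hF : c.Frame σ τ) : (∀ r ∈ rs, τ.reg r = σ.reg r) ∧ ∀ A ∈ as, τ.arr A = σ.arr A := by
  simp only [Cmd.keeps, Bool.and_eq_true, List.all_eq_true, Bool.not_eq_true'] at h
  exact ⟨fun r hr => hF.1 r (h.1 r hr), fun A hA => hF.2 A (h.2 A hA)⟩

/-- The memory holds the rooted tree of bags: the numbers of vertices and bags, the directed edges,
the bags and their parents, the attached vertices, and the limits of the loops. -/
structure Ready (n p : ℕ) (E : ℕ → ℕ → Prop) (b pa : ℕ → ℕ) (σ : State) : Prop where
  reg0 : σ.reg 0 = n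
  reg2 : σ.reg 2 = p
  reg7 : σ.reg 7 = n + 1
  arr2 : σ.arr 2 = b
  arr9 : σ.arr 9 = pa
  lt : ∀ u v, E u v → u < n ∧ v < n
  edge : ∀ u v, E u v ↔ ∃ j < σ.reg 5, σ.arr 5 j = u ∧ σ.arr 6 j = v
  att : ∀ v, σ.arr 12 v = 1 ↔ Att E b pa v
  att_le : ∀ v, σ.arr 12 v ≤ 1
  bids : ∀ U : Finset ℕ, ∀ X, (∀ v ∈ U, v < n ∧ b v = X) → U.card * (U.card + 1) < σ.reg 6

variable {n p : ℕ} {E : ℕ → ℕ → Prop} {b pa : ℕ → ℕ} {σ τ : State}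

lemma Ready.of_eq (h : Ready n p E b pa σ) (hr : ∀ r ∈ [0, 2, 5, 6, 7], τ.reg r = σ.reg r)
    (ha : ∀ A ∈ [2, 5, 6, 9, 12], τ.arr A = σ.arr A) : Ready n p E b pa τ := by
  simp only [List.mem_cons, List.not_mem_nil, or_false, forall_eq_or_imp, forall_eq] at hr ha
  obtain ⟨h0, h2, h5, h6, h7⟩ := hr
  obtain ⟨a2, a5, a6, a9, a12⟩ := ha
  constructor
  · rw [h0, h.reg0]
  · rw [h2, h.reg2]
  · rw [h7, h.reg7]
  · rw [a2, h.arr2]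
  · rw [a9, h.arr9]
  · exact h.lt
  · rw [h5, a5, a6]; exact h.edge
  · rw [a12]; exact h.att
  · rw [a12]; exact h.att_le
  · rw [h6]; exact h.bids

lemma Ready.of_frame {c : Cmd} (h : Ready n p E b pa σ) (hF : c.Frame σ τ)
    (hc : c.keeps [0, 2, 5, 6, 7] [2, 5, 6, 9, 12] = true) : Ready n p E b pa τ :=
  h.of_eq (Cmd.keeps_frame hc hF).1 (Cmd.keeps_frame hc hF).2

lemma Ready.run {c : Cmd} (h : Ready n p E b pa σ)
    (hc : c.keeps [0, 2, 5, 6, 7] [2, 5, 6, 9, 12] = true) : Ready n p E b pa (c.run σ) :=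
  h.of_frame (c.frame_run σ) hc

/-- The vertices that may be kept in bag `X` in mode `M`, if `X` is merged with its child `Z`, or
with no child in case `Z = X`. They are the bidders in the auction. -/
def Bidder (n : ℕ) (E : ℕ → ℕ → Prop) (b pa : ℕ → ℕ) (M X Z v : ℕ) : Prop :=
  v < n ∧ b v = X ∧ Admissible E b pa M v ∧ (X = Z ∨ M ≠ 1 ∧ ∃ w, E v w ∧ b w = Z)

/-- Membership in array `14` is being a bidder of the current job. -/
lemma markBidders_spec (h : Ready n p E b pa σ) (hM : σ.reg 15 < 3) {v : ℕ} (hv : v < n) :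
    (markBidders.run σ).arr 14 v = 1 ↔ Bidder n E b pa (σ.reg 15) (σ.reg 13) (σ.reg 14) v := by
  simp only [markBidders, run_seq]
  set σ1 := (loop 11 0 (ite (lit 1) (store 13 (reg 11) (reg 13 =ᵉ reg 14)) skip)).run σ with h1
  set σ2 := (loop 11 5 (ite (load 2 (load 6 (reg 11)) =ᵉ reg 14)
    (store 13 (load 5 (reg 11)) (lit 1)) skip)).run σ1 with h2
  have hr1 : Ready n p E b pa σ1 := h.run rfl
  have hr2 : Ready n p E b pa σ2 := hr1.run rfl
  have e1 : ∀ r ∈ [13, 14, 15], σ1.reg r = σ.reg r :=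
    (keeps_frame (as := []) rfl (frame_run _ σ)).1
  have e2 : ∀ r ∈ [13, 14, 15], σ2.reg r = σ1.reg r :=
    (keeps_frame (as := []) rfl (frame_run _ σ1)).1
  simp only [List.mem_cons, List.not_mem_nil, or_false, forall_eq_or_imp, forall_eq] at e1 e2
  have a1 : σ1.arr 13 v = if σ.reg 13 = σ.reg 14 then 1 else 0 := by
    rw [h1, run_loop_map _ rfl rfl]
    simp [h.reg0, hv, Holds, Expr.eval_eq]
  have a2 : σ2.arr 13 v = 1 ↔
      (∃ w, E v w ∧ b w = σ.reg 14) ∨ σ.reg 13 = σ.reg 14 := by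
    have : (∃ j < σ1.reg 5, b (σ1.arr 6 j) = σ.reg 14 ∧ σ1.arr 5 j = v) ↔
        ∃ w, E v w ∧ b w = σ.reg 14 := by
      simp only [hr1.edge]
      constructor
      · rintro ⟨j, hj, h1, h2⟩
        exact ⟨_, ⟨j, hj, h2, rfl⟩, h1⟩
      · rintro ⟨w, ⟨j, hj, h2, h3⟩, h1⟩
        exact ⟨j, hj, by rw [h3, h1], h2⟩
    rw [h2, run_loop_mark _ rfl rfl, a1]
    split_ifs with h1 h3 <;>
      simp only [holds_eq, eval_load, eval_reg, State.setReg_reg, State.setReg_arr,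
        hr1.arr2, if_true, e1.2.1, show ¬ (14 : ℕ) = 11 by decide, if_false, this] at h1 <;>
      simp [*]
  rw [run_loop_map _ rfl rfl]
  simp only [hr2.reg0, hv, true_and, Holds, eval_lit, ne_eq, one_ne_zero, not_false_eq_true,
    if_true]
  rw [Expr.eval_eq_one_iff _ (by rfl)]
  simp only [holds_and, holds_or, holds_not, holds_eq, eval_load, eval_reg, eval_lit,
    State.setReg_reg, State.setReg_arr, if_true, hr2.arr2, e2, e1, a2,
    show ¬ (13 : ℕ) = 11 by decide, show ¬ (14 : ℕ) = 11 by decide,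
    show ¬ (15 : ℕ) = 11 by decide, if_false]
  have hatt := hr2.att v
  have hatt1 := hr2.att_le v
  simp only [Bidder, Admissible, hv, true_and, ← hatt]
  have h3 : (σ.reg 15 = 2 ∨ σ2.arr 12 v = σ.reg 15) ↔
      (σ.reg 15 = 2 ∨ σ.reg 15 = 0 ∧ ¬ σ2.arr 12 v = 1 ∨ σ.reg 15 = 1 ∧ σ2.arr 12 v = 1) := by
    omega
  rw [h3]
  refine and_congr Iff.rfl (and_congr Iff.rfl ?_)
  by_cases hXZ : σ.reg 13 = σ.reg 14
  · simp [hXZ]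
  · simp only [hXZ, or_false, false_or]
    exact and_comm

open scoped Classical in
/-- The active vertices form a set `R`: in every child `Y` other than the merged one, a number of
attached vertices equal to the loss caused by hitting `Y`, or all attached vertices if there are
fewer. -/
lemma initPrices_spec (h : Ready n p E b pa σ) (hbag : ∀ v < n, b v < p) :
    ∃ R : Finset ℕ,
      (∀ v ∈ R, v < n ∧ pa (b v) = σ.reg 13 + 1 ∧ b v ≠ σ.reg 14 ∧ Att E b pa v) ∧
      (∀ v ∈ R, (initPrices.run σ).arr 18 v = 0) ∧
      (∀ v < n, v ∉ R → (initPrices.run σ).arr 18 v = σ.reg 16 + 1) ∧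
      ∀ Y < p, pa Y = σ.reg 13 + 1 → Y ≠ σ.reg 14 → (R.filter fun v => b v = Y).card =
        min (σ.arr 22 Y - σ.arr 20 Y)
          ((Finset.range n).filter fun v => b v = Y ∧ Att E b pa v).card := by
  simp only [initPrices, run_seq]
  set σ1 := (loop 11 2 (ite (lit 1) (store 17 (reg 11) (lit 0)) skip)).run σ with h1
  have hr1 : Ready n p E b pa σ1 := h.run rfl
  have e1 : (∀ r ∈ [13, 14, 16], σ1.reg r = σ.reg r) ∧ ∀ A ∈ [20, 22], σ1.arr A = σ.arr A :=
    keeps_frame rfl (frame_run _ σ)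
  simp only [List.mem_cons, List.not_mem_nil, or_false, forall_eq_or_imp, forall_eq] at e1
  have a1 : ∀ y < p, σ1.arr 17 y = 0 := by
    intro y hy
    rw [h1, run_loop_map _ rfl rfl]
    simp [h.reg2, hy, Holds]
  rw [← hr1.reg0]
  refine run_loop_induction (σ := σ1) (P := fun t τ => ∃ R : Finset ℕ,
      (∀ v ∈ R, v < t ∧ pa (b v) = σ.reg 13 + 1 ∧ b v ≠ σ.reg 14 ∧ Att E b pa v) ∧
      (∀ v ∈ R, τ.arr 18 v = 0) ∧
      (∀ v < t, v ∉ R → τ.arr 18 v = σ.reg 16 + 1) ∧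
      (∀ Y < p, pa Y = σ.reg 13 + 1 → Y ≠ σ.reg 14 → (R.filter fun v => b v = Y).card =
        min (σ.arr 22 Y - σ.arr 20 Y)
          ((Finset.range t).filter fun v => b v = Y ∧ Att E b pa v).card) ∧
      ∀ Y < p, τ.arr 17 Y = (R.filter fun v => b v = Y).card) ?_ ?_ |>.imp fun R hR =>
        ⟨hR.1, hR.2.1, hR.2.2.1, hR.2.2.2.1⟩
  · exact ⟨∅, by simp, by simp, by simp, by simp, fun Y hY => by simpa using a1 Y hY⟩
  rintro t τ ht hti hF ⟨R, hR1, hR2, hR3, hR4, hR5⟩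
  rw [hr1.reg0] at ht
  have hr : Ready n p E b pa τ := hr1.of_frame hF rfl
  have e2 : (∀ r ∈ [13, 14, 16], τ.reg r = σ1.reg r) ∧ ∀ A ∈ [20, 22], τ.arr A = σ1.arr A :=
    keeps_frame rfl hF
  simp only [List.mem_cons, List.not_mem_nil, or_false, forall_eq_or_imp, forall_eq] at e2
  have hbt := hbag t ht
  have htR : t ∉ R := fun h => lt_irrefl _ (hR1 t h).1
  simp only [run_ite, State.setReg_arr]
  have hact : activeTest.Holds τ ↔ pa (b t) = σ.reg 13 + 1 ∧ b t ≠ σ.reg 14 ∧ Att E b pa t ∧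
      (R.filter fun v => b v = b t).card < σ.arr 22 (b t) - σ.arr 20 (b t) := by
    simp only [activeTest, holds_and, holds_eq, holds_lt, holds_not, eval_load, eval_reg, eval_lit,
      eval_add, eval_sub, hti, hr.arr2, hr.arr9, hr.att, e2, e1, hR5 _ hbt, ne_eq]
  simp only [hact]
  split_ifs with hc
  · obtain ⟨c1, c2, c3, c4⟩ := hc
    simp only [run_seq, run_store, eval_load, eval_reg, eval_lit, eval_add, State.setArr_arr,
      State.setArr_reg, hti, hr.arr2, if_true, show ¬ (2 : ℕ) = 18 by decide, if_false,
      show ¬ (17 : ℕ) = 18 by decide, show ¬ (18 : ℕ) = 17 by decide]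
    refine ⟨insert t R, ?_, ?_, ?_, ?_, ?_⟩
    · intro v hv
      rcases Finset.mem_insert.1 hv with rfl | hv
      · exact ⟨by omega, c1, c2, c3⟩
      · exact ⟨(hR1 v hv).1.trans (by omega), (hR1 v hv).2⟩
    · intro v hv
      rcases Finset.mem_insert.1 hv with rfl | hv
      · simp
      · rw [hR2 v hv]
        simp
    · intro v hv hvR
      rw [Finset.mem_insert, not_or] at hvR
      rw [if_neg hvR.1]
      exact hR3 v (by omega) hvR.2
    · intro Y hY h1 h2
      have := hR4 Y hY h1 h2
      rw [Finset.filter_insert, Finset.range_add_one, Finset.filter_insert]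
      by_cases hYt : b t = Y
      · subst hYt
        rw [if_pos rfl, if_pos ⟨rfl, c3⟩, Finset.card_insert_of_notMem (by simp [htR]),
          Finset.card_insert_of_notMem (by simp)]
        omega
      · rw [if_neg hYt, if_neg (by simp [hYt]), this]
    · intro Y hY
      rw [Finset.filter_insert]
      by_cases hYt : b t = Y
      · subst hYt
        rw [if_pos rfl, if_pos rfl, Finset.card_insert_of_notMem (by simp [htR]), hR5 _ hbt]
      · rw [if_neg hYt, if_neg (Ne.symm hYt), hR5 Y hY]
  · simp only [run_store, eval_reg, eval_lit, eval_add, State.setArr_arr, hti, e2, e1, if_true,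
      show ¬ (17 : ℕ) = 18 by decide, if_false]
    refine ⟨R, ?_, ?_, ?_, ?_, hR5⟩
    · intro v hv
      exact ⟨(hR1 v hv).1.trans (by omega), (hR1 v hv).2⟩
    · intro v hv
      rw [if_neg, hR2 v hv]
      rintro rfl
      exact htR hv
    · intro v hv hvR
      split_ifs with h1
      · rfl
      · exact hR3 v (by omega) hvR
    · intro Y hY h1 h2
      have := hR4 Y hY h1 h2
      rw [Finset.range_add_one, Finset.filter_insert]
      by_cases hYt : b t = Y ∧ Att E b pa t
      · obtain ⟨rfl, h3⟩ := hYt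
        rw [if_pos ⟨rfl, h3⟩, Finset.card_insert_of_notMem (by simp)]
        have : ¬ (R.filter fun v => b v = b t).card < σ.arr 22 (b t) - σ.arr 20 (b t) :=
          fun h => hc ⟨h1, h2, h3, h⟩
        omega
      · rw [if_neg hYt, this]

/-- The memory holds the state of an auction. -/
structure InAuction (n p : ℕ) (E : ℕ → ℕ → Prop) (b pa : ℕ → ℕ) (U R : Finset ℕ) (σ : State) :
    Prop where
  ready : Ready n p E b pa σ
  sub : ∀ u ∈ U, u < n
  bidder : ∀ v < n, σ.arr 14 v = 1 ↔ v ∈ U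
  limit : σ.reg 16 = U.card + 1
  auction : Auction U R E (U.card + 1) (σ.arr 15) (σ.arr 16) (σ.arr 18)
  active_lt : ∀ v ∈ R, v < n
  inactive : ∀ v < n, v ∉ R → σ.arr 18 v = U.card + 2

open scoped Classical in
/-- The auction starts with all bidders pending and all prices `0`. -/
lemma initAuction_spec (h : Ready n p E b pa σ) (hbag : ∀ v < n, b v < p) {U : Finset ℕ}
    (hsub : ∀ u ∈ U, u < n) (hU : ∀ v < n, σ.arr 14 v = 1 ↔ v ∈ U)
    (hle : ∀ Y < p, pa Y = σ.reg 13 + 1 → σ.arr 22 Y - σ.arr 20 Y ≤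
      ((Finset.range n).filter fun v => b v = Y ∧ Att E b pa v).card) :
    ∃ R : Finset ℕ, InAuction n p E b pa U R (initAuction.run σ) ∧
      (∀ v ∈ R, v < n ∧ pa (b v) = σ.reg 13 + 1 ∧ b v ≠ σ.reg 14 ∧ Att E b pa v) ∧
      ∀ Y < p, pa Y = σ.reg 13 + 1 → Y ≠ σ.reg 14 → (R.filter fun v => b v = Y).card =
        σ.arr 22 Y - σ.arr 20 Y := by
  have hrτ : Ready n p E b pa (initAuction.run σ) := h.run rfl
  have h14 : (initAuction.run σ).arr 14 = σ.arr 14 := run_arr _ _ rfl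
  generalize hτ : initAuction.run σ = τ at hrτ h14
  simp only [initAuction, run_seq] at hτ
  set σ1 := (loop 11 0 (ite (lit 1) (store 15 (reg 11) (load 14 (reg 11))) skip)).run σ with h1
  set σ2 := (assign 16 (lit 1)).run σ1 with h2
  set σ3 := (loop 11 0 (ite (load 14 (reg 11) =ᵉ lit 1) (assign 16 (reg 16 +ᵉ lit 1)) skip)).run σ2
    with h3
  set σ4 := (loop 11 0 (ite (lit 1) (store 16 (reg 11) (lit 0)) skip)).run σ3 with h4
  have r1 : Ready n p E b pa σ1 := h.run rfl
  have r2 : Ready n p E b pa σ2 := r1.run rfl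
  have r3 : Ready n p E b pa σ3 := r2.run rfl
  have r4 : Ready n p E b pa σ4 := r3.run rfl
  have f1 : (∀ r ∈ [13, 14], σ1.reg r = σ.reg r) ∧ ∀ A ∈ [14, 20, 22], σ1.arr A = σ.arr A :=
    keeps_frame rfl (frame_run _ σ)
  have f2 : (∀ r ∈ [13, 14], σ2.reg r = σ1.reg r) ∧
      ∀ A ∈ [14, 15, 20, 22], σ2.arr A = σ1.arr A := keeps_frame rfl (frame_run _ σ1)
  have f3 : (∀ r ∈ [13, 14], σ3.reg r = σ2.reg r) ∧
      ∀ A ∈ [14, 15, 20, 22], σ3.arr A = σ2.arr A := keeps_frame rfl (frame_run _ σ2)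
  have f4 : (∀ r ∈ [13, 14, 16], σ4.reg r = σ3.reg r) ∧
      ∀ A ∈ [14, 15, 20, 22], σ4.arr A = σ3.arr A := keeps_frame rfl (frame_run _ σ3)
  have f5 : (∀ r ∈ [13, 14, 16], τ.reg r = σ4.reg r) ∧
      ∀ A ∈ [14, 15, 16, 20, 22], τ.arr A = σ4.arr A := by
    rw [← hτ]
    exact keeps_frame rfl (frame_run initPrices σ4)
  simp only [List.mem_cons, List.not_mem_nil, or_false, forall_eq_or_imp, forall_eq]
    at f1 f2 f3 f4 f5
  have a15 : ∀ v < n, τ.arr 15 v = σ.arr 14 v := by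
    intro v hv
    rw [f5.2.2.1, f4.2.2.1, f3.2.2.1, f2.2.2.1, h1, run_loop_map _ rfl rfl]
    simp [h.reg0, hv, Holds]
  have a16 : ∀ v < n, τ.arr 16 v = 0 := by
    intro v hv
    rw [f5.2.2.2.1, h4, run_loop_map _ rfl rfl]
    simp [r3.reg0, hv, Holds]
  have e16 : σ4.reg 16 = U.card + 1 := by
    rw [f4.1.2.2, h3, run_loop_count _ (by decide) rfl]
    have : ((Finset.range (σ2.reg 0)).filter fun j =>
        (load 14 (reg 11) =ᵉ lit 1).Holds (σ2.setReg 11 j)) = U := by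
      ext v
      simp only [holds_eq, eval_load, eval_reg, eval_lit, State.setReg_reg, State.setReg_arr,
        if_true, Finset.mem_filter, Finset.mem_range, r2.reg0, f2, f1]
      exact ⟨fun h => (hU v h.1).1 h.2, fun h => ⟨hsub v h, (hU v (hsub v h)).2 h⟩⟩
    rw [this, h2]
    simp [add_comm]
  obtain ⟨R, hR1, hR2, hR3, hR4⟩ := initPrices_spec r4 hbag
  rw [hτ] at hR2 hR3
  rw [f4.1.1, f3.1.1, f2.1.1, f1.1.1, f4.1.2.1, f3.1.2, f2.1.2, f1.1.2] at hR1 hR4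
  refine ⟨R, ⟨hrτ, hsub, ?_, ?_, ⟨?_, ?_, ?_, ?_, ?_⟩, fun v hv => (hR1 v hv).1, ?_⟩, hR1, ?_⟩
  · rw [h14]; exact hU
  · rw [f5.1.2.2, e16]
  · intro v hv hv0
    exact absurd (a16 v (hR1 v hv).1) hv0
  · exact fun v hv _ => hR2 v hv
  · intro v hv _ _ _ hv0
    exact absurd (a16 v (hR1 v hv).1) hv0
  · intro u hu hu1
    rw [a15 u (hsub u hu), (hU u (hsub u hu)).2 hu] at hu1
    exact absurd rfl hu1
  · intro v hv
    rw [hR2 v hv]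
    exact Nat.zero_le _
  · intro v hv hvR
    rw [hR3 v hv hvR, e16]
  · intro Y hY h1 h2
    rw [hR4 Y hY h1 h2, f4.2.2.2.2, f3.2.2.2.2, f2.2.2.2.2, f1.2.2.2, f4.2.2.2.1, f3.2.2.2.1,
      f2.2.2.2.1, f1.2.2.1]
    exact min_eq_left (hle Y hY h1)

/-- `reg 17` receives the least price of a vertex adjacent to a pending bidder, and `reg 18`, `reg 19`
such a bidder and such a vertex; if there is no price below `reg 16`, then `reg 17` is `reg 16`. -/
lemma findBid_spec (σ : State) :
    (∀ j < σ.reg 5, σ.arr 14 (σ.arr 5 j) = 1 → σ.arr 15 (σ.arr 5 j) = 1 →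
      (findBid.run σ).reg 17 ≤ σ.arr 18 (σ.arr 6 j)) ∧
    ((findBid.run σ).reg 17 = σ.reg 16 ∨ (findBid.run σ).reg 17 < σ.reg 16 ∧
      ∃ j < σ.reg 5, σ.arr 5 j = (findBid.run σ).reg 18 ∧ σ.arr 6 j = (findBid.run σ).reg 19 ∧
        σ.arr 14 (σ.arr 5 j) = 1 ∧ σ.arr 15 (σ.arr 5 j) = 1 ∧
        σ.arr 18 (σ.arr 6 j) = (findBid.run σ).reg 17) := by
  simp only [findBid, run_seq]
  set σ1 := (assign 17 (reg 16)).run σ with h1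
  have e5 : σ1.reg 5 = σ.reg 5 := by simp [h1]
  have e17 : σ1.reg 17 = σ.reg 16 := by simp [h1]
  have ea : σ1.arr = σ.arr := by simp [h1]
  rw [← e5]
  refine run_loop_induction (σ := σ1) (P := fun t τ =>
    (∀ j < t, σ.arr 14 (σ.arr 5 j) = 1 → σ.arr 15 (σ.arr 5 j) = 1 →
      τ.reg 17 ≤ σ.arr 18 (σ.arr 6 j)) ∧
    (τ.reg 17 = σ.reg 16 ∨ τ.reg 17 < σ.reg 16 ∧
      ∃ j < t, σ.arr 5 j = τ.reg 18 ∧ σ.arr 6 j = τ.reg 19 ∧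
        σ.arr 14 (σ.arr 5 j) = 1 ∧ σ.arr 15 (σ.arr 5 j) = 1 ∧
        σ.arr 18 (σ.arr 6 j) = τ.reg 17)) ?_ ?_
  · simp [e17]
  rintro t τ ht hti hF ⟨hP1, hP2⟩
  have ha : ∀ A ∈ [5, 6, 14, 15, 18], τ.arr A = σ1.arr A := (keeps_frame (rs := []) rfl hF).2
  simp only [List.mem_cons, List.not_mem_nil, or_false, forall_eq_or_imp, forall_eq, ea] at ha
  have h17 : τ.reg 17 ≤ σ.reg 16 := by
    rcases hP2 with h | h
    · exact h.le
    · exact h.1.le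
  simp only [run_ite, holds_and, holds_eq, holds_lt, eval_load, eval_reg, eval_lit, hti, ha]
  split_ifs with hc
  · obtain ⟨c1, c2, c3⟩ := hc
    simp only [run_seq, run_assign, eval_load, eval_reg, State.setReg_reg, State.setReg_arr, hti,
      ha, show ¬ (17 : ℕ) = 12 by decide, show ¬ (18 : ℕ) = 12 by decide,
      show ¬ (19 : ℕ) = 12 by decide, show ¬ (17 : ℕ) = 19 by decide,
      show ¬ (17 : ℕ) = 18 by decide, show ¬ (18 : ℕ) = 19 by decide,
      show ¬ (12 : ℕ) = 18 by decide, show ¬ (12 : ℕ) = 17 by decide, if_true, if_false]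
    refine ⟨fun j hj hj1 hj2 => ?_, .inr ⟨c3.trans_le h17, t, by omega, rfl, rfl, c1, c2, rfl⟩⟩
    rcases Nat.lt_succ_iff_lt_or_eq.1 hj with hj | rfl
    · exact c3.le.trans (hP1 j hj hj1 hj2)
    · exact le_rfl
  · simp only [run_skip, State.setReg_reg, show ¬ (17 : ℕ) = 12 by decide,
      show ¬ (18 : ℕ) = 12 by decide, show ¬ (19 : ℕ) = 12 by decide, if_false]
    refine ⟨fun j hj hj1 hj2 => ?_, ?_⟩
    · rcases Nat.lt_succ_iff_lt_or_eq.1 hj with hj | rfl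
      · exact hP1 j hj hj1 hj2
      · exact not_lt.1 fun h => hc ⟨hj1, hj2, h⟩
    · rcases hP2 with h | ⟨h, j, hj, h'⟩
      · exact .inl h
      · exact .inr ⟨h, j, by omega, h'⟩

/-- One iteration either raises the total price by one, or there is no further bid. -/
lemma bid_spec {U R : Finset ℕ} (h : InAuction n p E b pa U R σ) :
    InAuction n p E b pa U R ((findBid ;; placeBid).run σ) ∧
      ((∑ v ∈ R, ((findBid ;; placeBid).run σ).arr 18 v = ∑ v ∈ R, σ.arr 18 v + 1 ∧
        ¬ ∀ u ∈ U, σ.arr 15 u = 1 → ∀ v ∈ R, E u v → U.card + 1 ≤ σ.arr 18 v) ∨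
      (∀ u ∈ U, ((findBid ;; placeBid).run σ).arr 15 u = 1 → ∀ v ∈ R, E u v →
        U.card + 1 ≤ ((findBid ;; placeBid).run σ).arr 18 v)) := by
  have hrτ : Ready n p E b pa ((findBid ;; placeBid).run σ) := h.ready.run rfl
  have h14 : ((findBid ;; placeBid).run σ).arr 14 = σ.arr 14 := run_arr _ _ rfl
  have h16 : ((findBid ;; placeBid).run σ).reg 16 = σ.reg 16 := run_reg _ _ rfl
  obtain ⟨hmin, hfound⟩ := findBid_spec σ
  have f : (∀ r ∈ [16], (findBid.run σ).reg r = σ.reg r) ∧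
    ∀ A ∈ [15, 16, 18], (findBid.run σ).arr A = σ.arr A := keeps_frame rfl (frame_run _ σ)
  rw [run_seq] at *
  set σ1 := findBid.run σ with h1
  simp only [List.mem_cons, List.not_mem_nil, or_false, forall_eq_or_imp, forall_eq] at f
  have hmin' : ∀ u ∈ U, σ.arr 15 u = 1 → ∀ v, E u v → σ1.reg 17 ≤ σ.arr 18 v := by
    intro u hu hu1 v huv
    obtain ⟨j, hj, rfl, rfl⟩ := (h.ready.edge u v).1 huv
    exact hmin j hj ((h.bidder _ (h.sub _ hu)).2 hu) hu1
  rcases hfound with h17 | ⟨h17, j, hj, hj5, hj6, hu14, hu15, hpr⟩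
  · have hno : placeBid.run σ1 = σ1 := by
      simp [placeBid, h17, f]
    rw [hno] at hrτ h14 h16 ⊢
    refine ⟨⟨hrτ, h.sub, by rw [h14]; exact h.bidder, by rw [h16]; exact h.limit, ?_, h.active_lt,
      ?_⟩, .inr fun u hu hu1 v hv huv => ?_⟩
    · rw [f.2.1, f.2.2.1, f.2.2.2]
      exact h.auction
    · rw [f.2.2.2]
      exact h.inactive
    · rw [f.2.1] at hu1
      rw [f.2.2.2]
      have := hmin' u hu hu1 v huv
      rw [← h.limit]
      omega
  · have hE : E (σ1.reg 18) (σ1.reg 19) := (h.ready.edge _ _).2 ⟨j, hj, hj5, hj6⟩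
    rw [hj5] at hu14 hu15
    rw [hj6] at hpr
    have hlim := h.limit
    have huU : σ1.reg 18 ∈ U :=
      (h.bidder _ (h.ready.lt _ _ hE).1).1 hu14
    have hvn : σ1.reg 19 < n := (h.ready.lt _ _ hE).2
    have hvR : σ1.reg 19 ∈ R := by
      by_contra hv
      have := h.inactive _ hvn hv
      omega
    have a15 : ∀ x, (placeBid.run σ1).arr 15 x = if x = σ1.reg 18 then 0 else
        if σ.arr 16 (σ1.reg 19) ≠ 0 ∧ x = σ.arr 16 (σ1.reg 19) - 1 then 1 else σ.arr 15 x := by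
      intro x
      by_cases h0 : σ.arr 16 (σ1.reg 19) = 0 <;>
        simp [placeBid, h17, f, h0]
    have a16 : ∀ x, (placeBid.run σ1).arr 16 x = if x = σ1.reg 19 then σ1.reg 18 + 1 else
        σ.arr 16 x := by
      intro x
      by_cases h0 : σ.arr 16 (σ1.reg 19) = 0 <;>
        simp [placeBid, h17, f, h0]
    have a18 : ∀ x, (placeBid.run σ1).arr 18 x = if x = σ1.reg 19 then σ.arr 18 (σ1.reg 19) + 1
        else σ.arr 18 x := by
      intro x
      by_cases h0 : σ.arr 16 (σ1.reg 19) = 0 <;>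
        simp [placeBid, h17, f, h0, hpr]
    obtain ⟨hA, hsum⟩ := h.auction.bid huU hu15 hvR hE (by omega)
      (fun v' _ hE' => by rw [hpr]; exact hmin' _ huU hu15 v' hE') a15 a16 a18
    refine ⟨⟨hrτ, h.sub, by rw [h14]; exact h.bidder, by rw [h16]; exact h.limit, hA, h.active_lt,
      ?_⟩, .inl ⟨hsum, fun hd => ?_⟩⟩
    · intro v hv hvR'
      rw [a18, if_neg, h.inactive v hv hvR']
      rintro rfl
      exact hvR' hvR
    · have := hd _ huU hu15 _ hvR hE
      omega

end RAM

namespace RAM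

open RAM.Expr RAM.Cmd WPC

variable {n p : ℕ} {E : ℕ → ℕ → Prop} {b pa : ℕ → ℕ} {σ τ : State} {U R : Finset ℕ}

lemma InAuction.of_eq (h : InAuction n p E b pa U R σ)
    (hr : ∀ r ∈ [0, 2, 5, 6, 7, 16], τ.reg r = σ.reg r)
    (ha : ∀ A ∈ [2, 5, 6, 9, 12, 14, 15, 16, 18], τ.arr A = σ.arr A) :
    InAuction n p E b pa U R τ := by
  refine ⟨h.ready.of_eq (fun r hr' => hr r ?_) (fun A ha' => ha A ?_), h.sub, ?_, ?_, ?_,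
    h.active_lt, ?_⟩
  · simp only [List.mem_cons, List.not_mem_nil, or_false] at hr' ⊢
    tauto
  · simp only [List.mem_cons, List.not_mem_nil, or_false] at ha' ⊢
    tauto
  · rw [ha 14 (by simp)]; exact h.bidder
  · rw [hr 16 (by simp)]; exact h.limit
  · rw [ha 15 (by simp), ha 16 (by simp), ha 18 (by simp)]; exact h.auction
  · rw [ha 18 (by simp)]; exact h.inactive

/-- The loop is long enough for the auction to end: each bid raises the total price by one, and the
total price is at most `U.card * (U.card + 1)`. -/
lemma auction_spec (h : InAuction n p E b pa U R σ) {X : ℕ} (hX : ∀ u ∈ U, b u = X) :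
    InAuction n p E b pa U R (auction.run σ) ∧ ∀ u ∈ U, (auction.run σ).arr 15 u = 1 →
      ∀ v ∈ R, E u v → U.card + 1 ≤ (auction.run σ).arr 18 v := by
  have key : InAuction n p E b pa U R (auction.run σ) ∧
      (σ.reg 6 ≤ ∑ v ∈ R, (auction.run σ).arr 18 v ∨ ∀ u ∈ U, (auction.run σ).arr 15 u = 1 →
        ∀ v ∈ R, E u v → U.card + 1 ≤ (auction.run σ).arr 18 v) := by
    refine run_loop_induction (σ := σ) (P := fun t τ => InAuction n p E b pa U R τ ∧
      (t ≤ ∑ v ∈ R, τ.arr 18 v ∨ ∀ u ∈ U, τ.arr 15 u = 1 →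
        ∀ v ∈ R, E u v → U.card + 1 ≤ τ.arr 18 v)) ?_ ?_
    · exact ⟨h.of_eq (by simp) (by simp), .inl (Nat.zero_le _)⟩
    · rintro t τ - - - ⟨hP1, hP2⟩
      obtain ⟨h1, h2⟩ := bid_spec hP1
      refine ⟨h1.of_eq (by simp) (by simp), ?_⟩
      simp only [State.setReg_arr]
      rcases h2 with ⟨h2, h3⟩ | h2
      · rcases hP2 with hP2 | hP2
        · exact .inl (by omega)
        · exact absurd hP2 h3
      · exact .inr h2
  refine ⟨key.1, key.2.resolve_left fun h6 => ?_⟩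
  have h1 := key.1.auction.sum_price_le
  have h2 := h.ready.bids U X fun v hv => ⟨h.sub v hv, hX v hv⟩
  omega

/-- The search for a gap succeeds, since at most `U.card` active vertices have positive price. -/
lemma findGap_spec (h : InAuction n p E b pa U R σ) (hUn : U.card ≤ n) :
    1 ≤ (findGap.run σ).reg 20 ∧ (findGap.run σ).reg 20 ≤ U.card + 1 ∧
      ∀ v ∈ R, σ.arr 18 v ≠ (findGap.run σ).reg 20 := by
  simp only [findGap, run_seq]
  set σ1 := (assign 20 (lit 0)).run σ with h1
  have e7 : σ1.reg 7 = n + 1 := by simp [h1, h.ready.reg7]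
  have e0 : σ1.reg 0 = n := by simp [h1, h.ready.reg0]
  have ea : σ1.arr = σ.arr := by simp [h1]
  have key := run_loop_induction (i := 11) (N := 7) (c := assign 21 (lit 0) ;;
      loop 12 0 (ite (load 18 (reg 12) =ᵉ reg 11 +ᵉ lit 1) (assign 21 (lit 1)) skip) ;;
      ite (reg 21 =ᵉ lit 0 ∧ᵉ reg 20 =ᵉ lit 0) (assign 20 (reg 11 +ᵉ lit 1)) skip) (σ := σ1)
    (P := fun t τ =>
      (τ.reg 20 = 0 ∧ ∀ s, 1 ≤ s → s ≤ t → ∃ v < n, σ.arr 18 v = s) ∨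
      (1 ≤ τ.reg 20 ∧ (∀ v < n, σ.arr 18 v ≠ τ.reg 20) ∧
        ∀ s, 1 ≤ s → s < τ.reg 20 → ∃ v < n, σ.arr 18 v = s)) ?_ ?_
  · rw [e7] at key
    obtain ⟨t, ht1, ht2, ht3⟩ := h.auction.exists_gap
    have ht4 : ∀ v < n, σ.arr 18 v ≠ t := by
      intro v hv
      by_cases hvR : v ∈ R
      · exact ht3 v hvR
      · rw [h.inactive v hv hvR]
        omega
    rcases key with ⟨-, hs⟩ | ⟨hs1, hs2, hs3⟩
    · obtain ⟨v, hv, hvt⟩ := hs t ht1 (by omega)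
      exact absurd hvt (ht4 v hv)
    · refine ⟨hs1, ?_, fun v hv => hs2 v (h.active_lt v hv)⟩
      by_contra hlt
      obtain ⟨v, hv, hvt⟩ := hs3 t ht1 (by omega)
      exact ht4 v hv hvt
  · left
    refine ⟨by simp [h1], fun s h1 h2 => by omega⟩
  · intro t τ ht hti hF hP
    simp only [run_seq]
    set τ1 := (assign 21 (lit 0)).run τ with hτ1
    have f1 : (∀ r ∈ [0, 11, 20], τ1.reg r = τ.reg r) ∧ ∀ A ∈ [18], τ1.arr A = τ.arr A :=
      keeps_frame rfl (frame_run _ τ)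
    have f2 : ∀ r ∈ [0], τ.reg r = σ1.reg r := (keeps_frame (as := []) rfl hF).1
    have f3 : ∀ A ∈ [18], τ.arr A = σ1.arr A := (keeps_frame (rs := []) rfl hF).2
    set τ2 := (loop 12 0 (ite (load 18 (reg 12) =ᵉ reg 11 +ᵉ lit 1)
      (assign 21 (lit 1)) skip)).run τ1 with hτ2
    have f4 : ∀ r ∈ [11, 20], τ2.reg r = τ1.reg r :=
      (keeps_frame (as := []) rfl (frame_run _ τ1)).1
    simp only [List.mem_cons, List.not_mem_nil, or_false, forall_eq_or_imp, forall_eq]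
      at f1 f2 f3 f4
    have h21 : τ2.reg 21 = 0 ↔ ∀ v < n, σ.arr 18 v ≠ t + 1 := by
      have hex : (∃ j < τ1.reg 0, (load 18 (reg 12) =ᵉ reg 11 +ᵉ lit 1).Holds (τ1.setReg 12 j)) ↔
          ∃ v < n, σ.arr 18 v = t + 1 := by
        simp only [holds_eq, eval_load, eval_reg, eval_add, eval_lit, State.setReg_reg,
          State.setReg_arr, if_true, show ¬ (11 : ℕ) = 12 by decide, if_false, f1, f2, f3, hti, e0,
          ea]
      rw [hτ2, run_loop_any _ (by decide) rfl]
      by_cases hc : ∃ v < n, σ.arr 18 v = t + 1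
      · rw [if_pos (hex.2 hc)]
        simpa using hc
      · rw [if_neg fun h => hc (hex.1 h)]
        push Not at hc
        simpa [hτ1] using hc
    simp only [run_ite, holds_and, holds_eq, eval_reg, eval_lit, h21, f4, f1]
    split_ifs with hc
    · right
      simp only [run_assign, eval_add, eval_reg, eval_lit, State.setReg_reg,
        show ¬ (20 : ℕ) = 11 by decide, if_false, if_true, f4, f1, hti]
      rcases hP with ⟨-, hs⟩ | ⟨hs, -⟩
      · exact ⟨by omega, hc.1, fun s h1 h2 => hs s h1 (by omega)⟩
      · omega
    · simp only [run_skip, State.setReg_reg, show ¬ (20 : ℕ) = 11 by decide, if_false, f4, f1]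
      rcases hP with ⟨h20, hs⟩ | hP
      · left
        refine ⟨h20, fun s h1 h2 => ?_⟩
        by_cases hst : s ≤ t
        · exact hs s h1 hst
        · by_contra hno
          push Not at hno
          have : s = t + 1 := by omega
          subst this
          exact hc ⟨hno, h20⟩
      · exact .inr hP

/-- The value of the job is the number of bidders that remain pending, minus the loss in the merged
child; the set consists of the bidders all of whose active neighbours cost more than the gap. -/
lemma evaluate_spec (h : InAuction n p E b pa U R σ) (ht : σ.reg 20 ≤ U.card + 1) :
    (evaluate.run σ).reg 22 = (U.filter fun u => σ.arr 15 u = 1).card -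
        (if σ.reg 13 = σ.reg 14 then 0 else σ.arr 22 (σ.reg 14) - σ.arr 21 (σ.reg 14)) ∧
      ∀ v < n, (evaluate.run σ).arr 14 v = 1 ↔
        v ∈ U ∧ ∀ w ∈ R, E v w → σ.reg 20 < σ.arr 18 w := by
  simp only [evaluate, run_seq]
  set σ1 := (assign 22 (lit 0)).run σ with h1
  set σ2 := (loop 11 0 (ite (load 14 (reg 11) =ᵉ lit 1 ∧ᵉ load 15 (reg 11) =ᵉ lit 1)
    (assign 22 (reg 22 +ᵉ lit 1)) skip)).run σ1 with h2
  set σ3 := (ite (reg 13 =ᵉ reg 14) skip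
    (assign 22 (reg 22 -ᵉ (load 22 (reg 14) -ᵉ load 21 (reg 14))))).run σ2 with h3
  have f1 : (∀ r ∈ [0, 5, 13, 14, 20], σ1.reg r = σ.reg r) ∧
    ∀ A ∈ [5, 6, 14, 15, 18, 21, 22], σ1.arr A = σ.arr A := keeps_frame rfl (frame_run _ σ)
  have f2 : (∀ r ∈ [0, 5, 13, 14, 20], σ2.reg r = σ1.reg r) ∧
    ∀ A ∈ [5, 6, 14, 15, 18, 21, 22], σ2.arr A = σ1.arr A := keeps_frame rfl (frame_run _ σ1)
  have f3 : (∀ r ∈ [0, 5, 13, 14, 20], σ3.reg r = σ2.reg r) ∧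
    ∀ A ∈ [5, 6, 14, 15, 18, 21, 22], σ3.arr A = σ2.arr A := keeps_frame rfl (frame_run _ σ2)
  simp only [List.mem_cons, List.not_mem_nil, or_false, forall_eq_or_imp, forall_eq] at f1 f2 f3
  have e22 : σ2.reg 22 = (U.filter fun u => σ.arr 15 u = 1).card := by
    rw [h2, run_loop_count _ (by decide) rfl]
    have : ((Finset.range (σ1.reg 0)).filter fun j =>
        (load 14 (reg 11) =ᵉ lit 1 ∧ᵉ load 15 (reg 11) =ᵉ lit 1).Holds (σ1.setReg 11 j)) =
        U.filter fun u => σ.arr 15 u = 1 := by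
      ext v
      simp only [holds_and, holds_eq, eval_load, eval_reg, eval_lit, State.setReg_reg,
        State.setReg_arr, if_true, Finset.mem_filter, Finset.mem_range, f1, h.ready.reg0]
      constructor
      · rintro ⟨h1, h2, h3⟩
        exact ⟨(h.bidder v h1).1 h2, h3⟩
      · rintro ⟨h1, h2⟩
        exact ⟨h.sub v h1, (h.bidder v (h.sub v h1)).2 h1, h2⟩
    rw [this, h1]
    simp
  constructor
  · rw [run_reg _ _ rfl, h3, run_ite]
    simp only [holds_eq, eval_reg, f2, f1]
    split_ifs with hXZ
    · simpa using e22
    · simp [e22, f2, f1]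
  · intro v hv
    have hex : (∃ j < σ3.reg 5, (load 18 (load 6 (reg 11)) <ᵉ reg 20 +ᵉ lit 1).Holds
        (σ3.setReg 11 j) ∧ (load 5 (reg 11)).eval (σ3.setReg 11 j) = v) ↔
        ∃ w, E v w ∧ σ.arr 18 w ≤ σ.reg 20 := by
      simp only [holds_lt, eval_load, eval_reg, eval_lit, eval_add, State.setReg_reg,
        State.setReg_arr, if_true, show ¬ (20 : ℕ) = 11 by decide, if_false, f3, f2, f1,
        h.ready.edge, Nat.lt_succ_iff]
      constructor
      · rintro ⟨j, hj, h1, h2⟩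
        exact ⟨_, ⟨j, hj, h2, rfl⟩, h1⟩
      · rintro ⟨w, ⟨j, hj, h2, h3⟩, h1⟩
        exact ⟨j, hj, by rwa [h3], h2⟩
    rw [run_loop_mark _ rfl rfl, f3.2.2.2.1, f2.2.2.2.1, f1.2.2.2.1]
    by_cases hc : ∃ w, E v w ∧ σ.arr 18 w ≤ σ.reg 20
    · rw [if_pos (hex.2 hc)]
      simp only [zero_ne_one, false_iff, not_and]
      intro _ hall
      obtain ⟨w, hw, hle⟩ := hc
      have hwR : w ∈ R := by
        by_contra hwR
        have := h.inactive w (h.ready.lt _ _ hw).2 hwR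
        omega
      have := hall w hwR hw
      omega
    · rw [if_neg fun h => hc (hex.1 h), h.bidder v hv]
      push Not at hc
      exact ⟨fun h => ⟨h, fun w _ hw => hc w hw⟩, fun h => h.1⟩

open scoped Classical in
/-- The job finds an optimal set of vertices to be kept in a bag, for a fixed mode and a fixed child
with which the bag is merged. -/
theorem solveJob_spec (hT : RootedBags n p E b pa) (h : Ready n p E b pa σ) {M X Z : ℕ}
    (hM : σ.reg 15 = M) (hX : σ.reg 13 = X) (hZ : σ.reg 14 = Z) (hM3 : M < 3)
    (hXZ : X = Z ∨ Z < p ∧ pa Z = X + 1) (val : ℕ → ℕ → ℕ) (hval : ∀ i < 3, σ.arr (20 + i) = val i)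
    (hle : ∀ Y < p, pa Y = X + 1 → val 2 Y - val 0 Y ≤
      ((Finset.range n).filter fun v => b v = Y ∧ Att E b pa v).card) :
    (∀ L, Feasible n p E b pa M X (if X = Z then 0 else Z + 1) L →
      L.card ≤ (solveJob.run σ).reg 22 +
        loss p E b pa val (if X = Z then 0 else Z + 1) X L) ∧
    (0 < (solveJob.run σ).reg 22 → ∀ L : Finset ℕ,
      (∀ v, v ∈ L ↔ v < n ∧ b v = X ∧ (solveJob.run σ).arr 14 v = 1) →
      Feasible n p E b pa M X (if X = Z then 0 else Z + 1) L ∧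
      L.card = (solveJob.run σ).reg 22 +
        loss p E b pa val (if X = Z then 0 else Z + 1) X L) := by
  simp only [solveJob, run_seq]
  set σ1 := markBidders.run σ with h1
  set σ2 := initAuction.run σ1 with h2
  set σ3 := auction.run σ2 with h3
  set σ4 := findGap.run σ3 with h4
  have r1 : Ready n p E b pa σ1 := h.run rfl
  have f1 : (∀ r ∈ [13, 14], σ1.reg r = σ.reg r) ∧ ∀ A ∈ [20, 21, 22], σ1.arr A = σ.arr A :=
    keeps_frame rfl (frame_run _ σ)
  have f2 : (∀ r ∈ [13, 14], σ2.reg r = σ1.reg r) ∧ ∀ A ∈ [20, 21, 22], σ2.arr A = σ1.arr A :=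
    keeps_frame rfl (frame_run _ σ1)
  have f3 : (∀ r ∈ [13, 14], σ3.reg r = σ2.reg r) ∧ ∀ A ∈ [20, 21, 22], σ3.arr A = σ2.arr A :=
    keeps_frame rfl (frame_run _ σ2)
  have f4 : (∀ r ∈ [13, 14], σ4.reg r = σ3.reg r) ∧
      ∀ A ∈ [15, 18, 21, 22], σ4.arr A = σ3.arr A := keeps_frame rfl (frame_run _ σ3)
  have f4' : (∀ r ∈ [0, 2, 5, 6, 7, 16], σ4.reg r = σ3.reg r) ∧
      ∀ A ∈ [2, 5, 6, 9, 12, 14, 15, 16, 18], σ4.arr A = σ3.arr A :=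
    keeps_frame rfl (frame_run _ σ3)
  simp only [List.mem_cons, List.not_mem_nil, or_false, forall_eq_or_imp, forall_eq]
    at f1 f2 f3 f4
  set U := (Finset.range n).filter (Bidder n E b pa M X Z) with hU
  have hUmem : ∀ v, v ∈ U ↔ Bidder n E b pa M X Z v := by
    intro v
    simp only [hU, Finset.mem_filter, Finset.mem_range, and_iff_right_iff_imp]
    exact fun h => h.1
  have hUX : ∀ u ∈ U, b u = X := fun u hu => ((hUmem u).1 hu).2.1
  have hv0 : ∀ Y, σ.arr 20 Y = val 0 Y := fun Y => congrFun (hval 0 (by simp)) Y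
  have hv1 : ∀ Y, σ.arr 21 Y = val 1 Y := fun Y => congrFun (hval 1 (by simp)) Y
  have hv2 : ∀ Y, σ.arr 22 Y = val 2 Y := fun Y => congrFun (hval 2 (by simp)) Y
  obtain ⟨R, hA, hR, hcard⟩ := initAuction_spec r1 (fun v hv => hT.bag_lt hv) (U := U)
    (fun u hu => ((hUmem u).1 hu).1)
    (fun v hv => by rw [hUmem, h1, markBidders_spec h (by omega) hv, hM, hX, hZ])
    (by
      intro Y hY hXY
      rw [f1.2.1, f1.2.2.2, hv0, hv2]
      exact hle Y hY (by rw [hXY, f1.1.1, hX]))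
  rw [f1.1.1, f1.1.2, hX, hZ] at hR hcard
  simp only [f1, hv0, hv2] at hcard
  rw [← h2] at hA
  obtain ⟨hA3, hdone⟩ := auction_spec hA hUX
  rw [← h3] at hA3 hdone
  obtain ⟨hg1, hg2, hg3⟩ := findGap_spec hA3
    ((Finset.card_filter_le _ _).trans (by simp))
  rw [← h4] at hg1 hg2 hg3
  have hA4 : InAuction n p E b pa U R σ4 := hA3.of_eq f4'.1 f4'.2
  obtain ⟨hval22, hloc⟩ := evaluate_spec hA4 hg2
  have e13 : σ4.reg 13 = X := by rw [f4.1.1, f3.1.1, f2.1.1, f1.1.1, hX]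
  have e14 : σ4.reg 14 = Z := by rw [f4.1.2, f3.1.2, f2.1.2, f1.1.2, hZ]
  have e15 : σ4.arr 15 = σ3.arr 15 := f4.2.1
  have e18 : σ4.arr 18 = σ3.arr 18 := f4.2.2.1
  have e21 : σ4.arr 21 Z = val 1 Z := by
    rw [f4.2.2.2.1, f3.2.2.1, f2.2.2.1, f1.2.2.1, hv1]
  have e22 : σ4.arr 22 Z = val 2 Z := by
    rw [f4.2.2.2.2, f3.2.2.2, f2.2.2.2, f1.2.2.2, hv2]
  rw [e13, e14, e21, e22, e15] at hval22
  rw [e18] at hloc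
  set D := if X = Z then 0 else val 2 Z - val 1 Z with hD
  set z := if X = Z then 0 else Z + 1 with hz
  have hDz : z = 0 ∧ D = 0 ∨ ∃ Z < p, z = Z + 1 ∧ pa Z = X + 1 ∧ D = val 2 Z - val 1 Z := by
    by_cases hc : X = Z
    · simp [hz, hD, hc]
    · obtain ⟨h5, h6⟩ := hXZ.resolve_left hc
      exact .inr ⟨Z, h5, by simp [hz, hc], h6, by simp [hD, hc]⟩
  have hR' : ∀ v ∈ R, v < n ∧ pa (b v) = X + 1 ∧ b v + 1 ≠ z ∧ Att E b pa v := by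
    intro v hv
    obtain ⟨h5, h6, h7, h8⟩ := hR v hv
    refine ⟨h5, h6, ?_, h8⟩
    rw [hz]
    split_ifs <;> omega
  have hcard' : ∀ Y < p, pa Y = X + 1 → Y + 1 ≠ z →
      (R.filter fun v => b v = Y).card = val 2 Y - val 0 Y := by
    intro Y hY hXY hYz
    refine hcard Y hY hXY ?_
    rintro rfl
    rw [hz] at hYz
    split_ifs at hYz with hc
    · rw [hc] at hXY
      exact hT.pa_ne_self hY hXY
    · exact hYz rfl
  constructor
  · intro L hL
    have hLU : L ⊆ U := by
      intro v hv
      obtain ⟨h5, h6, h7⟩ := hL.1 v hv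
      refine (hUmem v).2 ⟨h5, h6, h7, ?_⟩
      by_cases hc : X = Z
      · exact .inl hc
      · rcases hL.2 with h8 | ⟨h8, Z', -, h9, -, h10⟩
        · simp [hz, hc] at h8
        · have : Z' = Z := by
            rw [hz, if_neg hc] at h9
            omega
          subst this
          exact .inr ⟨h8, h10 v hv⟩
    have h5 := hA3.auction.card_le hLU
    have h6 := hT.card_active_eq_loss (fun u hu => hUX u (hLU hu)) hR' hcard' hDz
    omega
  · intro hpos L hL
    have hLU : ∀ u, u ∈ L ↔ u ∈ U ∧ ∀ v ∈ R, E u v → σ4.reg 20 < σ3.arr 18 v := by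
      intro u
      rw [hL]
      constructor
      · rintro ⟨h5, h6, h7⟩
        exact (hloc u h5).1 h7
      · intro h5
        exact ⟨((hUmem u).1 h5.1).1, hUX u h5.1, (hloc u ((hUmem u).1 h5.1).1).2 h5⟩
    have h5 := hA3.auction.card_eq hg1 hg2 hg3 hdone hLU
    have h6 := hT.card_active_eq_loss (fun u hu => hUX u ((hLU u).1 hu).1) hR' hcard' hDz
    clear hDz
    refine ⟨⟨fun u hu => ?_, ?_⟩, by omega⟩
    · have := (hUmem u).1 ((hLU u).1 hu).1
      exact ⟨this.1, this.2.1, this.2.2.1⟩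
    · by_cases hc : X = Z
      · exact .inl (by simp [hz, hc])
      · -- A positive value shows that there is a bidder, hence merging is admissible.
        have hne : (U.filter fun u => σ3.arr 15 u = 1).Nonempty := by
          rw [← Finset.card_pos]
          omega
        obtain ⟨w, hw⟩ := hne
        have hw := ((hUmem w).1 (Finset.mem_filter.1 hw).1).2.2.2.resolve_left hc
        obtain ⟨h7, h8⟩ := hXZ.resolve_left hc
        refine .inr ⟨hw.1, Z, h7, by simp [hz, hc], h8, fun u hu => ?_⟩
        exact (((hUmem u).1 ((hLU u).1 hu).1).2.2.2.resolve_left hc).2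

end RAM

/-! ### Correctness of all jobs -/

namespace WPC

/-- A list of `Q` jobs: job `q` treats the bag `jx q`, merged with its child `jz q`, or with no
child if `jz q = jx q`. All jobs of a bag precede those of its parent. -/
structure JobList (p : ℕ) (pa : ℕ → ℕ) (Q : ℕ) (jx jz : ℕ → ℕ) : Prop where
  valid : ∀ q < Q, jx q < p ∧ (jx q = jz q ∨ jz q < p ∧ pa (jz q) = jx q + 1)
  own : ∀ X < p, ∃ q < Q, jx q = X ∧ jz q = X
  child : ∀ X < p, ∀ Z < p, pa Z = X + 1 → ∃ q < Q, jx q = X ∧ jz q = Z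
  order : ∀ q < Q, ∀ q' < Q, pa (jx q') = jx q + 1 → q' < q

/-- The invariant of the table of values: every value is attained, the job of every pair in `D`
(consisting of a mode and the index of a job) has been taken into account, and the entries of
untouched bags are trivial. -/
structure TableInv (n p : ℕ) (E : ℕ → ℕ → Prop) (b pa : ℕ → ℕ) (Q : ℕ) (jx jz : ℕ → ℕ)
    (D : ℕ → ℕ → Prop) (val mg : ℕ → ℕ → ℕ) (loc : ℕ → ℕ → Finset ℕ) : Prop where
  attained : ∀ M < 3, ∀ X < p, IsAttained n p E b pa val M X (mg M X) (loc M X)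
  upper : ∀ M < 3, ∀ q < Q, D M q →
    IsUpper n p E b pa val M (jx q) (if jx q = jz q then 0 else jz q + 1)
  fresh : ∀ X < p, (∀ q < Q, jx q = X → ∀ M < 3, ¬ D M q) →
    ∀ M < 3, val M X = 0 ∧ mg M X = 0 ∧ loc M X = ∅

variable {n p : ℕ} {E : ℕ → ℕ → Prop} {b pa : ℕ → ℕ} {Q : ℕ} {jx jz : ℕ → ℕ}
  {D : ℕ → ℕ → Prop} {val mg : ℕ → ℕ → ℕ} {loc : ℕ → ℕ → Finset ℕ}

lemma loss_congr {val' : ℕ → ℕ → ℕ} {z X : ℕ} (L : Finset ℕ)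
    (h : ∀ Y < p, pa Y = X + 1 → ∀ M < 3, val' M Y = val M Y) :
    loss p E b pa val' z X L = loss p E b pa val z X L := by
  refine Finset.sum_congr rfl fun Y hY => ?_
  obtain ⟨h1, h2⟩ := Finset.mem_filter.1 hY
  have := h Y (Finset.mem_range.1 h1) h2
  rw [this 0 (by simp), this 1 (by simp), this 2 (by simp)]

lemma loss_empty (X : ℕ) : loss p E b pa val 0 X ∅ = 0 := by
  refine Finset.sum_eq_zero fun Y _ => ?_
  simp [Hits]

lemma isAttained_empty {M X : ℕ} (h : val M X = 0) : IsAttained n p E b pa val M X 0 ∅ := by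
  refine ⟨⟨by simp, .inl rfl⟩, ?_⟩
  rw [loss_empty, h]
  rfl

/-- Once all jobs of a bag are done, its value bounds all feasible sets. -/
lemma TableInv.isUpper (h : TableInv n p E b pa Q jx jz D val mg loc) (hJ : JobList p pa Q jx jz)
    {M X : ℕ} (hM : M < 3) (hX : X < p) (hD : ∀ q < Q, jx q = X → D M q) (z : ℕ) :
    IsUpper n p E b pa val M X z := by
  intro L hL
  rcases hL.2 with h0 | ⟨-, Z, hZ, h0, hXZ, -⟩
  · obtain ⟨q, hq, h1, h2⟩ := hJ.own X hX
    have := h.upper M hM q hq (hD q hq h1)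
    rw [h1, h2, if_pos rfl, ← h0] at this
    exact this L hL
  · obtain ⟨q, hq, h1, h2⟩ := hJ.child X hX Z hZ hXZ
    have h3 := h.upper M hM q hq (hD q hq h1)
    have h4 : X ≠ Z := by
      rintro rfl
      have := hJ.order q hq q hq (by rw [h1, hXZ])
      omega
    rw [h1, h2, if_neg h4, ← h0] at h3
    exact h3 L hL

/-- The effect of a job in one mode. The values of `X` are only relevant for the parent of `X`,
none of whose jobs has been executed. -/
lemma TableInv.update (h : TableInv n p E b pa Q jx jz D val mg loc) (hJ : JobList p pa Q jx jz)
    {M₀ q₀ c : ℕ} (hM₀ : M₀ < 3) (hq₀ : q₀ < Q)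
    (hpar : ∀ q < Q, pa (jx q₀) = jx q + 1 → ∀ M < 3, ¬ D M q)
    {D' : ℕ → ℕ → Prop} (hD' : ∀ M q, D' M q ↔ D M q ∨ M = M₀ ∧ q = q₀)
    {val' mg' : ℕ → ℕ → ℕ} {loc' : ℕ → ℕ → Finset ℕ}
    (hother : ∀ M < 3, ∀ Y < p, ¬ (M = M₀ ∧ Y = jx q₀ ∧ val M₀ (jx q₀) < c) →
      val' M Y = val M Y ∧ mg' M Y = mg M Y ∧ loc' M Y = loc M Y)
    (hself : val M₀ (jx q₀) < c → val' M₀ (jx q₀) = c ∧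
      mg' M₀ (jx q₀) = (if jx q₀ = jz q₀ then 0 else jz q₀ + 1) ∧
      Feasible n p E b pa M₀ (jx q₀) (if jx q₀ = jz q₀ then 0 else jz q₀ + 1)
        (loc' M₀ (jx q₀)) ∧
      (loc' M₀ (jx q₀)).card = c + loss p E b pa val (if jx q₀ = jz q₀ then 0 else jz q₀ + 1)
        (jx q₀) (loc' M₀ (jx q₀)))
    (hupper : ∀ L, Feasible n p E b pa M₀ (jx q₀) (if jx q₀ = jz q₀ then 0 else jz q₀ + 1) L →
      L.card ≤ c + loss p E b pa val (if jx q₀ = jz q₀ then 0 else jz q₀ + 1) (jx q₀) L) :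
    TableInv n p E b pa Q jx jz D' val' mg' loc' := by
  have hX₀ := (hJ.valid q₀ hq₀).1
  have hge : ∀ M < 3, ∀ Y < p, val M Y ≤ val' M Y := by
    intro M hM Y hY
    by_cases hc : M = M₀ ∧ Y = jx q₀ ∧ val M₀ (jx q₀) < c
    · obtain ⟨rfl, rfl, hc⟩ := hc
      rw [(hself hc).1]
      exact hc.le
    · rw [(hother M hM Y hY hc).1]
  have hloss : ∀ X, pa (jx q₀) ≠ X + 1 → ∀ z L,
      loss p E b pa val' z X L = loss p E b pa val z X L := by
    intro X hX z L
    refine loss_congr L fun Y hY hXY M hM => (hother M hM Y hY ?_).1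
    rintro ⟨-, rfl, -⟩
    exact hX hXY
  have hnoself : pa (jx q₀) ≠ jx q₀ + 1 := fun h' => by
    have := hJ.order q₀ hq₀ q₀ hq₀ h'
    omega
  constructor
  · intro M hM X hX
    by_cases hpX : pa (jx q₀) = X + 1
    · have h1 := h.fresh X hX (fun q hq hqX => hpar q hq (by rw [hpX, hqX])) M hM
      have h2 := hother M hM X hX (by
        rintro ⟨-, rfl, -⟩
        exact hnoself hpX)
      rw [h2.2.1, h2.2.2, h1.2.1, h1.2.2]
      exact isAttained_empty (by rw [h2.1, h1.1])
    · by_cases hc : M = M₀ ∧ X = jx q₀ ∧ val M₀ (jx q₀) < c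
      · obtain ⟨rfl, rfl, hc⟩ := hc
        obtain ⟨h1, h2, h3, h4⟩ := hself hc
        rw [h2]
        exact ⟨h3, by rw [h4, h1, hloss _ hnoself]⟩
      · obtain ⟨h1, h2, h3⟩ := hother M hM X hX hc
        rw [h2, h3]
        have h4 := h.attained M hM X hX
        exact ⟨h4.1, by rw [h4.2, h1, hloss _ hpX]⟩
  · intro M hM q hq hD L hL
    have hpq : pa (jx q₀) ≠ jx q + 1 := by
      intro h'
      rcases (hD' M q).1 hD with h1 | ⟨-, rfl⟩
      · exact hpar q hq h' M hM h1
      · exact hnoself h'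
    rw [hloss _ hpq]
    have hqp := (hJ.valid q hq).1
    rcases (hD' M q).1 hD with h1 | ⟨rfl, rfl⟩
    · exact (h.upper M hM q hq h1 L hL).trans (Nat.add_le_add_right (hge M hM _ hqp) _)
    · by_cases hc : val M (jx q) < c
      · rw [(hself hc).1]
        exact hupper L hL
      · refine (hupper L hL).trans (Nat.add_le_add_right ?_ _)
        exact (not_lt.1 hc).trans (hge M hM _ hqp)
  · intro X hX hfresh M hM
    have hne : X ≠ jx q₀ := by
      rintro rfl
      exact hfresh q₀ hq₀ rfl M₀ hM₀ ((hD' _ _).2 (.inr ⟨rfl, rfl⟩))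
    have h1 := h.fresh X hX (fun q hq hqX M hM hD =>
      hfresh q hq hqX M hM ((hD' _ _).2 (.inl hD))) M hM
    obtain ⟨h2, h3, h4⟩ := hother M hM X hX (fun h' => hne h'.2.1)
    rw [h2, h3, h4]
    exact h1

end WPC

namespace RAM

open RAM.Expr RAM.Cmd WPC

variable {n p : ℕ} {E : ℕ → ℕ → Prop} {b pa : ℕ → ℕ} {Q : ℕ} {jx jz : ℕ → ℕ}
  {D : ℕ → ℕ → Prop} {σ τ : State}

/-- The table of the values in the memory. -/
def valOf (σ : State) (M X : ℕ) : ℕ := σ.arr (20 + M) X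

/-- The table of the merged children (plus one) in the memory. -/
def mergedOf (σ : State) (M X : ℕ) : ℕ := σ.arr (23 + M) X

/-- The table of the kept sets in the memory. -/
def keptOf (n : ℕ) (b : ℕ → ℕ) (σ : State) (M X : ℕ) : Finset ℕ :=
  (Finset.range n).filter fun v => b v = X ∧ σ.arr (26 + M) v = 1

/-- The memory during the execution of the jobs. -/
structure InJobs (n p : ℕ) (E : ℕ → ℕ → Prop) (b pa : ℕ → ℕ) (Q : ℕ) (jx jz : ℕ → ℕ)
    (D : ℕ → ℕ → Prop) (σ : State) : Prop where
  ready : Ready n p E b pa σ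
  jobX : ∀ q < Q, jx q = σ.arr 8 (p - 1 - σ.arr 10 q)
  jobZ : ∀ q < Q, jz q = σ.arr 11 q
  table : TableInv n p E b pa Q jx jz D (valOf σ) (mergedOf σ) (keptOf n b σ)

lemma InJobs.setReg (h : InJobs n p E b pa Q jx jz D σ) {r : ℕ} (a : ℕ) (hr : 8 ≤ r) :
    InJobs n p E b pa Q jx jz D (σ.setReg r a) := by
  refine ⟨h.ready.of_eq (fun s hs => ?_) (by simp), h.jobX, h.jobZ, h.table⟩
  rw [State.setReg_reg, if_neg]
  rintro rfl
  simp only [List.mem_cons, List.not_mem_nil, or_false] at hs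
  omega

lemma record_spec {M : ℕ} (hM : M < 3) (h0 : σ.reg 0 = n) (h2 : σ.arr 2 = b) :
    (σ.arr (20 + M) (σ.reg 13) < σ.reg 22 → ∀ M' < 3,
      (∀ Y, ((record M).run σ).arr (20 + M') Y =
        if M' = M ∧ Y = σ.reg 13 then σ.reg 22 else σ.arr (20 + M') Y) ∧
      (∀ Y, ((record M).run σ).arr (23 + M') Y =
        if M' = M ∧ Y = σ.reg 13 then (if σ.reg 13 = σ.reg 14 then 0 else σ.reg 14 + 1)
          else σ.arr (23 + M') Y) ∧
      ∀ v < n, ((record M).run σ).arr (26 + M') v =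
        if M' = M ∧ b v = σ.reg 13 then σ.arr 14 v else σ.arr (26 + M') v) ∧
    (¬ σ.arr (20 + M) (σ.reg 13) < σ.reg 22 → (record M).run σ = σ) := by
  constructor
  · intro hc M' hM'
    simp only [record, run_ite, holds_lt, eval_load, eval_reg, hc, if_true, run_seq]
    set σ1 := (store (20 + M) (reg 13) (reg 22)).run σ with h1
    set σ2 := (if (reg 13 =ᵉ reg 14).Holds σ1 then (store (23 + M) (reg 13) (lit 0)).run σ1 else
      (store (23 + M) (reg 13) (reg 14 +ᵉ lit 1)).run σ1) with hσ2
    have e1 : σ1.reg = σ.reg := by simp [h1]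
    have e2 : σ2.reg = σ.reg := by
      rw [hσ2]
      split_ifs <;> simp [e1]
    have a2 : ∀ A Y, σ2.arr A Y = if A = 23 + M ∧ Y = σ.reg 13 then
        (if σ.reg 13 = σ.reg 14 then 0 else σ.reg 14 + 1) else
        if A = 20 + M ∧ Y = σ.reg 13 then σ.reg 22 else σ.arr A Y := by
      intro A Y
      rw [hσ2]
      simp only [holds_eq, eval_reg, e1]
      by_cases hXZ : σ.reg 13 = σ.reg 14 <;> by_cases hA : A = 23 + M <;>
        by_cases hA' : A = 20 + M <;> by_cases hY : Y = σ.reg 13 <;>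
        simp_all
    have e2b : σ2.arr 2 = b := by
      funext v
      rw [a2, if_neg (by omega), if_neg (by omega), h2]
    have hq : (load 2 (reg 11) =ᵉ reg 13).readsArr (26 + M) = false := by
      simp [readsArr]
      omega
    have he : (load 14 (reg 11)).readsArr (26 + M) = false := by
      simp [readsArr]
      omega
    have hloop := run_loop_map (i := 11) (N := 0) σ2 hq he
    have hne : ∀ A, A ≠ 26 + M → ((loop 11 0 (ite (load 2 (reg 11) =ᵉ reg 13)
        (store (26 + M) (reg 11) (load 14 (reg 11))) skip)).run σ2).arr A = σ2.arr A := by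
      intro A hA
      refine run_arr _ _ ?_
      simp [writesArr, Ne.symm hA]
    refine ⟨fun Y => ?_, fun Y => ?_, fun v hv => ?_⟩
    · rw [hne _ (by omega), a2, if_neg (by omega)]
      simp
    · rw [hne _ (by omega), a2]
      by_cases hMM : M' = M <;> by_cases hY : Y = σ.reg 13 <;> simp [hMM, hY]
      intro h
      omega
    · by_cases hMM : M' = M
      · subst hMM
        rw [hloop]
        have a14 : σ2.arr 14 v = σ.arr 14 v := by
          rw [a2, if_neg (by omega), if_neg (by omega)]
        have a26 : σ2.arr (26 + M') v = σ.arr (26 + M') v := by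
          rw [a2, if_neg (by omega), if_neg (by omega)]
        simp [e2, e2b, h0, hv, a14, a26]
      · rw [hne _ (by omega), a2, if_neg (by omega), if_neg (by omega), if_neg (by simp [hMM])]
  · intro hc
    simp [record, hc]

/-- The pairs of modes and jobs that have been executed before mode `m` of job `t`. -/
def DoneBefore (t m M q : ℕ) : Prop := q < t ∨ q = t ∧ M < m

/-- A job in one mode updates the table. The children of its bag are complete already, and the parent
of its bag is untouched. -/
lemma jobInMode_spec (hT : RootedBags n p E b pa) (hJ : JobList p pa Q jx jz) {t m : ℕ}
    (ht : t < Q) (hm : m < 3) (h : InJobs n p E b pa Q jx jz (DoneBefore t m) σ)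
    (h13 : σ.reg 13 = jx t) (h14 : σ.reg 14 = jz t) :
    InJobs n p E b pa Q jx jz (DoneBefore t (m + 1)) ((jobInMode m).run σ) := by
  have hk : (jobInMode m).keeps [0, 2, 5, 6, 7] [2, 5, 6, 9, 12, 8, 10, 11] = true := by
    interval_cases m <;> rfl
  have hkf := keeps_frame hk (frame_run _ σ)
  have hready : Ready n p E b pa ((jobInMode m).run σ) := by
    refine h.ready.of_eq hkf.1 fun A hA => hkf.2 A ?_
    simp only [List.mem_cons, List.not_mem_nil, or_false] at hA ⊢
    omega
  refine ⟨hready, fun q hq => ?_, fun q hq => ?_, ?_⟩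
  · rw [hkf.2 8 (by simp), hkf.2 10 (by simp), h.jobX q hq]
  · rw [hkf.2 11 (by simp), h.jobZ q hq]
  simp only [jobInMode, run_seq]
  set σ1 := (assign 15 (lit m)).run σ with h1
  set σ2 := solveJob.run σ1 with h2
  have hX := hJ.valid t ht
  have r1 : Ready n p E b pa σ1 := h.ready.run rfl
  have f2 : (∀ r ∈ [0, 13, 14], σ2.reg r = σ1.reg r) ∧
      ∀ A ∈ [2, 20, 21, 22, 23, 24, 25, 26, 27, 28], σ2.arr A = σ1.arr A :=
    keeps_frame rfl (frame_run _ σ1)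
  have e13 : σ1.reg 13 = jx t := by simp [h1, h13]
  have e14 : σ1.reg 14 = jz t := by simp [h1, h14]
  have ea : σ1.arr = σ.arr := rfl
  rw [ea] at f2
  obtain ⟨hup, hat⟩ := solveJob_spec hT r1 (M := m) (by simp [h1]) e13 e14 hm hX.2 (valOf σ)
    (fun i _ => rfl) (by
      intro Y hY hXY
      have hdone : ∀ M < 3, ∀ q < Q, jx q = Y → DoneBefore t m M q := fun M _ q hq hqY =>
        .inl (hJ.order t ht q hq (by rw [hqY, hXY]))
      exact val_two_sub_zero_le (h.table.attained 2 (by simp) Y hY)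
        (h.table.isUpper hJ (by simp) hY (hdone 0 (by simp)) _))
  rw [← h2] at hup hat
  have g13 : σ2.reg 13 = jx t := by rw [f2.1 13 (by simp), e13]
  have g14 : σ2.reg 14 = jz t := by rw [f2.1 14 (by simp), e14]
  have g0 : σ2.reg 0 = n := by rw [f2.1 0 (by simp), r1.reg0]
  have g2 : σ2.arr 2 = b := by rw [f2.2 2 (by simp), h.ready.arr2]
  have gA : ∀ M < 3, σ2.arr (20 + M) = σ.arr (20 + M) ∧ σ2.arr (23 + M) = σ.arr (23 + M) ∧
      σ2.arr (26 + M) = σ.arr (26 + M) := by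
    intro M hM
    interval_cases M <;>
      exact ⟨f2.2 _ (by simp), f2.2 _ (by simp), f2.2 _ (by simp)⟩
  obtain ⟨hrec, hrec'⟩ := record_spec hm g0 g2
  rw [g13, g14] at hrec
  rw [g13] at hrec'
  rw [(gA m hm).1] at hrec hrec'
  refine h.table.update hJ hm ht (c := σ2.reg 22) ?_ ?_ ?_ ?_ hup
  · rintro q hq hpq M hM (hD | ⟨rfl, hD⟩)
    · have := hJ.order q hq t ht hpq
      omega
    · have := hJ.order q hq q hq hpq
      omega
  · intro M q
    unfold DoneBefore
    omega
  · intro M hM Y hY hno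
    obtain ⟨gA1, gA2, gA3⟩ := gA M hM
    by_cases hc : σ.arr (20 + m) (jx t) < σ2.reg 22
    · have hne : ¬ (M = m ∧ Y = jx t) := fun h' => hno ⟨h'.1, h'.2, hc⟩
      obtain ⟨k1, k2, k3⟩ := hrec hc M hM
      refine ⟨?_, ?_, ?_⟩
      · rw [valOf, valOf, k1, if_neg hne, gA1]
      · rw [mergedOf, mergedOf, k2, if_neg hne, gA2]
      · ext v
        simp only [keptOf, Finset.mem_filter, Finset.mem_range]
        refine and_congr_right fun hv => and_congr_right fun hvY => ?_
        rw [k3 v hv, if_neg (by rw [hvY]; exact hne), gA3]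
    · rw [hrec' hc]
      refine ⟨?_, ?_, ?_⟩
      · rw [valOf, valOf, gA1]
      · rw [mergedOf, mergedOf, gA2]
      · rw [keptOf, keptOf, gA3]
  · intro hc
    obtain ⟨k1, k2, k3⟩ := hrec hc m hm
    have hL := hat (by omega) (keptOf n b ((record m).run σ2) m (jx t)) (by
      intro v
      simp only [keptOf, Finset.mem_filter, Finset.mem_range]
      refine and_congr_right fun hv => and_congr_right fun hvY => ?_
      rw [k3 v hv, if_pos ⟨rfl, hvY⟩])
    refine ⟨?_, ?_, hL.1, hL.2⟩
    · rw [valOf, k1, if_pos ⟨rfl, rfl⟩]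
    · rw [mergedOf, k2, if_pos ⟨rfl, rfl⟩]

/-- After all jobs, every value is attained and bounds all feasible sets. -/
lemma allJobs_spec (hT : RootedBags n p E b pa) (hJ : JobList p pa Q jx jz)
    (hQ : σ.reg 8 = Q) (h : InJobs n p E b pa Q jx jz (DoneBefore 0 0) σ) :
    InJobs n p E b pa Q jx jz (DoneBefore Q 0) (allJobs.run σ) := by
  rw [← hQ]
  refine run_loop_induction (σ := σ)
    (P := fun t τ => InJobs n p E b pa (σ.reg 8) jx jz (DoneBefore t 0) τ) ?_ ?_
  · rw [hQ]
    exact h.setReg _ (by simp)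
  rw [hQ]
  intro t τ ht hti hF hP
  simp only [job, run_seq]
  set τ1 := (assign 13 (load 8 (reg 2 -ᵉ lit 1 -ᵉ load 10 (reg 10)))).run τ with h1
  set τ2 := (assign 14 (load 11 (reg 10))).run τ1 with h2
  set τ3 := (jobInMode 0).run τ2 with h3
  set τ4 := (jobInMode 1).run τ3 with h4
  have p1 : InJobs n p E b pa Q jx jz (DoneBefore t 0) τ1 := hP.setReg _ (by simp)
  have p2 : InJobs n p E b pa Q jx jz (DoneBefore t 0) τ2 := p1.setReg _ (by simp)
  have e13 : τ2.reg 13 = jx t := by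
    simp [h2, h1, hti, hP.jobX t ht, hP.ready.reg2]
  have e14 : τ2.reg 14 = jz t := by
    simp [h2, h1, hti, hP.jobZ t ht]
  have p3 := jobInMode_spec hT hJ ht (by simp) p2 e13 e14
  rw [← h3] at p3
  have p4 := jobInMode_spec hT hJ ht (by simp) p3 (by rw [h3, run_reg _ _ rfl, e13])
    (by rw [h3, run_reg _ _ rfl, e14])
  rw [← h4] at p4
  have p5 := jobInMode_spec hT hJ ht (by simp) p4
    (by rw [h4, run_reg _ _ rfl, h3, run_reg _ _ rfl, e13])
    (by rw [h4, run_reg _ _ rfl, h3, run_reg _ _ rfl, e14])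
  refine InJobs.setReg ⟨p5.ready, p5.jobX, p5.jobZ, p5.table.attained, fun M hM q hq hD => ?_,
    fun X hX hf => p5.table.fresh X hX fun q hq hqX M hM hD => hf q hq hqX M hM ?_⟩ _ (by simp)
  · refine p5.table.upper M hM q hq ?_
    unfold DoneBefore at hD ⊢
    omega
  · unfold DoneBefore at hD ⊢
    omega

end RAM

/-! ### Correctness of the preparation -/

namespace WPC

/-- The state of a breadth-first search on the bags: the queue `ord` of length `c` and the
parents `pa` (plus one, `0` for bags that have not been reached). -/
structure SearchInv (p : ℕ) (E : ℕ → ℕ → Prop) (b : ℕ → ℕ) (c : ℕ) (ord pa : ℕ → ℕ) : Prop where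
  pos : 0 < c
  zero : ord 0 = 0
  root : pa 0 = p + 1
  lt : ∀ i < c, ord i < p ∧ pa (ord i) ≠ 0
  index : ∀ Y < p, pa Y ≠ 0 → ∃ i < c, ord i = Y
  inj : ∀ i < c, ∀ i' < c, ord i = ord i' → i = i'
  parent : ∀ i < c, 0 < i → ∃ i' < i, pa (ord i) = ord i' + 1 ∧
    ∃ u v, E u v ∧ b u = ord i' ∧ b v = ord i

variable {p c : ℕ} {E : ℕ → ℕ → Prop} {b ord pa : ℕ → ℕ}

/-- The search appends a new bag `b v` that is adjacent to a bag in the queue. -/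
lemma SearchInv.append (h : SearchInv p E b c ord pa) {u v t : ℕ} (huv : E u v) (ht : t < c)
    (hu : b u = ord t) (hv : b v < p) (hnew : pa (b v) = 0) {ord' pa' : ℕ → ℕ}
    (hord : ∀ i, ord' i = if i = c then b v else ord i)
    (hpa : ∀ Y, pa' Y = if Y = b v then ord t + 1 else pa Y) :
    SearchInv p E b (c + 1) ord' pa' := by
  have h0 := h.pos
  have hne : ∀ i < c, ord i ≠ b v := fun i hi h' => (h.lt i hi).2 (h' ▸ hnew)
  have hord' : ∀ i < c, ord' i = ord i := fun i hi => by rw [hord, if_neg hi.ne]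
  have hordc : ord' c = b v := by rw [hord, if_pos rfl]
  have hpa' : ∀ i < c, pa' (ord i) = pa (ord i) := fun i hi => by rw [hpa, if_neg (hne i hi)]
  have hpac : pa' (b v) = ord t + 1 := by rw [hpa, if_pos rfl]
  refine ⟨by omega, by rw [hord' 0 h0, h.zero], ?_, ?_, ?_, ?_, ?_⟩
  · rw [← h.zero, hpa' 0 h0, h.zero, h.root]
  · intro i hi
    rcases Nat.lt_succ_iff_lt_or_eq.1 hi with hi | rfl
    · rw [hord' i hi, hpa' i hi]
      exact h.lt i hi
    · rw [hordc, hpac]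
      exact ⟨hv, by omega⟩
  · intro Y hY hY0
    by_cases hYv : Y = b v
    · exact ⟨c, by omega, by rw [hordc, hYv]⟩
    · rw [hpa, if_neg hYv] at hY0
      obtain ⟨i, hi, rfl⟩ := h.index Y hY hY0
      exact ⟨i, by omega, hord' i hi⟩
  · intro i hi i' hi' heq
    rcases Nat.lt_succ_iff_lt_or_eq.1 hi with hi | rfl <;>
      rcases Nat.lt_succ_iff_lt_or_eq.1 hi' with hi' | rfl
    · rw [hord' i hi, hord' i' hi'] at heq
      exact h.inj i hi i' hi' heq
    · rw [hord' i hi, hordc] at heq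
      exact absurd heq (hne i hi)
    · rw [hord' i' hi', hordc] at heq
      exact absurd heq.symm (hne i' hi')
    · rfl
  · intro i hi hi0
    rcases Nat.lt_succ_iff_lt_or_eq.1 hi with hi | rfl
    · obtain ⟨i', hi', h1, x, y, hxy, hx, hy⟩ := h.parent i hi hi0
      exact ⟨i', hi', by rw [hord' i hi, hpa' i hi, hord' i' (hi'.trans hi), h1], x, y, hxy,
        by rw [hord' i' (hi'.trans hi), hx], by rw [hord' i hi, hy]⟩
    · exact ⟨t, ht, by rw [hordc, hpac, hord' t ht], u, v, huv, by rw [hord' t ht, hu], hordc.symm⟩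

/-- The list of jobs during its construction, while the `t`-th bag in the order `ord'` is
treated. -/
structure JobInv (p : ℕ) (pa ord' : ℕ → ℕ) (t c : ℕ) (ji jz : ℕ → ℕ) : Prop where
  le : ∀ q < c, ji q ≤ t
  valid : ∀ q < c, ord' (ji q) = jz q ∨ jz q < p ∧ pa (jz q) = ord' (ji q) + 1
  mono : ∀ q' < c, ∀ q < q', ji q ≤ ji q'

/-- A job for the current bag is appended to the list. -/
lemma JobInv.push {ord' : ℕ → ℕ} {t Z : ℕ} {ji jz : ℕ → ℕ} (h : JobInv p pa ord' t c ji jz)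
    (hZ : ord' t = Z ∨ Z < p ∧ pa Z = ord' t + 1) {ji' jz' : ℕ → ℕ}
    (hji : ∀ q, ji' q = if q = c then t else ji q) (hjz : ∀ q, jz' q = if q = c then Z else jz q) :
    JobInv p pa ord' t (c + 1) ji' jz' ∧
      (∀ i Y, (∃ q < c, ji q = i ∧ jz q = Y) → ∃ q < c + 1, ji' q = i ∧ jz' q = Y) ∧
      ∃ q < c + 1, ji' q = t ∧ jz' q = Z := by
  have h1 : ∀ q < c, ji' q = ji q ∧ jz' q = jz q := fun q hq => by
    rw [hji, hjz, if_neg hq.ne, if_neg hq.ne]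
    exact ⟨rfl, rfl⟩
  have h2 : ji' c = t ∧ jz' c = Z := by
    rw [hji, hjz, if_pos rfl, if_pos rfl]
    exact ⟨rfl, rfl⟩
  refine ⟨⟨fun q hq => ?_, fun q hq => ?_, fun q' hq' q hq => ?_⟩, fun i Y => ?_,
    c, by omega, h2⟩
  · rcases Nat.lt_succ_iff_lt_or_eq.1 hq with hq | rfl
    · rw [(h1 q hq).1]
      exact h.le q hq
    · exact h2.1.le
  · rcases Nat.lt_succ_iff_lt_or_eq.1 hq with hq | rfl
    · rw [(h1 q hq).1, (h1 q hq).2]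
      exact h.valid q hq
    · rw [h2.1, h2.2]
      exact hZ
  · rcases Nat.lt_succ_iff_lt_or_eq.1 hq' with hq' | rfl
    · rw [(h1 q' hq').1, (h1 q (hq.trans hq')).1]
      exact h.mono q' hq' q hq
    · rw [h2.1, (h1 q hq).1]
      exact h.le q hq
  · rintro ⟨q, hq, h3, h4⟩
    exact ⟨q, by omega, by rw [(h1 q hq).1, h3], by rw [(h1 q hq).2, h4]⟩

end WPC

namespace RAM

open RAM.Expr RAM.Cmd WPC

variable {n p m : ℕ} {E : ℕ → ℕ → Prop} {b pa : ℕ → ℕ} {σ τ : State}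

lemma orientEdges_spec (h1 : σ.reg 1 = m) (h5 : σ.reg 5 = m + m)
    (hE : ∀ u v, E u v ↔ ∃ j < m, σ.arr 0 j = u ∧ σ.arr 1 j = v ∨ σ.arr 0 j = v ∧ σ.arr 1 j = u)
    (u v : ℕ) :
    E u v ↔ ∃ j < m + m, (orientEdges.run σ).arr 5 j = u ∧ (orientEdges.run σ).arr 6 j = v := by
  have key : ∀ j < σ.reg 5,
      (orientEdges.run σ).arr 5 j = (if j < m then σ.arr 0 j else σ.arr 1 (j - m)) ∧
      (orientEdges.run σ).arr 6 j = if j < m then σ.arr 1 j else σ.arr 0 (j - m) := by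
    refine run_loop_induction (σ := σ) (P := fun t τ => ∀ j < t,
      τ.arr 5 j = (if j < m then σ.arr 0 j else σ.arr 1 (j - m)) ∧
      τ.arr 6 j = if j < m then σ.arr 1 j else σ.arr 0 (j - m)) (by simp) ?_
    intro t τ ht hti hF hP j hj
    have f : (∀ r ∈ [1], τ.reg r = σ.reg r) ∧ ∀ A ∈ [0, 1], τ.arr A = σ.arr A :=
      keeps_frame rfl hF
    simp only [List.mem_cons, List.not_mem_nil, or_false, forall_eq_or_imp, forall_eq] at f
    have hjt : j ≠ t → j < t := by omega
    by_cases hc : t < m <;> by_cases hjt' : j = t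
    · simp [hti, f, h1, hc, hjt']
    · simpa [hti, f, h1, hc, hjt'] using hP j (hjt hjt')
    · simp [hti, f, h1, hc, hjt']
    · simpa [hti, f, h1, hc, hjt'] using hP j (hjt hjt')
  rw [h5] at key
  rw [hE]
  constructor
  · rintro ⟨j, hj, ⟨h2, h3⟩ | ⟨h2, h3⟩⟩
    · refine ⟨j, by omega, ?_⟩
      rw [(key j (by omega)).1, (key j (by omega)).2, if_pos hj, if_pos hj]
      exact ⟨h2, h3⟩
    · refine ⟨j + m, by omega, ?_⟩
      rw [(key (j + m) (by omega)).1, (key (j + m) (by omega)).2, if_neg (by omega),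
        if_neg (by omega), Nat.add_sub_cancel]
      exact ⟨h3, h2⟩
  · rintro ⟨j, hj, h2, h3⟩
    rw [(key j hj).1] at h2
    rw [(key j hj).2] at h3
    by_cases hc : j < m
    · rw [if_pos hc] at h2 h3
      exact ⟨j, hc, .inl ⟨h2, h3⟩⟩
    · rw [if_neg hc] at h2 h3
      exact ⟨j - m, by omega, .inr ⟨h3, h2⟩⟩

/-- The search reaches all bags. The loop runs `p` times irrespective of the length of the queue, and
an iteration that finds the queue exhausted does nothing. -/
lemma search_spec (h2 : σ.reg 2 = p) (hp : 0 < p) (ha2 : σ.arr 2 = b)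
    (h8 : ∀ i, σ.arr 8 i = 0) (h9 : ∀ Y, σ.arr 9 Y = 0)
    (hE : ∀ u v, E u v ↔ ∃ j < σ.reg 5, σ.arr 5 j = u ∧ σ.arr 6 j = v)
    (hb : ∀ u v, E u v → b u < p ∧ b v < p)
    (hconn : ∀ S : ℕ → Prop, S 0 → (∀ u v, E u v → S (b u) → S (b v)) → ∀ Y < p, S Y) :
    SearchInv p E b p ((search.run σ).arr 8) ((search.run σ).arr 9) ∧
      ∀ Y < p, ∃ i < p, (search.run σ).arr 8 i = Y := by
  simp only [search, run_seq]
  set σ1 := (assign 9 (lit 1)).run ((store 9 (lit 0) (reg 2 +ᵉ lit 1)).run σ) with h1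
  have e2 : σ1.reg 2 = p := by simp [h1, h2]
  have e9 : σ1.reg 9 = 1 := by simp [h1]
  have e5 : σ1.reg 5 = σ.reg 5 := by simp [h1]
  have a9 : ∀ Y, σ1.arr 9 Y = if Y = 0 then p + 1 else 0 := by
    intro Y
    simp [h1, h2, h9]
  have a256 : ∀ A ∈ [2, 5, 6, 8], σ1.arr A = σ.arr A :=
    (keeps_frame (c := store 9 (lit 0) (reg 2 +ᵉ lit 1)) (rs := []) rfl (frame_run _ σ)).2
  simp only [List.mem_cons, List.not_mem_nil, or_false, forall_eq_or_imp, forall_eq] at a256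
  have a8 := a256.2.2.2
  have key := run_loop_induction (i := 10) (N := 2)
    (c := ite (reg 10 <ᵉ reg 9) (assign 13 (load 8 (reg 10)) ;; loop 11 5 searchStep) skip)
    (σ := σ1) (P := fun t τ => SearchInv p E b (τ.reg 9) (τ.arr 8) (τ.arr 9) ∧
      ∀ i < t, i < τ.reg 9 → ∀ u v, E u v → b u = τ.arr 8 i → τ.arr 9 (b v) ≠ 0) ?_ ?_
  · rw [e2] at key
    generalize (loop 10 2 (ite (reg 10 <ᵉ reg 9) (assign 13 (load 8 (reg 10)) ;;
      loop 11 5 searchStep) skip)).run σ1 = τ at key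
    obtain ⟨hS, hcl⟩ := key
    have hle : τ.reg 9 ≤ p := by
      have := Finset.card_le_card_of_injOn (s := Finset.range (τ.reg 9)) (t := Finset.range p)
        (τ.arr 8) (fun i hi => by simpa using (hS.lt i (by simpa using hi)).1)
        (fun i hi i' hi' h => hS.inj i (by simpa using hi) i' (by simpa using hi') h)
      simpa using this
    have hall : ∀ Y < p, τ.arr 9 Y ≠ 0 := by
      refine fun Y hY => hconn (fun Y => Y < p → τ.arr 9 Y ≠ 0) (fun _ => ?_) ?_ Y hY hY
      · rw [hS.root]
        omega
      · intro u v huv hu hv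
        have hup := (hb u v huv).1
        obtain ⟨i, hi, hiu⟩ := hS.index (b u) hup (hu hup)
        exact hcl i (by omega) hi u v huv hiu.symm
    have hsurj : ∀ Y < p, ∃ i < τ.reg 9, τ.arr 8 i = Y := fun Y hY => hS.index Y hY (hall Y hY)
    have hge : p ≤ τ.reg 9 := by
      have := Finset.card_le_card_of_surjOn (s := Finset.range (τ.reg 9)) (t := Finset.range p)
        (τ.arr 8) (fun Y hY => by
          obtain ⟨i, hi, hiY⟩ := hsurj Y (by simpa using hY)
          exact ⟨i, by simpa using hi, hiY⟩)
      simpa using this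
    have hcp : τ.reg 9 = p := le_antisymm hle hge
    rw [hcp] at hS hsurj
    exact ⟨hS, hsurj⟩
  · simp only [State.setReg_reg, State.setReg_arr, e9, a8, show ¬ (9 : ℕ) = 10 by decide, if_false]
    refine ⟨⟨by simp, h8 0, by rw [a9, if_pos rfl], ?_, ?_, ?_, ?_⟩, by simp⟩
    · intro i hi
      obtain rfl : i = 0 := by omega
      rw [h8, a9]
      simpa using hp
    · intro Y hY hY0
      rw [a9] at hY0
      split_ifs at hY0 with h
      · exact ⟨0, by simp, by rw [h8, h]⟩
      · exact absurd rfl hY0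
    · intro i hi i' hi' _
      omega
    · intro i hi hi0
      omega
  · rintro t τ ht hti hF ⟨hS, hcl⟩
    have f : (∀ r ∈ [5], τ.reg r = σ1.reg r) ∧ ∀ A ∈ [2, 5, 6], τ.arr A = σ1.arr A :=
      keeps_frame rfl hF
    simp only [List.mem_cons, List.not_mem_nil, or_false, forall_eq_or_imp, forall_eq] at f
    simp only [run_ite, holds_lt, eval_reg, hti]
    split_ifs with htc
    swap
    · simp only [run_skip, State.setReg_reg, State.setReg_arr, show ¬ (9 : ℕ) = 10 by decide,
        if_false]
      exact ⟨hS, fun i hi hi9 => hcl i (by omega) hi9⟩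
    simp only [run_seq]
    set τ1 := (assign 13 (load 8 (reg 10))).run τ with hτ1
    have g5 : τ1.reg 5 = σ.reg 5 := by simp [hτ1, f, e5]
    have g9 : τ1.reg 9 = τ.reg 9 := by simp [hτ1]
    have g13 : τ1.reg 13 = τ.arr 8 t := by simp [hτ1, hti]
    have ga : τ1.arr = τ.arr := rfl
    have inner := run_loop_induction (i := 11) (N := 5) (c := searchStep) (σ := τ1)
      (P := fun s ρ => SearchInv p E b (ρ.reg 9) (ρ.arr 8) (ρ.arr 9) ∧ t < ρ.reg 9 ∧
        ρ.arr 8 t = τ.arr 8 t ∧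
        (∀ i < t, ∀ u v, E u v → b u = ρ.arr 8 i → ρ.arr 9 (b v) ≠ 0) ∧
        ∀ j < s, b (σ.arr 5 j) = τ.arr 8 t → ρ.arr 9 (b (σ.arr 6 j)) ≠ 0) ?_ ?_
    · rw [g5] at inner
      obtain ⟨i1, i2, i3, i4, i5⟩ := inner
      simp only [State.setReg_reg, State.setReg_arr, show ¬ (9 : ℕ) = 10 by decide, if_false]
      refine ⟨i1, fun i hi hi9 u v huv hu => ?_⟩
      rcases Nat.lt_succ_iff_lt_or_eq.1 hi with hi | rfl
      · exact i4 i hi u v huv hu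
      · obtain ⟨j, hj, rfl, rfl⟩ := (hE u v).1 huv
        exact i5 j hj (by rw [hu, i3])
    · simp only [State.setReg_reg, State.setReg_arr, g9, ga, show ¬ (9 : ℕ) = 11 by decide,
        if_false]
      exact ⟨hS, htc, trivial, fun i hi => hcl i hi (hi.trans htc), by simp⟩
    · rintro s ρ hs hsi hG ⟨i1, i2, i3, i4, i5⟩
      have g : (∀ r ∈ [13], ρ.reg r = τ1.reg r) ∧ ∀ A ∈ [2, 5, 6], ρ.arr A = τ1.arr A :=
        keeps_frame rfl hG
      simp only [List.mem_cons, List.not_mem_nil, or_false, forall_eq_or_imp, forall_eq] at g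
      have k2 : ρ.arr 2 = b := by rw [g.2.1, ga, f.2.1, a256.1, ha2]
      have k5 : ρ.arr 5 = σ.arr 5 := by rw [g.2.2.1, ga, f.2.2.1, a256.2.1]
      have k6 : ρ.arr 6 = σ.arr 6 := by rw [g.2.2.2, ga, f.2.2.2, a256.2.2.1]
      have k13 : ρ.reg 13 = τ.arr 8 t := by rw [g.1, g13]
      have hEs : E (σ.arr 5 s) (σ.arr 6 s) := (hE _ _).2 ⟨s, by omega, rfl, rfl⟩
      simp only [searchStep, run_ite, holds_and, holds_eq, eval_load, eval_reg, eval_lit, hsi,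
        k2, k5, k6, k13]
      split_ifs with hc
      · obtain ⟨c1, c2⟩ := hc
        set ρ' := ((store 8 (reg 9) (load 2 (load 6 (reg 11))) ;;
          store 9 (load 2 (load 6 (reg 11))) (reg 13 +ᵉ lit 1) ;;
          assign 9 (reg 9 +ᵉ lit 1)).run ρ) with hρ'
        have l9 : ρ'.reg 9 = ρ.reg 9 + 1 := by simp [hρ']
        have l8 : ∀ i, ρ'.arr 8 i = if i = ρ.reg 9 then b (σ.arr 6 s) else ρ.arr 8 i := by
          intro i
          simp [hρ', hsi, k2, k6]
        have l9' : ∀ Y, ρ'.arr 9 Y = if Y = b (σ.arr 6 s) then ρ.arr 8 t + 1 else ρ.arr 9 Y := by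
          intro Y
          simp [hρ', hsi, k2, k6, k13, i3]
        have lmono : ∀ Y, ρ.arr 9 Y ≠ 0 → ρ'.arr 9 Y ≠ 0 := by
          intro Y hY
          rw [l9']
          split_ifs
          · omega
          · exact hY
        have hS' := i1.append hEs i2 (by rw [c1, i3]) (hb _ _ hEs).2 c2 l8 l9'
        simp only [State.setReg_reg, State.setReg_arr, show ¬ (9 : ℕ) = 11 by decide, if_false, l9]
        refine ⟨hS', by omega, by rw [l8, if_neg i2.ne, i3], fun i hi u v huv hu => ?_,
          fun j hj hj5 => ?_⟩
        · rw [l8, if_neg (by omega)] at hu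
          exact lmono _ (i4 i hi u v huv hu)
        · rcases Nat.lt_succ_iff_lt_or_eq.1 hj with hj | rfl
          · exact lmono _ (i5 j hj hj5)
          · rw [l9', if_pos rfl]
            omega
      · simp only [run_skip, State.setReg_reg, State.setReg_arr, show ¬ (9 : ℕ) = 11 by decide,
          if_false]
        refine ⟨i1, i2, i3, i4, fun j hj hj5 => ?_⟩
        rcases Nat.lt_succ_iff_lt_or_eq.1 hj with hj | rfl
        · exact i5 j hj hj5
        · exact fun h0 => hc ⟨hj5, h0⟩

open scoped Classical in
/-- The list contains the required jobs in a valid order. Its length is at most `2 * p`, since every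
bag contributes one job of its own and one for its parent. -/
lemma listJobs_spec (h2 : σ.reg 2 = p) (hS : SearchInv p E b p (σ.arr 8) (σ.arr 9))
    (hsurj : ∀ Y < p, ∃ i < p, σ.arr 8 i = Y) :
    (listJobs.run σ).reg 8 ≤ 2 * p ∧ JobList p (σ.arr 9) ((listJobs.run σ).reg 8)
      (fun q => σ.arr 8 (p - 1 - (listJobs.run σ).arr 10 q)) ((listJobs.run σ).arr 11) := by
  simp only [listJobs, run_seq]
  set σ1 := (assign 8 (lit 0)).run σ with h1
  have e2 : σ1.reg 2 = p := by simp [h1, h2]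
  have e8 : σ1.reg 8 = 0 := by simp [h1]
  have ea : σ1.arr = σ.arr := rfl
  set pa := σ.arr 9 with hpa
  let ord' := fun i => σ.arr 8 (p - 1 - i)
  have hinj : ∀ i < p, ∀ i' < p, ord' i = ord' i' → i = i' := by
    intro i hi i' hi' heq
    have := hS.inj (p - 1 - i) (by omega) (p - 1 - i') (by omega) heq
    omega
  have key := run_loop_induction (i := 10) (N := 2)
    (c := assign 13 (load 8 (reg 2 -ᵉ lit 1 -ᵉ reg 10)) ;;
      loop 11 2 (ite (load 9 (reg 11) =ᵉ reg 13 +ᵉ lit 1) (pushJob (reg 11)) skip) ;;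
      pushJob (reg 13)) (σ := σ1)
    (P := fun t τ => JobInv p pa ord' t (τ.reg 8) (τ.arr 10) (τ.arr 11) ∧
      (∀ q < τ.reg 8, τ.arr 10 q < t) ∧
      (∀ i < t, ∃ q < τ.reg 8, τ.arr 10 q = i ∧ τ.arr 11 q = ord' i) ∧
      (∀ i < t, ∀ Z < p, pa Z = ord' i + 1 → ∃ q < τ.reg 8, τ.arr 10 q = i ∧ τ.arr 11 q = Z) ∧
      τ.reg 8 ≤ t + ((Finset.range p).filter fun Z => ∃ i < t, pa Z = ord' i + 1).card) ?_ ?_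
  · rw [e2] at key
    generalize (loop 10 2 (assign 13 (load 8 (reg 2 -ᵉ lit 1 -ᵉ reg 10)) ;;
      loop 11 2 (ite (load 9 (reg 11) =ᵉ reg 13 +ᵉ lit 1) (pushJob (reg 11)) skip) ;;
      pushJob (reg 13))).run σ1 = τ at key
    obtain ⟨k1, k2, k3, k4, k5⟩ := key
    have hord' : ∀ X < p, ∃ i < p, ord' i = X := by
      intro X hX
      obtain ⟨i, hi, hiX⟩ := hsurj X hX
      exact ⟨p - 1 - i, by omega, by
        change σ.arr 8 (p - 1 - (p - 1 - i)) = X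
        rw [← hiX]
        congr 1
        omega⟩
    refine ⟨?_, fun q hq => ⟨?_, k1.valid q hq⟩, fun X hX => ?_, fun X hX Z hZ hXZ => ?_,
      fun q hq q' hq' hpar => ?_⟩
    · have := Finset.card_filter_le (Finset.range p) fun Z => ∃ i < p, pa Z = ord' i + 1
      rw [Finset.card_range] at this
      omega
    · have := k2 q hq
      exact (hS.lt _ (by omega)).1
    · obtain ⟨i, hi, rfl⟩ := hord' X hX
      obtain ⟨q, hq, h3, h4⟩ := k3 i hi
      exact ⟨q, hq, by rw [h3], h4⟩
    · obtain ⟨i, hi, rfl⟩ := hord' X hX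
      obtain ⟨q, hq, h3, h4⟩ := k4 i hi Z hZ hXZ
      exact ⟨q, hq, by rw [h3], h4⟩
    · have h3 := k2 q hq
      have h4 := k2 q' hq'
      have h6 : τ.arr 10 q' < τ.arr 10 q := by
        have hpar' : pa (σ.arr 8 (p - 1 - τ.arr 10 q')) =
          σ.arr 8 (p - 1 - τ.arr 10 q) + 1 := hpar
        by_cases h0 : p - 1 - τ.arr 10 q' = 0
        · have h7 := (hS.lt (p - 1 - τ.arr 10 q) (by omega)).1
          have hroot : pa 0 = p + 1 := hS.root
          rw [h0, hS.zero, hroot] at hpar'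
          omega
        · obtain ⟨i', hi', h5, -⟩ := hS.parent (p - 1 - τ.arr 10 q') (by omega) (by omega)
          have h8 := hS.inj i' (by omega) (p - 1 - τ.arr 10 q) (by omega)
            (Nat.succ_injective (h5.symm.trans hpar'))
          omega
      by_contra hlt
      rcases (not_lt.1 hlt).eq_or_lt with rfl | hlt
      · omega
      · have := k1.mono q' hq' q hlt
        omega
  · simp only [State.setReg_reg, e8, show ¬ (8 : ℕ) = 10 by decide, if_false]
    exact ⟨⟨by simp, by simp, by simp⟩, by simp, by simp, by simp, by simp⟩
  · rintro t τ ht hti hF ⟨k1, k2, k3, k4, k5⟩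
    have f : (∀ r ∈ [2], τ.reg r = σ1.reg r) ∧ ∀ A ∈ [8, 9], τ.arr A = σ1.arr A :=
      keeps_frame rfl hF
    simp only [List.mem_cons, List.not_mem_nil, or_false, forall_eq_or_imp, forall_eq, e2, ea] at f
    rw [e2] at ht
    simp only [run_seq]
    set τ1 := (assign 13 (load 8 (reg 2 -ᵉ lit 1 -ᵉ reg 10))).run τ with hτ1
    have g : τ1.reg 2 = p ∧ τ1.reg 8 = τ.reg 8 ∧ τ1.reg 10 = t ∧ τ1.reg 13 = ord' t := by
      simp [hτ1, f, hti, ord']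
    have ga : τ1.arr = τ.arr := rfl
    have inner := run_loop_induction (i := 11) (N := 2)
      (c := ite (load 9 (reg 11) =ᵉ reg 13 +ᵉ lit 1) (pushJob (reg 11)) skip) (σ := τ1)
      (P := fun s ρ => JobInv p pa ord' t (ρ.reg 8) (ρ.arr 10) (ρ.arr 11) ∧
        (∀ i < t, ∃ q < ρ.reg 8, ρ.arr 10 q = i ∧ ρ.arr 11 q = ord' i) ∧
        (∀ i < t, ∀ Z < p, pa Z = ord' i + 1 → ∃ q < ρ.reg 8, ρ.arr 10 q = i ∧ ρ.arr 11 q = Z) ∧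
        (∀ Z < s, pa Z = ord' t + 1 → ∃ q < ρ.reg 8, ρ.arr 10 q = t ∧ ρ.arr 11 q = Z) ∧
        ρ.reg 8 ≤ t + ((Finset.range p).filter fun Z => (∃ i < t, pa Z = ord' i + 1) ∨
          Z < s ∧ pa Z = ord' t + 1).card) ?_ ?_
    · rw [g.1] at inner
      have f13 := run_reg (loop 11 2 (ite (load 9 (reg 11) =ᵉ reg 13 +ᵉ lit 1)
        (pushJob (reg 11)) skip)) τ1 (r := 13) rfl
      have f10 := run_reg (loop 11 2 (ite (load 9 (reg 11) =ᵉ reg 13 +ᵉ lit 1)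
        (pushJob (reg 11)) skip)) τ1 (r := 10) rfl
      generalize (loop 11 2 (ite (load 9 (reg 11) =ᵉ reg 13 +ᵉ lit 1)
        (pushJob (reg 11)) skip)).run τ1 = ρ at inner f13 f10
      rw [g.2.2.2] at f13
      rw [g.2.2.1] at f10
      obtain ⟨i1, i2, i3, i4, i5⟩ := inner
      have l8 : ((pushJob (reg 13)).run ρ).reg 8 = ρ.reg 8 + 1 := by simp [pushJob]
      have l10 : ∀ q, ((pushJob (reg 13)).run ρ).arr 10 q =
          if q = ρ.reg 8 then t else ρ.arr 10 q := by
        intro q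
        simp [pushJob, f10]
      have l11 : ∀ q, ((pushJob (reg 13)).run ρ).arr 11 q =
          if q = ρ.reg 8 then ord' t else ρ.arr 11 q := by
        intro q
        simp [pushJob, f13]
      obtain ⟨j1, j2, j3⟩ := i1.push (.inl rfl) l10 l11
      simp only [State.setReg_reg, State.setReg_arr, show ¬ (8 : ℕ) = 10 by decide, if_false, l8]
      refine ⟨⟨fun q hq => (j1.le q hq).trans (by omega), j1.valid, j1.mono⟩,
        fun q hq => Nat.lt_succ_of_le (j1.le q hq), fun i hi => ?_, fun i hi Z hZ hiZ => ?_, ?_⟩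
      · rcases Nat.lt_succ_iff_lt_or_eq.1 hi with hi | rfl
        · exact j2 _ _ (i2 i hi)
        · exact j3
      · rcases Nat.lt_succ_iff_lt_or_eq.1 hi with hi | rfl
        · exact j2 _ _ (i3 i hi Z hZ hiZ)
        · exact j2 _ _ (i4 Z hZ hiZ)
      · have : ((Finset.range p).filter fun Z => (∃ i < t, pa Z = ord' i + 1) ∨
            Z < p ∧ pa Z = ord' t + 1).card ≤
            ((Finset.range p).filter fun Z => ∃ i < t + 1, pa Z = ord' i + 1).card := by
          refine Finset.card_le_card fun Z hZ => ?_
          obtain ⟨h3, h4⟩ := Finset.mem_filter.1 hZ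
          refine Finset.mem_filter.2 ⟨h3, ?_⟩
          rcases h4 with ⟨i, hi, h4⟩ | ⟨-, h4⟩
          · exact ⟨i, by omega, h4⟩
          · exact ⟨t, by omega, h4⟩
        omega
    · simp only [State.setReg_reg, State.setReg_arr, g, ga, show ¬ (8 : ℕ) = 11 by decide,
        if_false]
      refine ⟨k1, k3, k4, by simp, ?_⟩
      simpa using k5
    · rintro s ρ hs hsi hG ⟨i1, i2, i3, i4, i5⟩
      rw [g.1] at hs
      have l : (∀ r ∈ [10, 13], ρ.reg r = τ1.reg r) ∧ ∀ A ∈ [9], ρ.arr A = τ1.arr A :=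
        keeps_frame rfl hG
      simp only [List.mem_cons, List.not_mem_nil, or_false, forall_eq_or_imp, forall_eq, g, ga,
        f] at l
      have hexp : ((Finset.range p).filter fun Z => (∃ i < t, pa Z = ord' i + 1) ∨
            Z < s + 1 ∧ pa Z = ord' t + 1) = ((Finset.range p).filter fun Z =>
            (∃ i < t, pa Z = ord' i + 1) ∨ Z < s ∧ pa Z = ord' t + 1) ∪
            if pa s = ord' t + 1 then {s} else ∅ := by
        ext Z
        simp only [Finset.mem_union, Finset.mem_filter, Finset.mem_range]
        by_cases hZs : Z = s
        · subst hZs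
          by_cases hpZ : pa Z = ord' t + 1
          · simp [hs, hpZ]
          · simp [hpZ]
        · have h3 : Z < s + 1 ↔ Z < s := by omega
          have h4 : Z ∉ (if pa s = ord' t + 1 then ({s} : Finset ℕ) else ∅) := by
            split_ifs <;> simp [hZs]
          rw [h3]
          simp [h4]
      simp only [run_ite, holds_eq, eval_load, eval_reg, eval_add, eval_lit, hsi, l]
      split_ifs with hc
      · have l8 : ((pushJob (reg 11)).run ρ).reg 8 = ρ.reg 8 + 1 := by simp [pushJob]
        have l10 : ∀ q, ((pushJob (reg 11)).run ρ).arr 10 q =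
            if q = ρ.reg 8 then t else ρ.arr 10 q := by
          intro q
          simp [pushJob, l]
        have l11 : ∀ q, ((pushJob (reg 11)).run ρ).arr 11 q =
            if q = ρ.reg 8 then s else ρ.arr 11 q := by
          intro q
          simp [pushJob, hsi]
        obtain ⟨j1, j2, j3⟩ := i1.push (.inr ⟨hs, hc⟩) l10 l11
        simp only [State.setReg_reg, State.setReg_arr, show ¬ (8 : ℕ) = 11 by decide, if_false, l8]
        refine ⟨j1, fun i hi => j2 _ _ (i2 i hi), fun i hi Z hZ hiZ => j2 _ _ (i3 i hi Z hZ hiZ),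
          fun Z hZ hpZ => ?_, ?_⟩
        · rcases Nat.lt_succ_iff_lt_or_eq.1 hZ with hZ | rfl
          · exact j2 _ _ (i4 Z hZ hpZ)
          · exact j3
        · rw [hexp, if_pos hc, Finset.card_union_of_disjoint, Finset.card_singleton]
          · omega
          · simp only [Finset.disjoint_singleton_right, Finset.mem_filter, not_and, not_or]
            refine fun _ => ⟨?_, by simp⟩
            rintro ⟨i, hi, hpi⟩
            exact hi.ne (hinj i (hi.trans ht) t ht (Nat.succ_injective (hpi.symm.trans hc)))
      · simp only [run_skip, State.setReg_reg, State.setReg_arr, show ¬ (8 : ℕ) = 11 by decide,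
          if_false]
        refine ⟨i1, i2, i3, fun Z hZ hpZ => ?_, ?_⟩
        · rcases Nat.lt_succ_iff_lt_or_eq.1 hZ with hZ | rfl
          · exact i4 Z hZ hpZ
          · exact absurd hpZ hc
        · rw [hexp, if_neg hc, Finset.union_empty]
          exact i5

/-- Array `12` is the indicator function of the attached vertices. -/
lemma markAttached_spec (h2 : σ.arr 2 = b) (h9 : σ.arr 9 = pa) (h12 : ∀ v, σ.arr 12 v = 0)
    (hE : ∀ u v, E u v ↔ ∃ j < σ.reg 5, σ.arr 5 j = u ∧ σ.arr 6 j = v) (v : ℕ) :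
    ((markAttached.run σ).arr 12 v = 1 ↔ Att E b pa v) ∧ (markAttached.run σ).arr 12 v ≤ 1 := by
  have hex : (∃ j < σ.reg 5, (load 9 (load 2 (load 6 (reg 10))) =ᵉ
        load 2 (load 5 (reg 10)) +ᵉ lit 1).Holds (σ.setReg 10 j) ∧
        (load 6 (reg 10)).eval (σ.setReg 10 j) = v) ↔ Att E b pa v := by
    simp only [holds_eq, eval_load, eval_reg, eval_lit, eval_add, State.setReg_reg,
      State.setReg_arr, if_true, h2, h9, Att, hE]
    constructor
    · rintro ⟨j, hj, h3, rfl⟩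
      exact ⟨_, ⟨j, hj, rfl, rfl⟩, h3⟩
    · rintro ⟨_, ⟨j, hj, rfl, rfl⟩, h3⟩
      exact ⟨j, hj, h3, rfl⟩
  rw [markAttached, run_loop_mark _ rfl rfl]
  by_cases hc : Att E b pa v
  · simp only [if_pos (hex.2 hc), hc, le_refl, and_self]
  · simp only [if_neg fun h => hc (hex.1 h), h12, hc, zero_ne_one, zero_le, and_self]

end RAM

/-! ### Correctness of the selection -/

namespace RAM

open RAM.Expr RAM.Cmd WPC

variable {n p m : ℕ} {E : ℕ → ℕ → Prop} {b pa : ℕ → ℕ} {σ τ : State}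

/-- After the preparation, the memory holds the search tree and a valid list of jobs, and the empty
table satisfies the invariant of the jobs. -/
lemma preparation_spec (h0 : σ.reg 0 = n) (h1 : σ.reg 1 = m) (h2 : σ.reg 2 = p)
    (h5 : σ.reg 5 = m + m) (h7 : σ.reg 7 = n + 1) (ha2 : σ.arr 2 = b)
    (hzero : ∀ A, 5 ≤ A → ∀ j, σ.arr A j = 0)
    (hE : ∀ u v, E u v ↔ ∃ j < m, σ.arr 0 j = u ∧ σ.arr 1 j = v ∨ σ.arr 0 j = v ∧ σ.arr 1 j = u)
    (hlt : ∀ u v, E u v → u < n ∧ v < n) (hp : 0 < p) (hb : ∀ u v, E u v → b u < p ∧ b v < p)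
    (hconn : ∀ S : ℕ → Prop, S 0 → (∀ u v, E u v → S (b u) → S (b v)) → ∀ Y < p, S Y)
    (hbids : ∀ U : Finset ℕ, ∀ X, (∀ v ∈ U, v < n ∧ b v = X) → U.card * (U.card + 1) < σ.reg 6)
    (hτ : τ = preparation.run σ) :
    (SearchInv p E b p (τ.arr 8) (τ.arr 9) ∧ ∀ Y < p, ∃ i < p, τ.arr 8 i = Y) ∧ τ.reg 8 ≤ 2 * p ∧
      ∃ jx jz, JobList p (τ.arr 9) (τ.reg 8) jx jz ∧
        InJobs n p E b (τ.arr 9) (τ.reg 8) jx jz (DoneBefore 0 0) τ := by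
  simp only [preparation, run_seq] at hτ
  set σ1 := orientEdges.run σ with hσ1
  set σ2 := search.run σ1 with hσ2
  set σ3 := listJobs.run σ2 with hσ3
  have f1 : (∀ r ∈ [0, 2, 5, 6, 7], σ1.reg r = σ.reg r) ∧
      ∀ A ∈ [2, 8, 9, 12, 20, 21, 22, 23, 24, 25, 26, 27, 28], σ1.arr A = σ.arr A :=
    keeps_frame rfl (frame_run _ σ)
  have f2 : (∀ r ∈ [0, 2, 5, 6, 7], σ2.reg r = σ1.reg r) ∧
      ∀ A ∈ [2, 5, 6, 12, 20, 21, 22, 23, 24, 25, 26, 27, 28], σ2.arr A = σ1.arr A :=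
    keeps_frame rfl (frame_run _ σ1)
  have f3 : (∀ r ∈ [0, 2, 5, 6, 7], σ3.reg r = σ2.reg r) ∧
      ∀ A ∈ [2, 5, 6, 8, 9, 12, 20, 21, 22, 23, 24, 25, 26, 27, 28], σ3.arr A = σ2.arr A :=
    keeps_frame rfl (frame_run _ σ2)
  have f4 : (∀ r ∈ [0, 2, 5, 6, 7, 8], τ.reg r = σ3.reg r) ∧
      ∀ A ∈ [2, 5, 6, 8, 9, 10, 11, 20, 21, 22, 23, 24, 25, 26, 27, 28], τ.arr A = σ3.arr A := by
    rw [hτ]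
    exact keeps_frame rfl (frame_run markAttached σ3)
  simp only [List.mem_cons, List.not_mem_nil, or_false, forall_eq_or_imp, forall_eq]
    at f1 f2 f3 f4
  obtain ⟨⟨r10, r12, r15, r16, r17⟩, a1⟩ := f1
  obtain ⟨⟨r20, r22, r25, r26, r27⟩, a2⟩ := f2
  obtain ⟨⟨r30, r32, r35, r36, r37⟩, a3⟩ := f3
  obtain ⟨⟨r40, r42, r45, r46, r47, r48⟩, a4⟩ := f4
  have hE1 : ∀ u v, E u v ↔ ∃ j < σ1.reg 5, σ1.arr 5 j = u ∧ σ1.arr 6 j = v := by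
    rw [r15, h5]
    exact orientEdges_spec h1 h5 hE
  obtain ⟨hS, hsurj⟩ := search_spec (σ := σ1) (p := p) (E := E) (b := b) (by rw [r12, h2]) hp
    (by rw [a1.1, ha2]) (by rw [a1.2.1]; exact hzero 8 (by simp))
    (by rw [a1.2.2.1]; exact hzero 9 (by simp)) hE1 hb hconn
  obtain ⟨hj8, hJ⟩ := listJobs_spec (σ := σ2) (by rw [r22, r12, h2]) hS hsurj
  have hatt := markAttached_spec (σ := σ3) (b := b) (pa := σ3.arr 9) (E := E)
    (by rw [a3.1, a2.1, a1.1, ha2]) rfl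
    (by rw [a3.2.2.2.2.2.1, a2.2.2.2.1, a1.2.2.2.1]; exact hzero 12 (by simp))
    (by rw [r35, r25, a3.2.1, a3.2.2.1, a2.2.1, a2.2.2.1]; exact hE1)
  have hτ8 : τ.arr 8 = σ2.arr 8 := a4.2.2.2.1.trans a3.2.2.2.1
  have hτ93 : τ.arr 9 = σ3.arr 9 := a4.2.2.2.2.1
  have hτ9 : τ.arr 9 = σ2.arr 9 := hτ93.trans a3.2.2.2.2.1
  have hhi : ∀ A < 9, ∀ j, τ.arr (20 + A) j = 0 := by
    intro A hA j
    rw [← hzero (20 + A) (by omega) j]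
    interval_cases A <;> simp only [Nat.reduceAdd, a1, a2, a3, a4]
  rw [← hσ2] at hS hsurj
  rw [← hσ3] at hJ hj8
  rw [hτ8, hτ9, r48]
  refine ⟨⟨hS, hsurj⟩, hj8, _, _, hJ, ⟨?_, ?_, ?_, ?_⟩⟩
  · constructor
    · rw [r40, r30, r20, r10, h0]
    · rw [r42, r32, r22, r12, h2]
    · rw [r47, r37, r27, r17, h7]
    · rw [a4.1, a3.1, a2.1, a1.1, ha2]
    · exact hτ9
    · exact hlt
    · rw [r45, r35, r25, a4.2.1, a4.2.2.1, a3.2.1, a3.2.2.1, a2.2.1, a2.2.2.1]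
      exact hE1
    · rw [← hτ9, hτ93, hτ]
      exact fun v => (hatt v).1
    · rw [hτ]
      exact fun v => (hatt v).2
    · rw [r46, r36, r26, r16]
      exact hbids
  · intro q _
    rw [hτ8, a4.2.2.2.2.2.1]
  · intro q _
    rw [a4.2.2.2.2.2.2.1]
  · have hval : ∀ M < 3, ∀ X, valOf τ M X = 0 := fun M hM X => hhi M (by omega) X
    have hmg : ∀ M < 3, ∀ X, mergedOf τ M X = 0 := fun M hM X => by
      have := hhi (3 + M) (by omega) X
      rwa [← add_assoc] at this
    have hk : ∀ M < 3, ∀ X, keptOf n b τ M X = ∅ := fun M hM X => by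
      refine Finset.filter_eq_empty_iff.2 fun v _ h => ?_
      have := hhi (6 + M) (by omega) v
      rw [← add_assoc] at this
      exact absurd (this.symm.trans h.2) (by simp)
    refine ⟨fun M hM X _ => ?_, fun M _ q _ hD => ?_, fun X _ _ M hM =>
      ⟨hval M hM X, hmg M hM X, hk M hM X⟩⟩
    · rw [hmg M hM, hk M hM]
      exact isAttained_empty (hval M hM X)
    · simp [DoneBefore] at hD

/-- The mode of `Y = reg 13` is `1` if the parent is merged with `Y`, otherwise `0` or `2` according to
whether the set `L` kept in the parent hits `Y`. -/
lemma chooseMode_spec (h9 : σ.arr 9 = pa) (h2 : σ.arr 2 = b)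
    (hE : ∀ u v, E u v ↔ ∃ j < σ.reg 5, σ.arr 5 j = u ∧ σ.arr 6 j = v) {L : Finset ℕ}
    (hL : ∀ u, (∃ v, E u v) → b u + 1 = pa (σ.reg 13) → (u ∈ L ↔ σ.arr 29 u = 1))
    (hL' : ∀ u ∈ L, b u + 1 = pa (σ.reg 13)) :
    ((σ.arr 30 (pa (σ.reg 13)) = σ.reg 13 + 1 → (chooseMode.run σ).reg 15 = 1)) ∧
    (σ.arr 30 (pa (σ.reg 13)) ≠ σ.reg 13 + 1 → Hits E b L (σ.reg 13) →
      (chooseMode.run σ).reg 15 = 0) ∧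
    (σ.arr 30 (pa (σ.reg 13)) ≠ σ.reg 13 + 1 → ¬ Hits E b L (σ.reg 13) →
      (chooseMode.run σ).reg 15 = 2) := by
  simp only [chooseMode, run_seq]
  set σ1 := (assign 15 (lit 2)).run ((assign 14 (load 9 (reg 13))).run σ) with hσ1
  have e : σ1.reg 5 = σ.reg 5 ∧ σ1.reg 13 = σ.reg 13 ∧ σ1.reg 14 = pa (σ.reg 13) ∧
      σ1.reg 15 = 2 := by
    simp [hσ1, h9]
  have ea : σ1.arr = σ.arr := rfl
  have hex : (∃ j < σ1.reg 5, (load 2 (load 6 (reg 11)) =ᵉ reg 13 ∧ᵉ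
      load 2 (load 5 (reg 11)) +ᵉ lit 1 =ᵉ reg 14 ∧ᵉ load 29 (load 5 (reg 11)) =ᵉ lit 1).Holds
        (σ1.setReg 11 j)) ↔ Hits E b L (σ.reg 13) := by
    simp only [holds_and, holds_eq, eval_load, eval_reg, eval_lit, eval_add, State.setReg_reg,
      State.setReg_arr, if_true, e, ea, h2, show ¬ (13 : ℕ) = 11 by decide,
      show ¬ (14 : ℕ) = 11 by decide, if_false, Hits, hE]
    constructor
    · rintro ⟨j, hj, h3, h4, h5⟩
      exact ⟨_, (hL _ ⟨_, (hE _ _).2 ⟨j, hj, rfl, rfl⟩⟩ h4).2 h5, _, ⟨j, hj, rfl, rfl⟩, h3⟩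
    · rintro ⟨u, hu, v, ⟨j, hj, rfl, rfl⟩, h3⟩
      exact ⟨j, hj, h3, hL' _ hu, (hL _ ⟨_, (hE _ _).2 ⟨j, hj, rfl, rfl⟩⟩ (hL' _ hu)).1 hu⟩
  have hany := run_loop_any (i := 11) (N := 5) (r := 15) (a := 0)
    (q := load 2 (load 6 (reg 11)) =ᵉ reg 13 ∧ᵉ load 2 (load 5 (reg 11)) +ᵉ lit 1 =ᵉ reg 14 ∧ᵉ
      load 29 (load 5 (reg 11)) =ᵉ lit 1) σ1 (by decide) (by rfl)
  have f : (∀ r ∈ [13, 14], _ = σ1.reg r) ∧ ∀ A ∈ [30], _ = σ1.arr A :=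
    keeps_frame (c := loop 11 5 (ite (load 2 (load 6 (reg 11)) =ᵉ reg 13 ∧ᵉ
      load 2 (load 5 (reg 11)) +ᵉ lit 1 =ᵉ reg 14 ∧ᵉ load 29 (load 5 (reg 11)) =ᵉ lit 1)
      (assign 15 (lit 0)) skip)) rfl (frame_run _ σ1)
  generalize (loop 11 5 (ite (load 2 (load 6 (reg 11)) =ᵉ reg 13 ∧ᵉ
      load 2 (load 5 (reg 11)) +ᵉ lit 1 =ᵉ reg 14 ∧ᵉ load 29 (load 5 (reg 11)) =ᵉ lit 1)
      (assign 15 (lit 0)) skip)).run σ1 = τ at hany f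
  simp only [List.mem_cons, List.not_mem_nil, or_false, forall_eq_or_imp, forall_eq, e, ea] at f
  simp only [run_ite, holds_eq, eval_load, eval_reg, eval_add, eval_lit, f]
  refine ⟨fun hc => ?_, fun hc hh => ?_, fun hc hh => ?_⟩
  · rw [if_pos hc]
    simp
  · rw [if_neg hc, run_skip, hany, if_pos (hex.2 hh)]
  · rw [if_neg hc, run_skip, hany, if_neg fun h => hh (hex.1 h), e.2.2.2]

lemma adopt_spec {M : ℕ} (h0 : σ.reg 0 = n) (h2 : σ.arr 2 = b) (hM : M < 3) :
    (∀ j, ((adopt M).run σ).arr 30 j =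
      if j = σ.reg 13 + 1 then σ.arr (23 + M) (σ.reg 13) else σ.arr 30 j) ∧
    ∀ v < n, ((adopt M).run σ).arr 29 v =
      if b v = σ.reg 13 then σ.arr (26 + M) v else σ.arr 29 v := by
  simp only [adopt, run_seq]
  set σ1 := (store 30 (reg 13 +ᵉ lit 1) (load (23 + M) (reg 13))).run σ with hσ1
  have hne : ∀ A < 30, σ1.arr A = σ.arr A := by
    intro A hA
    exact State.setArr_arr_ne _ _ _ hA.ne
  constructor
  · intro j
    rw [run_arr _ σ1 (A := 30) (by rfl)]
    simp [hσ1]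
  · intro v hv
    rw [run_loop_map σ1 (by rfl) (by interval_cases M <;> rfl)]
    have e0 : σ1.reg 0 = n := h0
    simp only [e0, hv, true_and, holds_eq, eval_load, eval_reg, State.setReg_reg,
      State.setReg_arr, if_true, hne 2 (by simp), hne 29 (by simp), hne (26 + M) (by omega), h2,
      show ¬ (13 : ℕ) = 11 by decide, if_false]
    rfl

/-- The modes are determined from the root downwards as `RootedBags.isCluster_and_card` requires. For
the root, whose parent is the virtual bag `p`, the cell `p + 1` of array `30` is `0` and no kept
vertex belongs to the parent, which results in mode `2`. -/
lemma selectAll_spec (hT : RootedBags n p E b pa) (h : Ready n p E b pa σ)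
    (hS : SearchInv p E b p (σ.arr 8) pa) (hsurj : ∀ Y < p, ∃ i < p, σ.arr 8 i = Y)
    (h30 : σ.arr 30 (p + 1) = 0) :
    ∃ md : ℕ → ℕ, (∀ X < p, md X < 3) ∧ md 0 = 2 ∧
      (∀ X < p, ∀ Y < p, pa Y = X + 1 →
        (mergedOf σ (md X) X = Y + 1 → md Y = 1) ∧
        (mergedOf σ (md X) X ≠ Y + 1 → Hits E b (keptOf n b σ (md X) X) Y → md Y = 0) ∧
        (mergedOf σ (md X) X ≠ Y + 1 → ¬ Hits E b (keptOf n b σ (md X) X) Y → md Y = 2)) ∧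
      ∀ v < n, (selectAll.run σ).arr 29 v = σ.arr (26 + md (b v)) v := by
  have key := run_loop_induction (i := 10) (N := 2)
    (c := assign 13 (load 8 (reg 10)) ;; chooseMode ;;
      ite (reg 15 =ᵉ lit 0) (adopt 0) (ite (reg 15 =ᵉ lit 1) (adopt 1) (adopt 2))) (σ := σ)
    (P := fun t τ => ∃ md : ℕ → ℕ, (∀ i < t, md (σ.arr 8 i) < 3) ∧ (0 < t → md 0 = 2) ∧
      (∀ i < t, ∀ X < p, pa (σ.arr 8 i) = X + 1 →
        (mergedOf σ (md X) X = σ.arr 8 i + 1 → md (σ.arr 8 i) = 1) ∧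
        (mergedOf σ (md X) X ≠ σ.arr 8 i + 1 → Hits E b (keptOf n b σ (md X) X) (σ.arr 8 i) →
          md (σ.arr 8 i) = 0) ∧
        (mergedOf σ (md X) X ≠ σ.arr 8 i + 1 → ¬ Hits E b (keptOf n b σ (md X) X) (σ.arr 8 i) →
          md (σ.arr 8 i) = 2)) ∧
      (∀ i < t, τ.arr 30 (σ.arr 8 i + 1) = mergedOf σ (md (σ.arr 8 i)) (σ.arr 8 i)) ∧
      (∀ i < t, ∀ v < n, b v = σ.arr 8 i → τ.arr 29 v = σ.arr (26 + md (b v)) v) ∧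
      τ.arr 30 (p + 1) = 0) ?_ ?_
  · rw [h.reg2] at key
    obtain ⟨md, k1, k2, k3, -, k5, -⟩ := key
    refine ⟨md, fun X hX => ?_, k2 hS.pos, fun X hX Y hY hXY => ?_, fun v hv => ?_⟩
    · obtain ⟨i, hi, rfl⟩ := hsurj X hX
      exact k1 i hi
    · obtain ⟨i, hi, rfl⟩ := hsurj Y hY
      exact k3 i hi X hX hXY
    · obtain ⟨i, hi, hiv⟩ := hsurj (b v) (hT.bag_lt hv)
      exact k5 i hi v hv hiv.symm
  · exact ⟨fun _ => 0, by simp, by simp, by simp, by simp, by simp, h30⟩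
  · rintro t τ ht hti hF ⟨md, k1, k2, k3, k4, k5, k6⟩
    rw [h.reg2] at ht
    have f : (∀ r ∈ [0, 2, 5], τ.reg r = σ.reg r) ∧
        ∀ A ∈ [2, 5, 6, 8, 9, 23, 24, 25, 26, 27, 28], τ.arr A = σ.arr A :=
      keeps_frame rfl hF
    simp only [run_seq]
    set τ1 := (assign 13 (load 8 (reg 10))).run τ with hτ1
    set τ2 := chooseMode.run τ1 with hτ2
    have f2 : (∀ r ∈ [0, 2, 5, 13], τ2.reg r = τ1.reg r) ∧
        ∀ A ∈ [2, 5, 6, 8, 9, 23, 24, 25, 26, 27, 28, 29, 30], τ2.arr A = τ1.arr A :=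
      keeps_frame rfl (frame_run chooseMode τ1)
    have ga : τ1.arr = τ.arr := rfl
    have hmgarr : ∀ M < 3, τ2.arr (23 + M) = σ.arr (23 + M) := by
      intro M hM
      rw [f2.2 (23 + M) (by interval_cases M <;> simp), ga,
        f.2 (23 + M) (by interval_cases M <;> simp)]
    have hlocarr : ∀ M < 3, τ2.arr (26 + M) = σ.arr (26 + M) := by
      intro M hM
      rw [f2.2 (26 + M) (by interval_cases M <;> simp), ga,
        f.2 (26 + M) (by interval_cases M <;> simp)]
    simp only [List.mem_cons, List.not_mem_nil, or_false, forall_eq_or_imp, forall_eq] at f f2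
    set Y := σ.arr 8 t with hY
    have g13 : τ1.reg 13 = Y := by simp [hτ1, hti, f, hY]
    have g5 : τ1.reg 5 = σ.reg 5 := by simp [hτ1, f]
    have g0 : τ2.reg 0 = n := by
      rw [f2.1.1, ← h.reg0, ← f.1.1]
      simp [hτ1]
    have t2 : τ2.arr 2 = b := by rw [f2.2.1, ga, f.2.1, h.arr2]
    have t13 : τ2.reg 13 = Y := by rw [f2.1.2.2.2, g13]
    have t29 : τ2.arr 29 = τ.arr 29 := by
      rw [← ga]
      simp only [f2]
    have t30 : τ2.arr 30 = τ.arr 30 := by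
      rw [← ga]
      simp only [f2]
    have e9 : τ1.arr 9 = pa := by rw [ga, f.2.2.2.2.2.1, h.arr9]
    have e2 : τ1.arr 2 = b := by rw [ga, f.2.1, h.arr2]
    have hEτ : ∀ u v, E u v ↔ ∃ j < τ1.reg 5, τ1.arr 5 j = u ∧ τ1.arr 6 j = v := by
      rw [g5, ga, f.2.2.1, f.2.2.2.1]
      exact h.edge
    have hYp := (hS.lt t ht).1
    -- The mode that the machine chooses is the one that the parent requires.
    have hmode : τ2.reg 15 < 3 ∧ (t = 0 → τ2.reg 15 = 2) ∧ ∀ X < p, pa Y = X + 1 →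
        (mergedOf σ (md X) X = Y + 1 → τ2.reg 15 = 1) ∧
        (mergedOf σ (md X) X ≠ Y + 1 → Hits E b (keptOf n b σ (md X) X) Y → τ2.reg 15 = 0) ∧
        (mergedOf σ (md X) X ≠ Y + 1 → ¬ Hits E b (keptOf n b σ (md X) X) Y →
          τ2.reg 15 = 2) := by
      rcases Nat.eq_zero_or_pos t with ht0 | ht0
      · have hY0 : Y = 0 := by rw [hY, ht0, hS.zero]
        have hpaY : pa Y = p + 1 := by rw [hY0, hS.root]
        obtain ⟨-, -, h3⟩ := chooseMode_spec (L := ∅) e9 e2 hEτ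
          (by
            rintro u ⟨v, hv⟩ hu
            have := hT.bag_lt (hT.lt hv)
            rw [g13, hpaY] at hu
            omega) (by simp)
        rw [g13, hpaY, ga, k6] at h3
        have h4 := h3 (by simp) (by simp [Hits])
        rw [← hτ2] at h4
        refine ⟨by omega, fun _ => h4, fun X hX hXY => ?_⟩
        omega
      · obtain ⟨i', hi', hpar, -⟩ := hS.parent t ht ht0
        set X := σ.arr 8 i' with hX
        have hXp := (hS.lt i' (hi'.trans ht)).1
        have hk : ∀ u, u ∈ keptOf n b σ (md X) X ↔ u < n ∧ b u = X ∧ τ.arr 29 u = 1 := by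
          intro u
          rw [keptOf, Finset.mem_filter, Finset.mem_range]
          refine and_congr_right fun hu => and_congr_right fun hb => ?_
          rw [k5 i' hi' u hu hb, hb]
        obtain ⟨h1, h2, h3⟩ := chooseMode_spec (L := keptOf n b σ (md X) X) e9 e2 hEτ
          (by
            rintro u ⟨v, hv⟩ hu
            rw [hk, ga]
            rw [g13, hpar] at hu
            exact ⟨fun h => h.2.2, fun h => ⟨hT.lt hv, Nat.succ_injective hu, h⟩⟩)
          (by
            intro u hu
            rw [g13, hpar, ((hk u).1 hu).2.1])
        rw [g13, hpar, ga, k4 i' hi', ← hτ2] at h1 h2 h3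
        refine ⟨?_, by omega, fun X' _ hX' => ?_⟩
        · by_cases c1 : mergedOf σ (md X) X = Y + 1
          · have := h1 c1
            omega
          · by_cases c2 : Hits E b (keptOf n b σ (md X) X) Y
            · have := h2 c1 c2
              omega
            · have := h3 c1 c2
              omega
        · obtain rfl : X' = X := Nat.succ_injective (hX'.symm.trans hpar)
          exact ⟨h1, h2, h3⟩
    obtain ⟨hM3, hM0, hMX⟩ := hmode
    set M := τ2.reg 15 with hM
    have hrun : (ite (reg 15 =ᵉ lit 0) (adopt 0)
        (ite (reg 15 =ᵉ lit 1) (adopt 1) (adopt 2))).run τ2 = (adopt M).run τ2 := by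
      simp only [run_ite, holds_eq, eval_reg, eval_lit, ← hM]
      clear_value M
      interval_cases M <;> simp
    rw [hrun]
    obtain ⟨d1, d2⟩ := adopt_spec (M := M) g0 t2 hM3
    rw [t13, hmgarr M hM3, t30] at d1
    rw [t13, hlocarr M hM3, t29] at d2
    have hne : ∀ i < t, σ.arr 8 i ≠ Y := fun i hi h' =>
      hi.ne (hS.inj i (hi.trans ht) t ht h')
    let md' := fun X => if X = Y then M else md X
    have hmd' : ∀ i < t, md' (σ.arr 8 i) = md (σ.arr 8 i) := fun i hi => if_neg (hne i hi)
    have hmdY : md' Y = M := if_pos rfl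
    -- The parent of a bag that has been treated has been treated before.
    have hpar : ∀ i < t + 1, ∀ X, X < p → pa (σ.arr 8 i) = X + 1 → md' X = md X := by
      intro i hi X hXp hX
      rcases Nat.eq_zero_or_pos i with rfl | hi0
      · rw [hS.zero, hS.root] at hX
        omega
      · obtain ⟨i', hi', h3, -⟩ := hS.parent i (by omega) hi0
        obtain rfl : X = σ.arr 8 i' := Nat.succ_injective (hX.symm.trans h3)
        exact hmd' i' (by omega)
    simp only [State.setReg_arr]
    refine ⟨md', fun i hi => ?_, fun _ => ?_, fun i hi X hXp hX => ?_, fun i hi => ?_,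
      fun i hi v hv hvi => ?_, ?_⟩
    · rcases Nat.lt_succ_iff_lt_or_eq.1 hi with hi | rfl
      · rw [hmd' i hi]
        exact k1 i hi
      · rw [← hY, hmdY]
        exact hM3
    · rcases Nat.eq_zero_or_pos t with ht0 | ht0
      · have hY0 : Y = 0 := by rw [hY, ht0, hS.zero]
        rw [← hY0, hmdY]
        exact hM0 ht0
      · have := hmd' 0 ht0
        rw [hS.zero] at this
        rw [this]
        exact k2 ht0
    · rw [hpar i hi X hXp hX]
      rcases Nat.lt_succ_iff_lt_or_eq.1 hi with hi | rfl
      · rw [hmd' i hi]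
        exact k3 i hi X hXp hX
      · rw [← hY, hmdY]
        exact hMX X hXp hX
    · rw [d1]
      rcases Nat.lt_succ_iff_lt_or_eq.1 hi with hi | rfl
      · rw [if_neg fun h' => hne i hi (Nat.succ_injective h'), hmd' i hi]
        exact k4 i hi
      · rw [← hY, if_pos rfl, hmdY]
        rfl
    · rw [d2 v hv]
      rcases Nat.lt_succ_iff_lt_or_eq.1 hi with hi | rfl
      · rw [if_neg fun h' => hne i hi (hvi.symm.trans h'), hvi, hmd' i hi, ← hvi]
        exact k5 i hi v hv hvi
      · rw [← hY] at hvi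
        rw [if_pos hvi, hvi, hmdY]
    · rw [d1, if_neg (by omega)]
      exact k6

/-- The output is the complement of the set marked in array `29`, and its size is compared with `k`. -/
lemma output_spec (h0 : σ.reg 0 = n) :
    (∀ v < n, (output.run σ).arr 0 v = if σ.arr 29 v = 1 then 0 else 1) ∧
      (output.run σ).reg 0 =
        if σ.reg 4 < ((Finset.range n).filter fun v => σ.arr 29 v ≠ 1).card then 0 else 1 := by
  simp only [output, run_seq]
  set σ1 := (loop 10 0 (ite (lit 1)
    (store 0 (reg 10) (lit 1 -ᵉ (load 29 (reg 10) =ᵉ lit 1))) skip)).run σ with hσ1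
  have h1 : ∀ v < n, σ1.arr 0 v = if σ.arr 29 v = 1 then 0 else 1 := by
    intro v hv
    rw [hσ1, run_loop_map σ (by rfl) (by rfl)]
    by_cases hc : σ.arr 29 v = 1 <;> simp [h0, hv, hc, Expr.Holds, Expr.eval, Op.eval]
  have f1 : (∀ r ∈ [0, 4], σ1.reg r = σ.reg r) ∧ ∀ A ∈ [29], σ1.arr A = σ.arr A :=
    keeps_frame rfl (frame_run _ σ)
  simp only [List.mem_cons, List.not_mem_nil, or_false, forall_eq_or_imp, forall_eq] at f1
  set σ2 := (assign 13 (lit 0)).run σ1 with hσ2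
  have e : σ2.reg 0 = n ∧ σ2.reg 4 = σ.reg 4 ∧ σ2.reg 13 = 0 := by simp [hσ2, f1, h0]
  have ea : σ2.arr = σ1.arr := rfl
  have hcount := run_loop_count (i := 10) (N := 0) (r := 13) (q := load 0 (reg 10) =ᵉ lit 1) σ2
    (by decide) (by rfl)
  have f3 : (∀ r ∈ [4], _ = σ2.reg r) ∧ ∀ A ∈ [0], _ = σ2.arr A :=
    keeps_frame (c := loop 10 0 (ite (load 0 (reg 10) =ᵉ lit 1)
      (assign 13 (reg 13 +ᵉ lit 1)) skip)) rfl (frame_run _ σ2)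
  generalize (loop 10 0 (ite (load 0 (reg 10) =ᵉ lit 1)
      (assign 13 (reg 13 +ᵉ lit 1)) skip)).run σ2 = τ at hcount f3
  simp only [List.mem_cons, List.not_mem_nil, or_false, forall_eq, e, ea] at f3
  rw [e.1, e.2.2, zero_add] at hcount
  have hcard : ((Finset.range n).filter fun j => (load 0 (reg 10) =ᵉ lit 1).Holds
      (σ2.setReg 10 j)) = (Finset.range n).filter fun v => σ.arr 29 v ≠ 1 := by
    refine Finset.filter_congr fun v hv => ?_
    rw [Finset.mem_range] at hv
    simp only [holds_eq, eval_load, eval_reg, State.setReg_reg, State.setReg_arr, if_true, ea,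
      h1 v hv, eval_lit]
    split_ifs with hc <;> simp [hc]
  rw [hcard] at hcount
  constructor
  · intro v hv
    rw [run_assign, State.setReg_arr, f3.2]
    exact h1 v hv
  · simp only [run_assign, State.setReg_reg, if_true, eval_sub, eval_lt, eval_lit, eval_reg, f3,
      hcount]
    split_ifs <;> rfl

/-- The output describes the complement of a maximum set of vertices that induces a cluster graph. -/
lemma solution_spec (hT : RootedBags n p E b pa) {Q : ℕ} {jx jz : ℕ → ℕ} (hQ : σ.reg 8 = Q)
    (hJ : JobList p pa Q jx jz) (h : InJobs n p E b pa Q jx jz (DoneBefore 0 0) σ)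
    (hS : SearchInv p E b p (σ.arr 8) pa) (hsurj : ∀ Y < p, ∃ i < p, σ.arr 8 i = Y)
    (h30 : σ.arr 30 (p + 1) = 0) :
    ∃ F : Finset ℕ, (∀ v ∈ F, v < n) ∧ IsCluster E F ∧
      (∀ K : Finset ℕ, (∀ v ∈ K, v < n) → IsCluster E K → K.card ≤ F.card) ∧
      (∀ v < n, (solution.run σ).arr 0 v = if v ∈ F then 0 else 1) ∧
      (solution.run σ).reg 0 = if σ.reg 4 < n - F.card then 0 else 1 := by
  classical
  have hR := allJobs_spec hT hJ hQ h
  simp only [solution, run_seq]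
  have f1 : (∀ r ∈ [4], (allJobs.run σ).reg r = σ.reg r) ∧
      ∀ A ∈ [8, 30], (allJobs.run σ).arr A = σ.arr A :=
    keeps_frame rfl (frame_run allJobs σ)
  generalize allJobs.run σ = σ1 at hR f1
  simp only [List.mem_cons, List.not_mem_nil, or_false, forall_eq_or_imp, forall_eq] at f1
  obtain ⟨md, m1, m2, m3, m4⟩ := selectAll_spec hT hR.ready (by rw [f1.2.1]; exact hS)
    (by rw [f1.2.1]; exact hsurj) (by rw [f1.2.2, h30])
  have f2 : (∀ r ∈ [0, 4], (selectAll.run σ1).reg r = σ1.reg r) ∧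
      ∀ A ∈ [0], (selectAll.run σ1).arr A = σ1.arr A :=
    keeps_frame rfl (frame_run selectAll σ1)
  generalize selectAll.run σ1 = σ2 at m4 f2
  simp only [List.mem_cons, List.not_mem_nil, or_false, forall_eq_or_imp, forall_eq] at f2
  obtain ⟨o1, o2⟩ := output_spec (σ := σ2) (f2.1.1.trans hR.ready.reg0)
  set F := (Finset.range n).filter fun v => σ2.arr 29 v = 1 with hF
  have hF' : ∀ v, v ∈ F ↔ v < n ∧ v ∈ keptOf n b σ1 (md (b v)) (b v) := by
    intro v
    rw [hF, keptOf, Finset.mem_filter, Finset.mem_filter, Finset.mem_range]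
    constructor
    · rintro ⟨h1, h2⟩
      exact ⟨h1, h1, rfl, by rw [← m4 v h1, h2]⟩
    · rintro ⟨h1, -, -, h2⟩
      exact ⟨h1, by rw [m4 v h1, h2]⟩
  obtain ⟨c1, c2⟩ := hT.isCluster_and_card (val := valOf σ1)
    (fun M hM X hX z => hR.table.isUpper hJ hM hX (fun q hq _ => .inl hq) z)
    hR.table.attained m1 m2
    (fun X hX Y hY hXY => by
      obtain ⟨a1, a2, a3⟩ := m3 X hX Y hY hXY
      split_ifs with d1 d2
      · exact a1 d1
      · exact a2 d1 d2
      · exact a3 d1 d2) hF'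
  refine ⟨F, fun v hv => ((hF' v).1 hv).1, c1, c2, fun v hv => ?_, ?_⟩
  · rw [o1 v hv]
    simp [hF, hv]
  · have : ((Finset.range n).filter fun v => σ2.arr 29 v ≠ 1) = Finset.range n \ F := by
      ext v
      simp [hF]
      tauto
    rw [o2, this, Finset.card_sdiff_of_subset (Finset.filter_subset _ _), Finset.card_range,
      f2.1.2, f1.1]

end RAM

/-! ### Graphs on the numbers below `n` -/

namespace WPC

variable {n p : ℕ}

/-- The adjacency relation of a graph on `Fin n` as a relation on natural numbers. -/
def natAdj (G : SimpleGraph (Fin n)) (u v : ℕ) : Prop := ∃ hu hv, G.Adj ⟨u, hu⟩ ⟨v, hv⟩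

/-- The map from vertices to bags as a map on natural numbers, with value `0` beyond the
vertices. -/
def natBag (bag : Fin n → Fin p) (v : ℕ) : ℕ := if h : v < n then (bag ⟨v, h⟩ : ℕ) else 0

variable {G : SimpleGraph (Fin n)} {bag : Fin n → Fin p} {T : SimpleGraph (Fin p)}
  {ord pa : ℕ → ℕ}

lemma natAdj_fin {u v : Fin n} : natAdj G u v ↔ G.Adj u v :=
  ⟨fun ⟨_, _, h⟩ => h, fun h => ⟨u.2, v.2, h⟩⟩

lemma natBag_fin (v : Fin n) : natBag bag v = bag v := by simp [natBag]

/-- The components of `G - S` are cliques if and only if `G - S` has no induced path on three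
vertices. -/
lemma isCVDSet_iff (S : Finset (Fin n)) :
    IsCVDSet G S ↔ IsCluster (natAdj G) (Sᶜ.map Fin.valEmbedding) := by
  constructor
  · intro h u hu v hv w hw huv hvw huw
    simp only [Finset.mem_map, Finset.mem_compl, Fin.valEmbedding_apply] at hu hv hw
    obtain ⟨u, hu, rfl⟩ := hu
    obtain ⟨v, hv, rfl⟩ := hv
    obtain ⟨w, hw, rfl⟩ := hw
    rw [natAdj_fin] at *
    have h1 : (G.induce {v | v ∉ S}).Adj ⟨u, hu⟩ ⟨v, hv⟩ := huv
    have h2 : (G.induce {v | v ∉ S}).Adj ⟨v, hv⟩ ⟨w, hw⟩ := hvw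
    have h3 := h ((G.induce {v | v ∉ S}).connectedComponentMk ⟨u, hu⟩) (x := ⟨u, hu⟩)
      (by simp) (y := ⟨w, hw⟩)
      (by
        rw [SimpleGraph.ConnectedComponent.mem_supp_iff, SimpleGraph.ConnectedComponent.eq]
        exact (h1.reachable.trans h2.reachable).symm)
      (fun h' => huw (congrArg (fun x : {v | v ∉ S} => ((x : Fin n) : ℕ)) h'))
    exact h3
  · intro h K x hx y hy hxy
    have key : ∀ {x y : {v | v ∉ S}} (w : (G.induce {v | v ∉ S}).Walk x y),
        x = y ∨ (G.induce {v | v ∉ S}).Adj x y := by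
      intro x y w
      induction w with
      | nil => exact .inl rfl
      | @cons u v w huv _ ih =>
        by_cases huw : u = w
        · exact .inl huw
        · refine .inr ?_
          rcases ih with rfl | hvw
          · exact huv
          · have hm : ∀ x : {v | v ∉ S}, ((x : Fin n) : ℕ) ∈ Sᶜ.map Fin.valEmbedding := fun x =>
              Finset.mem_map.2 ⟨x, Finset.mem_compl.2 x.2, rfl⟩
            exact natAdj_fin.1 (h _ (hm u) _ (hm v) _ (hm w) (natAdj_fin.2 huv)
              (natAdj_fin.2 hvw) fun h' => huw (Subtype.ext (Fin.ext h')))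
    rw [SimpleGraph.ConnectedComponent.mem_supp_iff] at hx hy
    obtain ⟨w⟩ := SimpleGraph.ConnectedComponent.exact (hx.trans hy.symm)
    exact (key w).resolve_left hxy

lemma natAdj_iff_getD {es : List (Fin n × Fin n)} (h : IsEdgeList G es) (u v : ℕ) :
    natAdj G u v ↔ ∃ j < es.length,
      (es.map fun e => (e.1 : ℕ)).getD j 0 = u ∧ (es.map fun e => (e.2 : ℕ)).getD j 0 = v ∨
      (es.map fun e => (e.1 : ℕ)).getD j 0 = v ∧ (es.map fun e => (e.2 : ℕ)).getD j 0 = u := by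
  have hadj : ∀ x y : Fin n, G.Adj x y ↔ ∃ e ∈ es, s(e.1, e.2) = s(x, y) := by
    intro x y
    rw [← SimpleGraph.mem_edgeSet, ← h.2, List.mem_map]
  have hget : ∀ j (hj : j < es.length), (es.map fun e => (e.1 : ℕ)).getD j 0 = es[j].1 ∧
      (es.map fun e => (e.2 : ℕ)).getD j 0 = es[j].2 := by
    intro j hj
    simp [List.getD_eq_getElem?_getD, hj]
  constructor
  · rintro ⟨hu, hv, huv⟩
    obtain ⟨e, he, heq⟩ := (hadj _ _).1 huv
    obtain ⟨j, hj, rfl⟩ := List.mem_iff_getElem.1 he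
    refine ⟨j, hj, ?_⟩
    rw [(hget j hj).1, (hget j hj).2]
    rcases Sym2.eq_iff.1 heq with ⟨h1, h2⟩ | ⟨h1, h2⟩
    · exact .inl ⟨by rw [h1], by rw [h2]⟩
    · exact .inr ⟨by rw [h1], by rw [h2]⟩
  · rintro ⟨j, hj, h'⟩
    rw [(hget j hj).1, (hget j hj).2] at h'
    have hj' : G.Adj es[j].1 es[j].2 := (hadj _ _).2 ⟨es[j], List.getElem_mem hj, rfl⟩
    rcases h' with ⟨rfl, rfl⟩ | ⟨rfl, rfl⟩
    · exact natAdj_fin.2 hj'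
    · exact natAdj_fin.2 hj'.symm

lemma ncard_edgeSet {V : Type*} {G : SimpleGraph V} {es : List (V × V)} (h : IsEdgeList G es) :
    G.edgeSet.ncard = es.length := by
  classical
  have : G.edgeSet = ((es.map fun e => s(e.1, e.2)).toFinset : Set (Sym2 V)) := by
    ext e
    rw [← h.2 e]
    simp
  rw [this, Set.ncard_coe_finset, List.toFinset_card_of_nodup h.1, List.length_map]

lemma IsEdgeList.length_le {G : SimpleGraph (Fin n)} {es : List (Fin n × Fin n)}
    (h : IsEdgeList G es) : es.length ≤ n * n := by
  simpa using (List.Nodup.of_map _ h.1).length_le_card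

lemma le_length_add_one (hG : G.Connected) {es : List (Fin n × Fin n)} (h : IsEdgeList G es) :
    n ≤ es.length + 1 := by
  have := hG.card_vert_le_card_edgeSet_add_one
  rw [← ncard_edgeSet h, ← Nat.card_coe_set_eq]
  simpa using this

lemma IsPartitionTree.le (hT : IsPartitionTree G bag T) : p ≤ n := by
  simpa using Fintype.card_le_of_surjective bag hT.surjective

lemma IsPartitionTree.pos (hT : IsPartitionTree G bag T) : 0 < p := by
  have := hT.isTree.connected.nonempty
  exact Fin.pos_iff_nonempty.2 this

/-- A property of bags that passes from bag to bag along the edges of `G` spreads to all bags. -/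
lemma IsPartitionTree.induction (hT : IsPartitionTree G bag T) (hG : G.Connected) (S : ℕ → Prop)
    (h0 : S 0) (hS : ∀ u v, natAdj G u v → S (natBag bag u) → S (natBag bag v)) :
    ∀ Y < p, S Y := by
  intro Y hY
  obtain ⟨u, hu⟩ := hT.surjective ⟨0, hT.pos⟩
  obtain ⟨v, hv⟩ := hT.surjective ⟨Y, hY⟩
  have key : ∀ {x y : Fin n} (w : G.Walk x y), S (bag x) → S (bag y) := by
    intro x y w
    induction w with
    | nil => exact id
    | cons h _ ih =>
      intro hx
      apply ih
      have := hS _ _ (natAdj_fin.2 h)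
      rw [natBag_fin, natBag_fin] at this
      exact this hx
  obtain ⟨w⟩ := hG.preconnected u v
  have := key w
  rw [hu, hv] at this
  exact this h0

/-- The tree edges are exactly those found by the search, since a tree has no connected proper
spanning subgraph. -/
lemma SearchInv.adj (hS : SearchInv p (natAdj G) (natBag bag) p ord pa)
    (hsurj : ∀ Y < p, ∃ i < p, ord i = Y) (hT : IsPartitionTree G bag T) (X Y : Fin p) :
    T.Adj X Y ↔ pa Y = X + 1 ∨ pa X = Y + 1 := by
  -- Edges found by the search are tree edges.
  have hle : ∀ X Y : Fin p, pa Y = X + 1 → T.Adj X Y := by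
    intro X Y hXY
    obtain ⟨i, hi, hiY⟩ := hsurj Y Y.2
    have hi0 : 0 < i := by
      rcases Nat.eq_zero_or_pos i with rfl | h
      · rw [← hiY, hS.zero, hS.root] at hXY
        have := X.2
        omega
      · exact h
    obtain ⟨i', hi', h1, u, v, ⟨hu, hv, huv⟩, h2, h3⟩ := hS.parent i hi hi0
    rw [hiY, hXY] at h1
    have h4 : ord i' = X := (Nat.succ_injective h1).symm
    have h5 : bag ⟨u, hu⟩ = X := Fin.ext (by rw [← natBag_fin, h2, h4])
    have h6 : bag ⟨v, hv⟩ = Y := Fin.ext (by rw [← natBag_fin, h3, hiY])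
    by_contra hc
    refine hT.no_edge_of_not_adj X Y (fun h' => ?_) hc _ _ h5 h6 huv
    rw [h', ← hiY] at h4
    exact hi'.ne (hS.inj i' (hi'.trans hi) i hi h4)
  let H : SimpleGraph (Fin p) :=
    { Adj := fun X Y => pa Y = X + 1 ∨ pa X = Y + 1
      symm := ⟨fun X Y h => h.symm⟩
      loopless := ⟨fun X h => (hle X X (by simpa using h)).ne rfl⟩ }
  have hHT : H ≤ T := by
    rintro X Y (h | h)
    · exact hle X Y h
    · exact (hle Y X h).symm
  have hreach : ∀ i < p, ∀ Y : Fin p, ord i = Y → H.Reachable ⟨0, hT.pos⟩ Y := by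
    intro i
    induction i using Nat.strong_induction_on with
    | _ i ih =>
      intro hi Y hiY
      rcases Nat.eq_zero_or_pos i with rfl | hi0
      · rw [hS.zero] at hiY
        obtain rfl : ⟨0, hT.pos⟩ = Y := Fin.ext hiY
        exact SimpleGraph.Reachable.refl _
      · obtain ⟨i', hi', h1, -⟩ := hS.parent i hi hi0
        have hX := (hS.lt i' (hi'.trans hi)).1
        refine (ih i' hi' (hi'.trans hi) ⟨ord i', hX⟩ rfl).trans (SimpleGraph.Adj.reachable ?_)
        exact .inl (by rw [← hiY, h1])
  have hH : H.Connected := by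
    have : Nonempty (Fin p) := ⟨⟨0, hT.pos⟩⟩
    refine SimpleGraph.Connected.mk fun X Y => ?_
    obtain ⟨i, hi, hiX⟩ := hsurj X X.2
    obtain ⟨j, hj, hjY⟩ := hsurj Y Y.2
    exact (hreach i hi X hiX).symm.trans (hreach j hj Y hjY)
  exact ⟨fun h => (SimpleGraph.isTree_iff_minimal_connected.1 hT.isTree).2 hH hHT h,
    fun h => hHT h⟩

lemma SearchInv.rootedBags (hS : SearchInv p (natAdj G) (natBag bag) p ord pa)
    (hsurj : ∀ Y < p, ∃ i < p, ord i = Y) (hT : IsPartitionTree G bag T) :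
    RootedBags n p (natAdj G) (natBag bag) pa := by
  have hb : ∀ {v}, v < n → natBag bag v < p := fun {v} hv => by
    rw [natBag, dif_pos hv]
    exact (bag _).2
  have hparent : ∀ i < p, ∀ X < p, pa (ord i) = X + 1 → ∃ i' < i, ord i' = X := by
    intro i hi X hX hiX
    rcases Nat.eq_zero_or_pos i with rfl | hi0
    · rw [hS.zero, hS.root] at hiX
      omega
    · obtain ⟨i', hi', h1, -⟩ := hS.parent i hi hi0
      exact ⟨i', hi', Nat.succ_injective (h1.symm.trans hiX)⟩
  refine ⟨fun ⟨hu, _, _⟩ => hu, fun ⟨hu, hv, h⟩ => ⟨hv, hu, h.symm⟩, hb, ?_, ?_, ?_, ?_,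
    hS.root, ?_⟩
  · intro u v hu hv hne huv
    refine ⟨hu, hv, hT.isClique (bag ⟨u, hu⟩) rfl ?_ fun h => hne (congrArg Fin.val h)⟩
    rw [natBag, natBag, dif_pos hu, dif_pos hv] at huv
    exact Fin.ext huv.symm
  · rintro u v ⟨hu, hv, h⟩
    rw [natBag, natBag, dif_pos hu, dif_pos hv]
    by_cases hc : bag ⟨u, hu⟩ = bag ⟨v, hv⟩
    · exact .inl (by rw [hc])
    · refine .inr ((hS.adj hsurj hT _ _).1 ?_)
      by_contra hadj
      exact hT.no_edge_of_not_adj _ _ hc hadj _ _ rfl rfl h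
  · rintro u v u' v' hpa ⟨hu, hv', h1⟩ ⟨hu', hv, h2⟩ hbv hbu
    rw [natBag, natBag, dif_pos hv, dif_pos hv'] at hbv
    rw [natBag, natBag, dif_pos hu, dif_pos hu'] at hbu
    rw [natBag, natBag, dif_pos hu, dif_pos hv] at hpa
    obtain ⟨A, B, -, -, hAB⟩ := hT.product_of_adj _ _ ((hS.adj hsurj hT _ _).2 (.inl hpa))
    refine ⟨hu, hv, (hAB _ _ rfl rfl).2 ⟨?_, ?_⟩⟩
    · exact ((hAB _ _ rfl (Fin.ext hbv)).1 h1).1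
    · exact ((hAB _ _ (Fin.ext hbu) rfl).1 h2).2
  · choose f hf using hsurj
    -- The virtual parent `p` of the root has the least rank.
    refine ⟨fun Y => if h : Y < p then f Y h + 1 else 0, fun X Y hY hXY => ?_⟩
    dsimp only
    by_cases hXp : X < p
    swap
    · rw [dif_pos hY, dif_neg hXp]
      exact Nat.succ_pos _
    rw [dif_pos hY, dif_pos hXp]
    obtain ⟨h1, h2⟩ := hf Y hY
    obtain ⟨h3, h4⟩ := hf X hXp
    obtain ⟨i', hi', h5⟩ := hparent (f Y hY) h1 X hXp (by rw [h2, hXY])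
    rw [hS.inj (f X hXp) h3 i' (hi'.trans h1) (h4.trans h5.symm)]
    exact Nat.succ_lt_succ hi'
  · intro Y hY hY0
    obtain ⟨i, hi, rfl⟩ := hsurj Y hY
    obtain ⟨i', hi', h1, -⟩ := hS.parent i hi (by
      rcases Nat.eq_zero_or_pos i with rfl | h
      · exact absurd hS.zero hY0
      · exact h)
    exact ⟨ord i', (hS.lt i' (hi'.trans hi)).1, h1⟩

/-- A bag is a clique, so that its size is bounded in terms of the number of edges. -/
lemma IsPartitionTree.card_mul_lt (hT : IsPartitionTree G bag T) (hG : G.Connected)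
    {es : List (Fin n × Fin n)} (h : IsEdgeList G es) {U : Finset ℕ} {X : ℕ}
    (hU : ∀ v ∈ U, v < n ∧ natBag bag v = X) :
    U.card * (U.card + 1) < es.length + es.length + (es.length + es.length) + 3 := by
  set f : ℕ → ℕ × ℕ := fun j =>
    ((es.map fun e => (e.1 : ℕ)).getD j 0, (es.map fun e => (e.2 : ℕ)).getD j 0)
  have hsub : U.offDiag ⊆ (Finset.range es.length).image f ∪
      (Finset.range es.length).image (fun j => (f j).swap) := by
    rintro ⟨u, v⟩ huv
    obtain ⟨hu, hv, hne⟩ := Finset.mem_offDiag.1 huv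
    obtain ⟨hun, hub⟩ := hU u hu
    obtain ⟨hvn, hvb⟩ := hU v hv
    have hadj : natAdj G u v := by
      refine ⟨hun, hvn, hT.isClique (bag ⟨u, hun⟩) rfl ?_ fun h => hne (congrArg Fin.val h)⟩
      rw [natBag, dif_pos hun] at hub
      rw [natBag, dif_pos hvn] at hvb
      exact Fin.ext (hvb.trans hub.symm)
    obtain ⟨j, hj, ⟨h1, h2⟩ | ⟨h1, h2⟩⟩ := (natAdj_iff_getD h u v).1 hadj
    · exact Finset.mem_union_left _ (Finset.mem_image.2 ⟨j, Finset.mem_range.2 hj,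
        Prod.ext h1 h2⟩)
    · exact Finset.mem_union_right _ (Finset.mem_image.2 ⟨j, Finset.mem_range.2 hj,
        Prod.ext h2 h1⟩)
  have h1 := (Finset.card_le_card hsub).trans ((Finset.card_union_le _ _).trans
    (Nat.add_le_add Finset.card_image_le Finset.card_image_le))
  rw [Finset.offDiag_card, Finset.card_range] at h1
  have h2 : U.card ≤ n := by
    simpa using Finset.card_le_card (fun v hv => Finset.mem_range.2 (hU v hv).1 :
      U ⊆ Finset.range n)
  -- A connected graph has `n ≤ m + 1`, so that `|U|² + |U| ≤ 2 m + 2 (m + 1)`.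
  have h3 := le_length_add_one hG h
  rw [Nat.mul_add, mul_one]
  omega

end WPC

/-! ### Running time and overflow -/

namespace RAM

open RAM.Expr RAM.Cmd WPC

/-- Bounds for the limits of the loops. -/
def limitBound (n m : ℕ) : ℕ → ℕ
  | 5 => m + m
  | 6 => m + m + (m + m) + 3
  | 7 => n + 1
  | 8 => 2 * n
  | _ => n

/-- The static bound on the running time is `O(m² n)`: the auctions contribute `O(p m²)`, everything
else `O(n³ + m n + 1)`, and `n ≤ m + 1`. The summand `30` covers `setLimits`. -/
lemma exists_time_le : ∃ C, ∀ n m : ℕ, 0 < n → n ≤ m + 1 →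
    30 + preparation.time (limitBound n m) + solution.time (limitBound n m) ≤
      C * (m ^ 2 * n + 1) := by
  refine ⟨100000, fun n m hn hnm => ?_⟩
  simp only [preparation, solution, orientEdges, search, searchStep, listJobs, pushJob,
    markAttached, allJobs, job, jobInMode, solveJob, markBidders, initAuction, initPrices, auction,
    findBid, placeBid, findGap, evaluate, record, selectAll, chooseMode, adopt, output, activeTest,
    Cmd.time, Expr.cost, Expr.and, Expr.or, Expr.not, limitBound]
  rcases Nat.eq_zero_or_pos m with rfl | hm
  · obtain rfl : n = 1 := by omega
    norm_num
  · have h0 : n ≤ 2 * m := by omega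
    have h1 : n ≤ m ^ 2 * n := Nat.le_mul_of_pos_left n (by positivity)
    have h2 : m * n ≤ m ^ 2 * n := Nat.mul_le_mul_right n (by nlinarith)
    have h3 : m ≤ m * n := Nat.le_mul_of_pos_right m hn
    have h4 : n ^ 2 ≤ 2 * (m * n) := by nlinarith
    have h5 : n ^ 2 * m ≤ 2 * (m ^ 2 * n) := by
      calc n ^ 2 * m ≤ (2 * (m * n)) * m := Nat.mul_le_mul_right m h4
        _ = 2 * (m ^ 2 * n) := by ring
    have h6 : n ^ 3 ≤ 4 * (m ^ 2 * n) := by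
      calc n ^ 3 = n ^ 2 * n := by ring
        _ ≤ (2 * (m * n)) * (2 * m) := Nat.mul_le_mul h4 h0
        _ = 4 * (m ^ 2 * n) := by ring
    ring_nf at *
    linarith

/-- Words of `O(log n)` bits hold all numbers below `7 (n + 1)²` plus the running time, since
`C + 7 ≤ 2 ^ (C + 7)` turns the constant factor into an exponent. -/
lemma word_bound {n C m W : ℕ} (hn : 0 < n) (hm : m ≤ n * n) (hW : (n + 1) ^ (C + 12) ≤ W) :
    7 * (n + 1) ^ 2 + C * (m ^ 2 * n + 1) ≤ W := by
  refine le_trans ?_ hW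
  have h1 : m ^ 2 * n + 1 ≤ (n + 1) ^ 5 := by
    have h2 : m ^ 2 ≤ n ^ 4 := by
      calc m ^ 2 ≤ (n * n) ^ 2 := Nat.pow_le_pow_left hm 2
        _ = n ^ 4 := by ring
    have h3 : n ^ 5 + 1 ≤ (n + 1) ^ 5 := by
      ring_nf
      omega
    calc m ^ 2 * n + 1 ≤ n ^ 4 * n + 1 := Nat.succ_le_succ (Nat.mul_le_mul_right n h2)
      _ = n ^ 5 + 1 := by ring
      _ ≤ (n + 1) ^ 5 := h3
  have h4 : (n + 1) ^ 2 ≤ (n + 1) ^ 5 := Nat.pow_le_pow_right (by omega) (by norm_num)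
  have h5 : C + 7 ≤ (n + 1) ^ (C + 7) := by
    calc C + 7 ≤ 2 ^ (C + 7) := Nat.lt_two_pow_self.le
      _ ≤ (n + 1) ^ (C + 7) := Nat.pow_le_pow_left (by omega) _
  calc 7 * (n + 1) ^ 2 + C * (m ^ 2 * n + 1)
      ≤ 7 * (n + 1) ^ 5 + C * (n + 1) ^ 5 :=
        Nat.add_le_add (Nat.mul_le_mul_left _ h4) (Nat.mul_le_mul_left _ h1)
    _ = (C + 7) * (n + 1) ^ 5 := by ring
    _ ≤ (n + 1) ^ (C + 7) * (n + 1) ^ 5 := Nat.mul_le_mul_right _ h5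
    _ = (n + 1) ^ (C + 12) := by rw [← pow_add]

lemma runs_setLimits {W : ℕ} (σ : State) (hm : 4 * σ.reg 1 + 3 ≤ W) (hn : σ.reg 0 + 1 ≤ W) :
    Runs W setLimits σ 14 (((σ.setReg 5 (σ.reg 1 + σ.reg 1)).setReg 6
      (σ.reg 1 + σ.reg 1 + (σ.reg 1 + σ.reg 1) + 3)).setReg 7 (σ.reg 0 + 1)) := by
  refine .seq (s := 4) (t := 10) (σ := σ.setReg 5 (σ.reg 1 + σ.reg 1)) (.assign 5 _ σ ?_)
    (.seq (s := 6) (t := 4) (.assign 6 _ _ ?_) (.assign 7 _ _ ?_))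
  all_goals
    simp [Expr.Fits, Expr.eval, Op.eval]
    omega

end RAM

namespace WPC

open RAM

variable {n p : ℕ} {G : SimpleGraph (Fin n)} {bag : Fin n → Fin p} {T : SimpleGraph (Fin p)}

/-- The complement of a maximum set that induces a cluster graph is a minimum CVD set. -/
lemma isSolution_of_isCluster {k : ℕ} {τ : State} {F : Finset ℕ} (hlt : ∀ v ∈ F, v < n)
    (hF : IsCluster (natAdj G) F)
    (hmax : ∀ K : Finset ℕ, (∀ v ∈ K, v < n) → IsCluster (natAdj G) K → K.card ≤ F.card)
    (h0 : ∀ v < n, τ.arr 0 v = if v ∈ F then 0 else 1)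
    (hk : τ.reg 0 = if k < n - F.card then 0 else 1) : IsSolution G k τ := by
  set S : Finset (Fin n) := Finset.univ.filter fun v => (v : ℕ) ∉ F with hS
  have hSF : Sᶜ.map Fin.valEmbedding = F := by
    ext v
    simp only [Finset.mem_map, Finset.mem_compl, hS, Finset.mem_filter, Finset.mem_univ, true_and,
      not_not, Fin.valEmbedding_apply]
    exact ⟨fun ⟨x, hx, h⟩ => h ▸ hx, fun hv => ⟨⟨v, hlt v hv⟩, hv, rfl⟩⟩
  have hcard : ∀ S : Finset (Fin n), (Sᶜ.map Fin.valEmbedding).card = n - S.card := fun S => by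
    rw [Finset.card_map, Finset.card_compl, Fintype.card_fin]
  have hle : ∀ S : Finset (Fin n), S.card ≤ n := fun S => by
    simpa using S.card_le_univ
  have hS1 : IsCVDSet G S := by
    rw [isCVDSet_iff, hSF]
    exact hF
  have hFS : F.card = n - S.card := by rw [← hcard, hSF]
  have hS2 : ∀ S' : Finset (Fin n), IsCVDSet G S' → S.card ≤ S'.card := by
    intro S' hS'
    have h1 := hmax (S'ᶜ.map Fin.valEmbedding) (fun v hv => by
      obtain ⟨x, -, rfl⟩ := Finset.mem_map.1 hv
      exact x.2) ((isCVDSet_iff S').1 hS')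
    rw [hcard, hFS] at h1
    have := hle S
    have := hle S'
    omega
  have hSn := hle S
  refine ⟨⟨S, ⟨hS1, hS2⟩, fun v => ⟨fun hv => ?_, fun hv => ?_⟩⟩, ?_, ?_⟩
  · rw [h0 v v.2, if_neg (Finset.mem_filter.1 hv).2]
  · rw [h0 v v.2, if_pos]
    by_contra h
    exact hv (Finset.mem_filter.2 ⟨Finset.mem_univ _, h⟩)
  · rintro ⟨S', hS', hk'⟩
    have := hS2 S' hS'
    rw [hk, if_neg (by omega)]
  · intro h
    rw [hk, if_pos]
    by_contra hlt
    exact h ⟨S, hS1, by omega⟩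

/-- The memory after the loop limits have been set. -/
def startState (es : List (Fin n × Fin n)) (bag : Fin n → Fin p) (ts : List (Fin p × Fin p))
    (k : ℕ) : State :=
  (((inputState es bag ts k).setReg 5 (es.length + es.length)).setReg 6
    (es.length + es.length + (es.length + es.length) + 3)).setReg 7 (n + 1)

lemma startState_boundedBy (hT : IsPartitionTree G bag T) {es : List (Fin n × Fin n)}
    {ts : List (Fin p × Fin p)} (hes : IsEdgeList G es) (hts : IsEdgeList T ts) (k : ℕ) :
    (startState es bag ts k).BoundedBy (7 * (n + 1) ^ 2) := by
  have hm := hes.length_le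
  have hp := hT.le
  have hl : ts.length ≤ n * n := hts.length_le.trans (Nat.mul_le_mul hp hp)
  have hget : ∀ {q : ℕ} (l : List (Fin q × Fin q)) (f : Fin q × Fin q → Fin q) j, q ≤ n →
      (l.map fun e => (f e : ℕ)).getD j 0 ≤ 7 * (n + 1) ^ 2 := by
    intro q l f j hq
    rw [List.getD_eq_getElem?_getD, List.getElem?_map]
    cases l[j]? with
    | none => simp
    | some e =>
      have := (f e).2
      simp only [Option.map_some, Option.getD_some]
      nlinarith
  constructor
  · intro i hi
    simp only [startState, State.setReg_reg, inputState]
    split_ifs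
    · nlinarith
    · nlinarith
    · nlinarith
    · split <;> first | contradiction | nlinarith
  · intro A j
    simp only [startState, State.setReg_arr, inputState]
    split
    · exact hget es Prod.fst j le_rfl
    · exact hget es Prod.snd j le_rfl
    · split_ifs with h
      · have := (bag ⟨j, h⟩).2
        nlinarith
      · simp
    · exact hget ts Prod.fst j hp
    · exact hget ts Prod.snd j hp
    · simp

/-- The program solves every instance within the time bound, and without overflow. -/
theorem exists_runs_cvdProgram {C : ℕ} (hC : ∀ n m : ℕ, 0 < n → n ≤ m + 1 →
    30 + preparation.time (limitBound n m) + solution.time (limitBound n m) ≤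
      C * (m ^ 2 * n + 1)) (hconn : G.Connected) (hT : IsPartitionTree G bag T)
    {es : List (Fin n × Fin n)} {ts : List (Fin p × Fin p)} (hes : IsEdgeList G es)
    (hts : IsEdgeList T ts) {W : ℕ} (k : ℕ) (hW : (n + 1) ^ (C + 12) ≤ W) :
    ∃ (t : ℕ) (τ : State), Runs W cvdProgram (inputState es bag ts k) t τ ∧
      t ≤ C * (G.edgeSet.ncard ^ 2 * n + 1) ∧ IsSolution G k τ := by
  have hn : 0 < n := Fin.pos_iff_nonempty.2 hconn.nonempty
  have hm := hes.length_le
  have hp := hT.le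
  have hnm := le_length_add_one hconn hes
  have htime := hC n es.length hn hnm
  have hword := word_bound (C := C) hn hm hW
  rw [ncard_edgeSet hes]
  set m := es.length with hmdef
  set ρ := limitBound n m with hρ
  set M := 7 * (n + 1) ^ 2 with hM
  have hM1 : 4 * m + 3 ≤ M := by nlinarith
  have hM2 : n + 1 ≤ M := by nlinarith
  set σ := startState es bag ts k with hσ
  have hσb : σ.BoundedBy M := startState_boundedBy hT hes hts k
  have hrun0 : Runs W setLimits (inputState es bag ts k) 14 σ :=
    runs_setLimits (inputState es bag ts k) (show 4 * m + 3 ≤ W by omega)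
      (show n + 1 ≤ W by omega)
  obtain ⟨⟨t1, ht1, hrun1⟩, hb1⟩ := preparation.runs ρ (W := W) σ M preparation_good hσb (by omega)
    (by
      have : ∀ N ∈ preparation.limits, N = 5 ∨ N = 2 := by decide
      intro N hN
      rcases this N hN with rfl | rfl
      · exact le_rfl
      · exact hp) (by omega)
  have hlt : ∀ u v, natAdj G u v → u < n ∧ v < n := fun u v ⟨hu, hv, _⟩ => ⟨hu, hv⟩
  have hblt : ∀ v < n, natBag bag v < p := fun v hv => by
    rw [natBag, dif_pos hv]
    exact (bag _).2
  obtain ⟨⟨hS, hsurj⟩, h8, jx, jz, hJ, hI⟩ := preparation_spec (σ := σ) (n := n) (m := m) (p := p)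
    (E := natAdj G) (b := natBag bag) rfl rfl rfl rfl rfl rfl
    (by
      intro A hA j
      match A, hA with
      | A + 5, _ => rfl)
    (fun u v => natAdj_iff_getD hes u v) hlt hT.pos
    (fun u v h => ⟨hblt u (hlt u v h).1, hblt v (hlt u v h).2⟩) (hT.induction hconn)
    (fun U X hU => hT.card_mul_lt hconn hes hU) rfl
  have f : (∀ r ∈ [0, 2, 4, 5, 6, 7], (preparation.run σ).reg r = σ.reg r) ∧
      ∀ A ∈ [30], (preparation.run σ).arr A = σ.arr A :=
    Cmd.keeps_frame rfl (Cmd.frame_run preparation σ)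
  generalize preparation.run σ = σ' at hrun1 hb1 hS hsurj h8 hJ hI f
  simp only [List.mem_cons, List.not_mem_nil, or_false, forall_eq_or_imp, forall_eq] at f
  -- The number of jobs, computed by the first part, limits a loop of the second part.
  obtain ⟨⟨t2, ht2, hrun2⟩, -⟩ := solution.runs ρ (W := W) σ' _ solution_good hb1 (by omega)
    (by
      have : ∀ N ∈ solution.limits, N = 8 ∨ N = 0 ∨ N = 5 ∨ N = 2 ∨ N = 6 ∨ N = 7 := by decide
      intro N hN
      rcases this N hN with rfl | rfl | rfl | rfl | rfl | rfl
      · exact h8.trans (Nat.mul_le_mul_left 2 hp)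
      · exact f.1.1.le
      · exact f.1.2.2.2.1.le
      · exact f.1.2.1.le.trans hp
      · exact f.1.2.2.2.2.1.le
      · exact f.1.2.2.2.2.2.le) (by omega)
  obtain ⟨F, hF1, hF2, hF3, hF4, hF5⟩ := solution_spec (hS.rootedBags hsurj hT) rfl hJ hI hS hsurj
    (by
      rw [f.2]
      rfl)
  refine ⟨_, _, .seq hrun0 (.seq hrun1 hrun2), by omega,
    isSolution_of_isCluster hF1 hF2 hF3 hF4 ?_⟩
  rw [hF5, f.1.2.2.1]
  rfl

end WPC

theorem theorem1 :
    ∃ (A : RAM.Prog) (C c : ℕ),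
      ∀ (n p : ℕ) (G : SimpleGraph (Fin n)) (bag : Fin n → Fin p) (T : SimpleGraph (Fin p)),
        WPC.IsWellPartitionedChordal G → WPC.IsPartitionTree G bag T →
        ∀ (es : List (Fin n × Fin n)) (ts : List (Fin p × Fin p)),
          WPC.IsEdgeList G es → WPC.IsEdgeList T ts →
          ∀ W k : ℕ, (n + 1) ^ c ≤ W → k ≤ W →
            ∃ (t : ℕ) (τ : RAM.State),
              RAM.Runs W A (WPC.inputState es bag ts k) t τ ∧
              t ≤ C * (G.edgeSet.ncard ^ 2 * n + 1) ∧
              WPC.IsSolution G k τ := by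
  obtain ⟨C, hC⟩ := RAM.exists_time_le
  exact ⟨RAM.cvdProgram, C, C + 12, fun n p G bag T hG hT es ts hes hts W k hW _ =>
    WPC.exists_runs_cvdProgram hC hG.1 hT hes hts k hW⟩
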